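/- Let $T>0$ and $n\ge 1$, let $\mathbb T=\mathbb R/T\mathbb Z$ and $G=\mathbb T\times\mathbb R^n$ with dual group $\widehat G=\frac{2\pi}{T}\mathbb Z\times\mathbb R^n$, and write $\xi=(\xi',\xi_n)\in\mathbb R^{n-1}\times\mathbb R$. Let $$D(\tau,\xi)=\mathsf i\tau+|\xi|^2(\mathsf i\tau+|\xi|^2),\qquad \mu_D(\gamma)=\max\{4,2+\gamma\}\quad(\gamma>0)$$ be the symbol of $\partial_t-\Delta(\partial_t-\Delta)$ (the determinant of the Cahn–Hilliard–Gurtin system) and its order function. *Notation.* A strictly positive order function is a function $\mu(\gamma)=\max_{1\le j\le N}(r_j+\gamma s_j)$ on $(0,\infty)$ with $N\ge1$ and $r_j,s_j\ge 0$. Its Newton polygon is the convex hull of $(0,0)$ and of the points $(b,m),(b,0),(0,m)$, where $b+\gamma m$ runs through the affine pieces of $\mu$. With sums over the vertices $(r,s)\neq(0,0)$ of this polygon let $$W_\mu(\tau,\xi)=1+\sum|\tau|^{s}|\xi|^{r},\qquad w_\mu(\tau,\xi)=1+\sum(1+|\tau|^2)^{s/2}(1+|\xi|^2)^{r/2}.$$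 A function $P:(\mathbb R\setminus\{0\})\times\mathbb R^n\to\mathbb C$ is $\mathcal N$-elliptic for $\mu$ if it is smooth, if $|P|\le C\,W_\mu$ for some $C>0$, and if for every $\lambda>0$ there is $C_\lambda>0$ with $|P(\tau,\xi)|\ge C_\lambda W_\mu(\tau,\xi)$ whenever $|\tau|\ge\lambda$. The class $\mathcal O^\perp$ consists of the $m\in C^\infty((\mathbb R\setminus\{0\})\times\mathbb R^n)$ such that, for every smooth $\eta$ on $\mathbb R$ with $\mathbb 1_{[-\pi/T,\pi/T]}\le 1-\eta\le \mathbb 1_{[-2\pi/T,2\pi/T]}$, the function $\eta(\tau)m(\tau,\xi)$ is smooth on $\mathbb R\times\mathbb R^n$ with all derivatives polynomially bounded. For such $m$, $\mathsf{op}[m]$ denotes the Fourier multiplier on $G$ with symbol $m$, acting on functions with vanishing time average (so only the frequencies $\tau\in\frac{2\pi}T\mathbb Z\setminus\{0\}$ matter). $H^\mu_\perp(G)$ is the space of all $f\in L^2(G)$ with vanishing time average and $\|f\|_\mu:=\|\mathsf{op}[w_\mu]f\|_{L^2(G)}<\infty$. An operator between such spaces preserves upper (lower) support if it maps functions supported in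 $\{x_n\ge0\}$ (in $\{x_n\le 0\}$) to functions supported in the same set. For normed spaces, $\mathcal L_{\mathrm{iso}}$ denotes the linear isomorphisms that are bounded with bounded inverse. **Proposition.** There are symbols $D^+,D^-:(\mathbb R\setminus\{0\})\times\mathbb R^n\to\mathbb C$ in $\mathcal O^\perp$ such that for all $\tau\ne0$ and $\xi\in\mathbb R^n$ $$D^{\pm}(\tau,\xi)=\prod_{\rho}(\xi_n-\rho),\qquad D(\tau,\xi)=D^-(\tau,\xi)\,D^+(\tau,\xi),$$ where $\rho$ runs, with multiplicities, through the complex roots of the polynomial $D(\tau,\xi',\cdot)$ with $\operatorname{Im}\rho>0$ for $D^+$ and with $\operatorname{Im}\rho<0$ for $D^-$. Both $D^+$ and $D^-$ are $\mathcal N$-elliptic for the order function $\mu_\pm:=\tfrac12\mu_D$. Moreover, for every strictly positive order function $\nu$, $$\mathsf{op}[D]\in\mathcal L_{\mathrm{iso}}(H^{\mu_D+\nu}_\perp(G),H^\nu_\perp(G)),\quad \mathsf{op}[D^+]\in\mathcal L_{\mathrm{iso}}(H^{\mu_D+\nu}_\perp(G),H^{\mu_-+\nu}_\perp(G)),\quad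 \mathsf{op}[D^-]\in\mathcal L_{\mathrm{iso}}(H^{\mu_-+\nu}_\perp(G),H^{\nu}_\perp(G)),$$ and $\mathsf{op}[D]$ is admissible with these factors: $\mu_\pm$ are strictly positive order functions with $\mu_D=\mu_++\mu_-$, and 1. $\mathsf{op}[D]=\mathsf{op}[D^-]\,\mathsf{op}[D^+]$; 2. $\mathsf{op}[D^+]$ and $\mathsf{op}[D^-]$ preserve lower support; 3. $\mathsf{op}[D^+]$ and $\mathsf{op}[D^+]^{-1}$ preserve upper support; 4. $\mathsf{op}[D^-]^{-1}$ preserves lower support. -/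

import Mathlib

namespace CHG

noncomputable section

open MeasureTheory Set
open scoped ContDiff

/-! ## Order functions, Newton polygons and weight functions -/

/-- Real functions on `(0, ∞)`; only the strictly positive order functions below are used. -/
abbrev OrderFn : Type := Ioi (0 : ℝ) → ℝ

/-- `μ` is a strictly positive order function: `μ(γ) = max { r + γ s | (r, s) ∈ V }` for a finite
nonempty set `V` of points of `[0, ∞)²`. -/
def IsStrictlyPositiveOrder (μ : OrderFn) : Prop :=
  ∃ (V : Finset (ℝ × ℝ)) (hV : V.Nonempty), (∀ v ∈ V, 0 ≤ v.1 ∧ 0 ≤ v.2) ∧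
    ∀ γ : Ioi (0 : ℝ), μ γ = V.sup' hV (fun v => v.1 + (γ : ℝ) * v.2)

/-- The pairs `(b, m)` such that `μ(γ) = b + γ m` on some nonempty open interval, i.e. the
coefficients of the affine pieces of a piecewise affine `μ`. -/
def pieces (μ : OrderFn) : Set (ℝ × ℝ) :=
  {v | ∃ a b : ℝ, 0 ≤ a ∧ a < b ∧
    ∀ γ : Ioi (0 : ℝ), a < (γ : ℝ) → (γ : ℝ) < b → μ γ = v.1 + (γ : ℝ) * v.2}

/-- The Newton polygon of a set `E` of points: the convex hull of `E`, of its projections to the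
two coordinate axes and of the origin. -/
def newtonPolygon (E : Set (ℝ × ℝ)) : Set (ℝ × ℝ) :=
  convexHull ℝ (E ∪ (fun v => (v.1, 0)) '' E ∪ (fun v => (0, v.2)) '' E ∪ {(0, 0)})

/-- The vertices `(r, s)` of the Newton polygon of `μ`, other than the origin. -/
def vertices (μ : OrderFn) : Set (ℝ × ℝ) :=
  (newtonPolygon (pieces μ)).extremePoints ℝ \ {(0, 0)}

/-- The space variables `ξ = (ξ', ξ_n)` in `ℝⁿ` with `n = d + 1`. -/
abbrev Space (d : ℕ) : Type := EuclideanSpace ℝ (Fin (d + 1))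

/-- The last coordinate `ξ_n`. -/
def lastCoord {d : ℕ} (ξ : Space d) : ℝ := ξ (Fin.last d)

/-- `|ξ'|²`, where `ξ'` consists of the first `n - 1` coordinates of `ξ`. -/
def tangentialSq {d : ℕ} (ξ : Space d) : ℝ := ∑ i : Fin d, ξ i.castSucc ^ 2

/-- The weight function `W_μ(τ, ξ) = 1 + ∑ |τ|^s |ξ|^r` over the vertices `(r, s) ≠ 0`. -/
def weight {d : ℕ} (μ : OrderFn) (p : ℝ × Space d) : ℝ :=
  1 + ∑ᶠ v ∈ vertices μ, |p.1| ^ v.2 * ‖p.2‖ ^ v.1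

/-- The smooth weight function `w_μ(τ, ξ) = 1 + ∑ ⟨τ⟩^s ⟨ξ⟩^r` over the vertices `(r, s) ≠ 0`, with
`⟨x⟩ = (1 + |x|²)^(1/2)`. -/
def smoothWeight {d : ℕ} (μ : OrderFn) (p : ℝ × Space d) : ℝ :=
  1 + ∑ᶠ v ∈ vertices μ, (1 + |p.1| ^ 2) ^ (v.2 / 2) * (1 + ‖p.2‖ ^ 2) ^ (v.1 / 2)

theorem smoothWeight_pos {d : ℕ} (μ : OrderFn) (p : ℝ × Space d) : 0 < smoothWeight μ p := by
  have : 0 ≤ ∑ᶠ v ∈ vertices μ, (1 + |p.1| ^ 2) ^ (v.2 / 2) * (1 + ‖p.2‖ ^ 2) ^ (v.1 / 2) :=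
    finsum_nonneg fun v => finsum_nonneg fun _ => by positivity
  unfold smoothWeight
  linarith

/-! ## Symbols -/

/-- `P` is smooth on `(ℝ \ {0}) × ℝⁿ` and `𝒩`-elliptic for the order function `μ`. -/
def IsNElliptic {d : ℕ} (P : ℝ × Space d → ℂ) (μ : OrderFn) : Prop :=
  ContDiffOn ℝ ∞ P {p | p.1 ≠ 0} ∧
  (∃ C : ℝ, 0 < C ∧ ∀ p : ℝ × Space d, p.1 ≠ 0 → ‖P p‖ ≤ C * weight μ p) ∧
  ∀ lam : ℝ, 0 < lam → ∃ C : ℝ, 0 < C ∧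
    ∀ p : ℝ × Space d, lam ≤ |p.1| → C * weight μ p ≤ ‖P p‖

/-- Smooth cut-offs `η` in frequency with `1_[-π/T, π/T] ≤ 1 - η ≤ 1_[-2π/T, 2π/T]`. -/
def IsCutoff (T : ℝ) (η : ℝ → ℝ) : Prop :=
  ContDiff ℝ ∞ η ∧ ∀ τ : ℝ,
    (Icc (-(Real.pi / T)) (Real.pi / T)).indicator 1 τ ≤ 1 - η τ ∧
    1 - η τ ≤ (Icc (-(2 * Real.pi / T)) (2 * Real.pi / T)).indicator 1 τ

/-- The class `𝒪^⊥` of symbols `m`, smooth on `(ℝ \ {0}) × ℝⁿ`, such that `η m` is smooth on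
`ℝ × ℝⁿ` with all derivatives polynomially bounded. -/
def IsPerpSymbol {d : ℕ} (T : ℝ) (m : ℝ × Space d → ℂ) : Prop :=
  ContDiffOn ℝ ∞ m {p | p.1 ≠ 0} ∧
  ∀ η : ℝ → ℝ, IsCutoff T η → Function.HasTemperateGrowth (fun p => (η p.1 : ℂ) * m p)

/-- The symbol `D(τ, ξ) = iτ + |ξ|² (iτ + |ξ|²)` of `∂ₜ - Δ(∂ₜ - Δ)`. -/
def chgSymbol {d : ℕ} (p : ℝ × Space d) : ℂ :=
  Complex.I * (p.1 : ℂ) +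
    ((‖p.2‖ ^ 2 : ℝ) : ℂ) * (Complex.I * (p.1 : ℂ) + ((‖p.2‖ ^ 2 : ℝ) : ℂ))

/-- The order function `μ_D(γ) = max {4, 2 + γ}`. -/
def chgOrder : OrderFn := fun γ => max 4 (2 + (γ : ℝ))

/-- The polynomial `D(τ, ξ', ·)`, in which `z ∈ ℂ` replaces the last coordinate `ξ_n` of `ξ`, so
that `|ξ'|² + z²` replaces `|ξ|²`. -/
def chgPoly {d : ℕ} (p : ℝ × Space d) : Polynomial ℂ :=
  let S : Polynomial ℂ := Polynomial.C ((tangentialSq p.2 : ℝ) : ℂ) + Polynomial.X ^ 2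
  let t : Polynomial ℂ := Polynomial.C (Complex.I * (p.1 : ℂ))
  t + S * (t + S)

open Classical in
/-- The product of the factors `ξ_n - ρ` over the roots `ρ` of `D(τ, ξ', ·)` lying in `Z`, with
multiplicities. -/
def rootFactor {d : ℕ} (Z : Set ℂ) (p : ℝ × Space d) : ℂ :=
  (((chgPoly p).roots.filter (fun ρ => ρ ∈ Z)).map (fun ρ => (lastCoord p.2 : ℂ) - ρ)).prod

/-! ## The group `G = 𝕋 × ℝⁿ` and its Fourier transform on `L²` -/

/-- The Haar measure on `G = 𝕋 × ℝⁿ`, with `𝕋 = ℝ / Tℤ` of total mass one. -/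
abbrev haarG (T : ℝ) [Fact (0 < T)] (d : ℕ) : Measure (AddCircle T × Space d) :=
  AddCircle.haarAddCircle.prod volume

/-- The space `L²(G)`. -/
abbrev L2G (T : ℝ) [Fact (0 < T)] (d : ℕ) : Type := Lp ℂ 2 (haarG T d)

/-- The space `L²(ℝⁿ)`. -/
abbrev L2Space (d : ℕ) : Type := Lp ℂ 2 (volume : Measure (Space d))

section Fourier

variable {T : ℝ} [hT : Fact (0 < T)] {d : ℕ}

theorem ae_slice {p : AddCircle T × Space d → Prop} (h : ∀ᵐ z ∂haarG T d, p z) :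
    ∀ᵐ x : Space d, ∀ᵐ t ∂(AddCircle.haarAddCircle (T := T)), p (t, x) :=
  Measure.ae_ae_of_ae_prod (p := fun z : Space d × AddCircle T => p z.swap)
    (Measure.measurePreserving_swap.quasiMeasurePreserving.ae h)

theorem memLp_slice (f : L2G T d) :
    ∀ᵐ x : Space d, MemLp (fun t => f (t, x)) 2 AddCircle.haarAddCircle := by
  have hf : MemLp f 2 (AddCircle.haarAddCircle.prod volume) := Lp.memLp f
  have hs : AEStronglyMeasurable (fun z : Space d × AddCircle T => f z.swap)
      (volume.prod AddCircle.haarAddCircle) := hf.1.prod_swap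
  have hfin : ∫⁻ x : Space d, ∫⁻ t : AddCircle T, ‖f (t, x)‖ₑ ^ (2 : ℝ) ∂AddCircle.haarAddCircle
      ≠ ⊤ := by
    rw [← lintegral_prod_symm _ (hf.1.enorm.pow_const _)]
    have := lintegral_rpow_enorm_lt_top_of_eLpNorm_lt_top (by norm_num) (by norm_num) hf.2
    simpa using this.ne
  have hae := ae_lt_top' (f := fun x : Space d =>
      ∫⁻ t : AddCircle T, ‖f (t, x)‖ₑ ^ (2 : ℝ) ∂AddCircle.haarAddCircle)
    ((hs.enorm.pow_const _).lintegral_prod_right') hfin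
  filter_upwards [hae, hs.prodMk_left] with x hx hm
  refine ⟨hm, ?_⟩
  rw [eLpNorm_lt_top_iff_lintegral_rpow_enorm_lt_top (by norm_num) (by norm_num)]
  simpa using hx

theorem memLp_timeCoeff (f : L2G T d) (k : ℤ) :
    MemLp (fun x : Space d => fourierCoeff (fun t => f (t, x)) k) 2 volume := by
  have hf : MemLp f 2 (AddCircle.haarAddCircle.prod volume) := Lp.memLp f
  have hs : AEStronglyMeasurable (fun z : Space d × AddCircle T => f z.swap)
      (volume.prod AddCircle.haarAddCircle) := hf.1.prod_swap
  have hm : AEStronglyMeasurable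
      (fun x : Space d => fourierCoeff (fun t => f (t, x)) k) volume := by
    have hk : AEStronglyMeasurable
        (fun z : Space d × AddCircle T => fourier (-k) z.2 • f z.swap)
        (volume.prod AddCircle.haarAddCircle) :=
      (((map_continuous (fourier (-k))).comp continuous_snd).aestronglyMeasurable).smul hs
    exact hk.integral_prod_right'
  refine ⟨hm, ?_⟩
  rw [eLpNorm_lt_top_iff_lintegral_rpow_enorm_lt_top (by norm_num) (by norm_num)]
  have hfin : ∫⁻ x : Space d, ∫⁻ t : AddCircle T, ‖f (t, x)‖ₑ ^ (2 : ℝ) ∂AddCircle.haarAddCircle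
      < ⊤ := by
    rw [← lintegral_prod_symm _ (hf.1.enorm.pow_const _)]
    have := lintegral_rpow_enorm_lt_top_of_eLpNorm_lt_top (by norm_num) (by norm_num) hf.2
    simpa using this
  refine lt_of_le_of_lt (lintegral_mono_ae ?_) hfin
  filter_upwards [memLp_slice f] with x hx
  have h1 : ‖fourierCoeff (fun t => f (t, x)) k‖ₑ
      ≤ eLpNorm (fun t => f (t, x)) 1 AddCircle.haarAddCircle := by
    unfold fourierCoeff
    refine (enorm_integral_le_lintegral_enorm _).trans ?_
    rw [eLpNorm_one_eq_lintegral_enorm]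
    refine lintegral_mono fun t => ?_
    rw [enorm_smul]
    have : ‖fourier (-k) t‖ₑ = 1 := by
      rw [fourier_apply, ← ofReal_norm, Circle.norm_coe, ENNReal.ofReal_one]
    rw [this, one_mul]
  have h2 : eLpNorm (fun t => f (t, x)) 1 AddCircle.haarAddCircle
      ≤ eLpNorm (fun t => f (t, x)) 2 AddCircle.haarAddCircle :=
    eLpNorm_le_eLpNorm_of_exponent_le (by norm_num) hx.1
  have h3 := ENNReal.rpow_le_rpow (h1.trans h2) (by norm_num : (0 : ℝ) ≤ 2)
  rw [eLpNorm_eq_lintegral_rpow_enorm_toReal (by norm_num) (by norm_num), ← ENNReal.rpow_mul] at h3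
  simpa using h3

/-- The `k`-th Fourier coefficient in time `x ↦ ∫_𝕋 f(t, x) e^{-2πikt/T} dt` of `f ∈ L²(G)`, an
element of `L²(ℝⁿ)`. For `k = 0` it is the time average of `f`. -/
def timeCoeff (f : L2G T d) (k : ℤ) : L2Space d := (memLp_timeCoeff f k).toLp _

/-- The Fourier transform of `f ∈ L²(G)`, on the dual group indexed by `ℤ × ℝⁿ`. The point `(k, ξ)`
stands for the frequency `freq T (k, ξ)`. -/
def fourierG (f : L2G T d) (k : ℤ) : L2Space d := Lp.fourierTransformₗᵢ (Space d) ℂ (timeCoeff f k)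

theorem timeCoeff_add (f g : L2G T d) (k : ℤ) :
    timeCoeff (f + g) k = timeCoeff f k + timeCoeff g k := by
  unfold timeCoeff
  rw [← MemLp.toLp_add]
  refine MemLp.toLp_congr _ _ ?_
  have hae : ∀ᵐ x : Space d, ∀ᵐ t ∂(AddCircle.haarAddCircle (T := T)),
      (f + g : L2G T d) (t, x) = f (t, x) + g (t, x) :=
    ae_slice (p := fun z => (f + g : L2G T d) z = f z + g z) (Lp.coeFn_add f g)
  filter_upwards [hae, memLp_slice f, memLp_slice g] with x hx hf hg
  have := fourierCoeff.add (hf.integrable (by norm_num)) (hg.integrable (by norm_num))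
  rw [Pi.add_apply, ← Pi.add_apply (fourierCoeff _) (fourierCoeff _), ← this]
  exact congrFun (fourierCoeff_congr_ae hx) k

theorem timeCoeff_smul (c : ℂ) (f : L2G T d) (k : ℤ) :
    timeCoeff (c • f) k = c • timeCoeff f k := by
  unfold timeCoeff
  rw [← MemLp.toLp_const_smul]
  refine MemLp.toLp_congr _ _ ?_
  have hae : ∀ᵐ x : Space d, ∀ᵐ t ∂(AddCircle.haarAddCircle (T := T)),
      (c • f : L2G T d) (t, x) = c • f (t, x) :=
    ae_slice (p := fun z => (c • f : L2G T d) z = c • f z) (Lp.coeFn_smul c f)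
  filter_upwards [hae] with x hx
  rw [Pi.smul_apply, ← fourierCoeff.const_smul]
  exact congrFun (fourierCoeff_congr_ae hx) k

theorem fourierG_add (f g : L2G T d) (k : ℤ) :
    fourierG (f + g) k = fourierG f k + fourierG g k := by
  unfold fourierG
  rw [timeCoeff_add, map_add]

theorem fourierG_smul (c : ℂ) (f : L2G T d) (k : ℤ) :
    fourierG (c • f) k = c • fourierG f k := by
  unfold fourierG
  rw [timeCoeff_smul, map_smul]

theorem eq_zero_of_fourierG (f : L2G T d) (h : ∀ k, fourierG f k = 0) : f = 0 := by
  have h0 : ∀ k, timeCoeff f k = 0 := fun k =>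
    (LinearIsometryEquiv.map_eq_zero_iff _).1 (h k)
  have h1 : ∀ᵐ x : Space d, ∀ k : ℤ, fourierCoeff (fun t => f (t, x)) k = 0 := by
    rw [ae_all_iff]
    intro k
    have h2 := (memLp_timeCoeff f k).coeFn_toLp
    have h3 : (timeCoeff f k : Space d → ℂ) =ᵐ[volume] 0 := by
      rw [h0 k]
      exact Lp.coeFn_zero _ _ _
    filter_upwards [h2, h3] with x hx hx'
    exact hx.symm.trans hx'
  have h4 : ∀ᵐ x : Space d, ∀ᵐ t ∂(AddCircle.haarAddCircle (T := T)), f (t, x) = 0 := by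
    filter_upwards [h1, memLp_slice f] with x hx hm
    have h5 : hm.toLp _ = 0 := by
      apply (fourierBasis (T := T)).repr.injective
      ext k
      rw [fourierBasis_repr, map_zero, congrFun (fourierCoeff_congr_ae hm.coeFn_toLp) k, hx k]
      rfl
    have h6 := hm.coeFn_toLp
    rw [h5] at h6
    filter_upwards [h6, Lp.coeFn_zero ℂ 2 (AddCircle.haarAddCircle (T := T))] with t ht ht'
    rw [← ht, ht']
    rfl
  have hmeas : MeasurableSet {z : Space d × AddCircle T | f z.swap = 0} :=
    ((Lp.stronglyMeasurable f).measurable.comp measurable_swap) (measurableSet_singleton 0)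
  have h7 : ∀ᵐ z ∂((volume : Measure (Space d)).prod (AddCircle.haarAddCircle (T := T))),
      f z.swap = 0 := (Measure.ae_prod_iff_ae_ae hmeas).2 h4
  have h8 : ∀ᵐ z ∂haarG T d, f z = 0 := by
    have := Measure.measurePreserving_swap.quasiMeasurePreserving.ae h7
    simpa using this
  refine Lp.ext ?_
  filter_upwards [h8, Lp.coeFn_zero ℂ 2 (haarG T d)] with z hz hz'
  rw [hz, hz', Pi.zero_apply]

/-- The frequency `(2πk/T, 2πξ) ∈ (2π/T)ℤ × ℝⁿ` belonging to `(k, ξ)`; the factor `2π` in space is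
due to the normalization `e^{-2πi x·ξ}` of the Fourier transform on `L²(ℝⁿ)`. -/
def freq (T : ℝ) {d : ℕ} (k : ℤ) (ξ : Space d) : ℝ × Space d :=
  (2 * Real.pi * k / T, (2 * Real.pi) • ξ)

/-- `g = op[m] f` for `f, g ∈ L²(G)`: the Fourier transform of `g` is `m` times that of `f`. -/
def IsMultiplier (m : ℝ × Space d → ℂ) (f g : L2G T d) : Prop :=
  ∀ k : ℤ, ∀ᵐ ξ : Space d, fourierG g k ξ = m (freq T k ξ) * fourierG f k ξ

theorem IsMultiplier.add {m : ℝ × Space d → ℂ} {f g f' g' : L2G T d}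
    (h : IsMultiplier m f g) (h' : IsMultiplier m f' g') : IsMultiplier m (f + f') (g + g') := by
  intro k
  rw [fourierG_add, fourierG_add]
  filter_upwards [h k, h' k, Lp.coeFn_add (fourierG f k) (fourierG f' k),
    Lp.coeFn_add (fourierG g k) (fourierG g' k)] with ξ h1 h2 h3 h4
  rw [h3, h4, Pi.add_apply, Pi.add_apply, h1, h2, mul_add]

theorem IsMultiplier.smul {m : ℝ × Space d → ℂ} {f g : L2G T d} (c : ℂ)
    (h : IsMultiplier m f g) : IsMultiplier m (c • f) (c • g) := by
  intro k
  rw [fourierG_smul, fourierG_smul]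
  filter_upwards [h k, Lp.coeFn_smul c (fourierG f k), Lp.coeFn_smul c (fourierG g k)]
    with ξ h1 h2 h3
  rw [h2, h3, Pi.smul_apply, Pi.smul_apply, h1, smul_eq_mul, smul_eq_mul, mul_left_comm]

theorem fourierG_zero (k : ℤ) : fourierG (0 : L2G T d) k = 0 := by
  simpa using fourierG_smul (0 : ℂ) (0 : L2G T d) k

theorem IsMultiplier.zero (m : ℝ × Space d → ℂ) : IsMultiplier m (0 : L2G T d) 0 := by
  intro k
  rw [fourierG_zero]
  filter_upwards [Lp.coeFn_zero ℂ 2 (volume : Measure (Space d))] with ξ h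
  rw [h, Pi.zero_apply, mul_zero]

theorem IsMultiplier.unique {m : ℝ × Space d → ℂ} {f g g' : L2G T d}
    (h : IsMultiplier m f g) (h' : IsMultiplier m f g') : g = g' := by
  rw [← sub_eq_zero]
  refine eq_zero_of_fourierG _ fun k => ?_
  have : g - g' = g + (-1 : ℂ) • g' := by rw [neg_one_smul, sub_eq_add_neg]
  rw [this, fourierG_add, fourierG_smul, neg_one_smul, ← sub_eq_add_neg, sub_eq_zero]
  refine Lp.ext ?_
  filter_upwards [h k, h' k] with ξ h1 h2
  rw [h1, h2]

theorem IsMultiplier.eq_zero {m : ℝ × Space d → ℂ} (hm : ∀ p, m p ≠ 0) {f : L2G T d}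
    (h : IsMultiplier m f 0) : f = 0 := by
  refine eq_zero_of_fourierG _ fun k => Lp.ext ?_
  have h' := h k
  rw [fourierG_zero] at h'
  filter_upwards [h', Lp.coeFn_zero ℂ 2 (volume : Measure (Space d))] with ξ h1 h2
  rw [h2, Pi.zero_apply] at h1
  rw [h2, Pi.zero_apply]
  exact (mul_eq_zero.1 h1.symm).resolve_left (hm _)

end Fourier

/-! ## Purely oscillatory Newton polygon potential spaces -/

section Spaces

variable (T : ℝ) [hT : Fact (0 < T)] (d : ℕ) (μ : OrderFn)

/-- The set of all `f ∈ L²(G)` with vanishing time average and `op[w_μ] f ∈ L²(G)`. -/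
def newtonSubmodule : Submodule ℂ (L2G T d) where
  carrier := {f | timeCoeff f 0 = 0 ∧ ∃ g, IsMultiplier (fun p => (smoothWeight μ p : ℂ)) f g}
  add_mem' := by
    rintro f f' ⟨h0, g, h⟩ ⟨h0', g', h'⟩
    exact ⟨by rw [timeCoeff_add, h0, h0', add_zero], g + g', h.add h'⟩
  zero_mem' := ⟨by simpa using timeCoeff_smul (0 : ℂ) (0 : L2G T d) 0, 0, IsMultiplier.zero _⟩
  smul_mem' := by
    rintro c f ⟨h0, g, h⟩
    exact ⟨by rw [timeCoeff_smul, h0, smul_zero], c • g, h.smul c⟩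

/-- The space `H^μ_⊥(G)` for a strictly positive order function `μ`; its norm is
`‖f‖_μ = ‖op[w_μ] f‖_{L²(G)}`. -/
def NewtonSpace : Type := newtonSubmodule T d μ

instance : AddCommGroup (NewtonSpace T d μ) :=
  inferInstanceAs (AddCommGroup (newtonSubmodule T d μ))

instance : Module ℂ (NewtonSpace T d μ) :=
  inferInstanceAs (Module ℂ (newtonSubmodule T d μ))

variable {T d μ}

/-- The inclusion of `H^μ_⊥(G)` into `L²(G)`. -/
def toL2 : NewtonSpace T d μ →ₗ[ℂ] L2G T d := (newtonSubmodule T d μ).subtype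

/-- The operator `op[w_μ] : H^μ_⊥(G) → L²(G)`. -/
def opWeight : NewtonSpace T d μ →ₗ[ℂ] L2G T d where
  toFun f := f.2.2.choose
  map_add' f f' :=
    IsMultiplier.unique (f + f').2.2.choose_spec (f.2.2.choose_spec.add f'.2.2.choose_spec)
  map_smul' c f := IsMultiplier.unique (c • f).2.2.choose_spec (f.2.2.choose_spec.smul c)

theorem opWeight_spec (f : NewtonSpace T d μ) :
    IsMultiplier (fun p => (smoothWeight μ p : ℂ)) (toL2 f) (opWeight f) :=
  f.2.2.choose_spec

theorem opWeight_injective : Function.Injective (opWeight (T := T) (d := d) (μ := μ)) := by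
  rw [injective_iff_map_eq_zero]
  intro f hf
  have h := opWeight_spec f
  rw [hf] at h
  exact Subtype.ext (h.eq_zero fun p => Complex.ofReal_ne_zero.2 (smoothWeight_pos μ p).ne')

instance : NormedAddCommGroup (NewtonSpace T d μ) :=
  NormedAddCommGroup.induced (NewtonSpace T d μ) (L2G T d) opWeight opWeight_injective

instance : NormedSpace ℂ (NewtonSpace T d μ) :=
  NormedSpace.induced ℂ (NewtonSpace T d μ) (L2G T d) opWeight

end Spaces

/-! ## Operators, preservation of support, and admissibility -/

section Operators

variable {T : ℝ} [hT : Fact (0 < T)] {d : ℕ} {μ μ' : OrderFn}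

/-- `A = op[m]` on purely oscillatory spaces, i.e. `A` is the Fourier multiplier operator with
symbol `(1 - δ_ℤ) m`, where `δ_ℤ` is the indicator function of the frequency zero in time. -/
def IsOp (m : ℝ × Space d → ℂ) (A : NewtonSpace T d μ →L[ℂ] NewtonSpace T d μ') : Prop :=
  ∀ f, IsMultiplier (fun p => if p.1 = 0 then 0 else m p) (toL2 f) (toL2 (A f))

/-- `supp f ⊆ 𝕋 × {x_n ≥ 0}`. -/
def IsSupportedUpper (f : L2G T d) : Prop := ∀ᵐ z ∂haarG T d, lastCoord z.2 < 0 → f z = 0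

/-- `supp f ⊆ 𝕋 × {x_n ≤ 0}`. -/
def IsSupportedLower (f : L2G T d) : Prop := ∀ᵐ z ∂haarG T d, 0 < lastCoord z.2 → f z = 0

/-- `A` preserves upper support. -/
def PreservesUpper (A : NewtonSpace T d μ →L[ℂ] NewtonSpace T d μ') : Prop :=
  ∀ f, IsSupportedUpper (toL2 f) → IsSupportedUpper (toL2 (A f))

/-- `A` preserves lower support. -/
def PreservesLower (A : NewtonSpace T d μ →L[ℂ] NewtonSpace T d μ') : Prop :=
  ∀ f, IsSupportedLower (toL2 f) → IsSupportedLower (toL2 (A f))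

/-- The isomorphism `A : H^{μ+ν}_⊥(G) → H^ν_⊥(G)` is admissible, with the order functions `μp` and `μm`
in the roles of `μ_+`, `μ_-` and with the factors `Ap`, `Am` in the roles of `A^+`, `A^-`. -/
structure IsAdmissible {μ ν : OrderFn} (μp : OrderFn) {μm : OrderFn}
    (A : NewtonSpace T d (μ + ν) ≃L[ℂ] NewtonSpace T d ν)
    (Ap : NewtonSpace T d (μ + ν) ≃L[ℂ] NewtonSpace T d (μm + ν))
    (Am : NewtonSpace T d (μm + ν) ≃L[ℂ] NewtonSpace T d ν) : Prop where
  pos : IsStrictlyPositiveOrder μ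
  pos_nu : IsStrictlyPositiveOrder ν
  pos_plus : IsStrictlyPositiveOrder μp
  pos_minus : IsStrictlyPositiveOrder μm
  order_eq : μ = μp + μm
  factor : ∀ f, A f = Am (Ap f)
  plus_lower : PreservesLower (Ap : NewtonSpace T d (μ + ν) →L[ℂ] NewtonSpace T d (μm + ν))
  minus_lower : PreservesLower (Am : NewtonSpace T d (μm + ν) →L[ℂ] NewtonSpace T d ν)
  plus_upper : PreservesUpper (Ap : NewtonSpace T d (μ + ν) →L[ℂ] NewtonSpace T d (μm + ν))
  plus_symm_upper :
    PreservesUpper (Ap.symm : NewtonSpace T d (μm + ν) →L[ℂ] NewtonSpace T d (μ + ν))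
  minus_symm_lower :
    PreservesLower (Am.symm : NewtonSpace T d ν →L[ℂ] NewtonSpace T d (μm + ν))

end Operators

end

end CHG

open CHG

/-! As a polynomial in `y = |ξ|²` the symbol is `y² + iτy + iτ = (y + b₁)(y + b₂)`. With `l = |ξ'|²`
the roots in `ξ_n` are therefore `±i√(l + b₁)` and `±i√(l + b₂)`, and for `τ ≠ 0` none of them is
real. Multiplying the two factors of one half plane gives `ξ_n² ∓ i q ξ_n - p`, where `p² = D(τ, ξ',
0)` and `q² = 2l + iτ + 2p`. So both factors are explicit in terms of two nested principal square
roots (`factorSymbol`, `rootFactor_eq`), and their regularity reduces to `TemperateOn.sqrt`.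

Ellipticity: each factor is at most a constant times the weight of `μ_D/2`, directly from its terms.
Since `Re D = |ξ|⁴` and `Im D = τ(1 + |ξ|²)`, the product `D` dominates the square of that weight
for `|τ| ≥ λ`. The upper bound for one factor is thus a lower bound for the other
(`halfWeight_le_norm_factorSymbol`).

Isomorphisms: on the curve `⟨τ⟩ = ⟨ξ⟩^γ` the weight `w_μ` is comparable to `⟨ξ⟩^{μ(γ)}` (`growth`),
which turns sums of order functions into products. Hence `w_{μ+ν}` is comparable to `|m| w_ν` when
`m` grows like `w_μ`, and Plancherel on `𝕋 × ℝⁿ` gives bounded operators in both directions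
(`HasGrowth.exists_isOp_equiv`).

Supports: a Paley–Wiener argument is replaced by algebra and limits. At a fixed frequency in time,
the bounded multipliers preserving a half space form an algebra that contains the translations into
the half space and is closed under bounded pointwise limits and under Neumann series. Tangential
translations generate the resolvent of the tangential Laplacian, hence all bounded continuous
functions of `|ξ'|²` (`tangential_mem`). One-sided normal difference quotients then yield `(ξ_n -
σic)⁻¹` when `Re c ≥ ε > 0` (`inv_normal_sub_mem`), and so the inverse factors. The factors
themselves are limits of multipliers in the algebra, dominated because the factors are elliptic
(`halfSupported_polynomial`); this works for either half space. -/

namespace CHG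
open MeasureTheory Set
open scoped ContDiff

/-! ### Smooth functions with polynomially bounded derivatives on an open set. -/

section Temperate

variable {E F F₁ F₂ : Type*} [NormedAddCommGroup E] [NormedSpace ℝ E]
  [NormedAddCommGroup F] [NormedSpace ℝ F] [NormedAddCommGroup F₁] [NormedSpace ℝ F₁]
  [NormedAddCommGroup F₂] [NormedSpace ℝ F₂]

/-- The derivatives of `f` on `U` up to order `N` are polynomially bounded. -/
def PolyBounded (U : Set E) (N : ℕ) (f : E → F) : Prop :=
  ∃ (k : ℕ) (C : ℝ), 0 ≤ C ∧ ∀ n ≤ N, ∀ x ∈ U,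
    ‖iteratedFDerivWithin ℝ n f U x‖ ≤ C * (1 + ‖x‖) ^ k

/-- `f` is smooth on `U` with polynomially bounded derivatives. -/
def TemperateOn (U : Set E) (f : E → F) : Prop :=
  ContDiffOn ℝ ∞ f U ∧ ∀ N, PolyBounded U N f

variable {U : Set E}

theorem PolyBounded.congr {N : ℕ} {f g : E → F} (hf : PolyBounded U N f) (h : EqOn g f U) :
    PolyBounded U N g := by
  obtain ⟨k, C, hC, H⟩ := hf
  refine ⟨k, C, hC, fun n hn x hx => ?_⟩
  rw [iteratedFDerivWithin_congr h hx]
  exact H n hn x hx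

/-- The Leibniz rule; the binomial coefficients add up to at most `2 ^ N`. Fixing the order `N`
allows products inside an induction on `N`, before all derivatives are under control. -/
theorem PolyBounded.bilinear (hU : UniqueDiffOn ℝ U) (B : F →L[ℝ] F₁ →L[ℝ] F₂) {N : ℕ}
    {f : E → F} {g : E → F₁} (hf' : ContDiffOn ℝ ∞ f U) (hg' : ContDiffOn ℝ ∞ g U)
    (hf : PolyBounded U N f) (hg : PolyBounded U N g) :
    PolyBounded U N (fun x => B (f x) (g x)) := by
  obtain ⟨k, C, hC, H⟩ := hf
  obtain ⟨k', C', hC', H'⟩ := hg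
  refine ⟨k + k', ‖B‖ * (2 ^ N * (C * C')), by positivity, fun n hn x hx => ?_⟩
  have hx1 : (1 : ℝ) ≤ 1 + ‖x‖ := by simp
  have h1 := B.norm_iteratedFDerivWithin_le_of_bilinear hf' hg' hU hx (n := n) (by exact_mod_cast le_top)
  refine h1.trans ?_
  rw [mul_assoc]
  refine mul_le_mul_of_nonneg_left ?_ B.opNorm_nonneg
  have h2 : ∀ i ∈ Finset.range (n + 1),
      (n.choose i : ℝ) * ‖iteratedFDerivWithin ℝ i f U x‖ *
        ‖iteratedFDerivWithin ℝ (n - i) g U x‖ ≤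
      (n.choose i : ℝ) * (C * C' * (1 + ‖x‖) ^ (k + k')) := by
    intro i hi
    rw [Finset.mem_range] at hi
    have e1 := H i (by omega) x hx
    have e2 := H' (n - i) (by omega) x hx
    rw [mul_assoc]
    refine mul_le_mul_of_nonneg_left ?_ (by positivity)
    calc _ ≤ (C * (1 + ‖x‖) ^ k) * (C' * (1 + ‖x‖) ^ k') := by gcongr
      _ = _ := by ring
  refine (Finset.sum_le_sum h2).trans ?_
  rw [← Finset.sum_mul]
  have h3 : (∑ i ∈ Finset.range (n + 1), (n.choose i : ℝ)) = 2 ^ n := by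
    exact_mod_cast Nat.sum_range_choose n
  rw [h3, ← mul_assoc]
  have h4 : (2 : ℝ) ^ n ≤ 2 ^ N := pow_le_pow_right₀ (by norm_num) hn
  gcongr

/-- The induction step for functions whose derivative is expressed through themselves, such as
inverse square roots. -/
theorem PolyBounded.of_fderivWithin (hU : UniqueDiffOn ℝ U) {N : ℕ} {f : E → F}
    (h0 : PolyBounded U 0 f) (h : PolyBounded U N (fderivWithin ℝ f U)) :
    PolyBounded U (N + 1) f := by
  obtain ⟨k, C, hC, H⟩ := h0
  obtain ⟨k', C', hC', H'⟩ := h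
  refine ⟨k + k', C + C', by positivity, fun n hn x hx => ?_⟩
  have hx1 : (1 : ℝ) ≤ 1 + ‖x‖ := by simp
  have e1 : (1 + ‖x‖) ^ k ≤ (1 + ‖x‖) ^ (k + k') := pow_le_pow_right₀ hx1 (by omega)
  have e2 : (1 + ‖x‖) ^ k' ≤ (1 + ‖x‖) ^ (k + k') := pow_le_pow_right₀ hx1 (by omega)
  have e3 : 0 ≤ C * (1 + ‖x‖) ^ (k + k') := by positivity
  have e4 : 0 ≤ C' * (1 + ‖x‖) ^ (k + k') := by positivity
  rcases n with _ | n
  · have := H 0 le_rfl x hx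
    have := mul_le_mul_of_nonneg_left e1 hC
    linarith
  · rw [← norm_iteratedFDerivWithin_fderivWithin hU hx]
    have := H' n (by omega) x hx
    have := mul_le_mul_of_nonneg_left e2 hC'
    linarith

theorem PolyBounded.fderivWithin (hU : UniqueDiffOn ℝ U) {N : ℕ} {f : E → F}
    (h : PolyBounded U (N + 1) f) : PolyBounded U N (fderivWithin ℝ f U) := by
  obtain ⟨k, C, hC, H⟩ := h
  refine ⟨k, C, hC, fun n hn x hx => ?_⟩
  rw [norm_iteratedFDerivWithin_fderivWithin hU hx]
  exact H (n + 1) (by omega) x hx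

theorem PolyBounded.mono {N M : ℕ} (h : M ≤ N) {f : E → F}
    (hf : PolyBounded U N f) : PolyBounded U M f := by
  obtain ⟨k, C, hC, H⟩ := hf
  exact ⟨k, C, hC, fun n hn => H n (hn.trans h)⟩

theorem TemperateOn.congr {f g : E → F} (hf : TemperateOn U f) (h : EqOn g f U) :
    TemperateOn U g :=
  ⟨hf.1.congr h, fun N => (hf.2 N).congr h⟩

theorem TemperateOn.bilinear (hU : UniqueDiffOn ℝ U) (B : F →L[ℝ] F₁ →L[ℝ] F₂)
    {f : E → F} {g : E → F₁} (hf : TemperateOn U f) (hg : TemperateOn U g) :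
    TemperateOn U (fun x => B (f x) (g x)) :=
  ⟨B.isBoundedBilinearMap.contDiff.comp_contDiffOn (hf.1.prodMk hg.1),
    fun N => (hf.2 N).bilinear hU B hf.1 hg.1 (hg.2 N)⟩

theorem TemperateOn.mul (hU : UniqueDiffOn ℝ U) {f g : E → ℂ} (hf : TemperateOn U f)
    (hg : TemperateOn U g) : TemperateOn U (fun x => f x * g x) :=
  hf.bilinear hU (ContinuousLinearMap.mul ℝ ℂ) hg

theorem TemperateOn.add (hU : UniqueDiffOn ℝ U) {f g : E → F} (hf : TemperateOn U f)
    (hg : TemperateOn U g) : TemperateOn U (fun x => f x + g x) := by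
  refine ⟨hf.1.add hg.1, fun N => ?_⟩
  obtain ⟨k, C, hC, H⟩ := hf.2 N
  obtain ⟨k', C', hC', H'⟩ := hg.2 N
  refine ⟨k + k', C + C', by positivity, fun n hn x hx => ?_⟩
  have hx1 : (1 : ℝ) ≤ 1 + ‖x‖ := by simp
  have e1 : (1 + ‖x‖) ^ k ≤ (1 + ‖x‖) ^ (k + k') := pow_le_pow_right₀ hx1 (by omega)
  have e2 : (1 + ‖x‖) ^ k' ≤ (1 + ‖x‖) ^ (k + k') := pow_le_pow_right₀ hx1 (by omega)
  have h1 := fun_iteratedFDerivWithin_add_apply (i := n) (𝕜 := ℝ)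
    ((hf.1 x hx).of_le (by exact_mod_cast le_top)) ((hg.1 x hx).of_le (by exact_mod_cast le_top)) hU hx
  rw [h1]
  refine (norm_add_le _ _).trans ?_
  have := mul_le_mul_of_nonneg_left e1 hC
  have := mul_le_mul_of_nonneg_left e2 hC'
  have := H n hn x hx
  have := H' n hn x hx
  linarith

theorem TemperateOn.of_hasTemperateGrowth (hU : IsOpen U) {f : E → F}
    (hf : f.HasTemperateGrowth) : TemperateOn U f := by
  refine ⟨hf.1.contDiffOn, fun N => ?_⟩
  obtain ⟨k, C, hC, H⟩ := hf.norm_iteratedFDeriv_le_uniform N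
  refine ⟨k, C, hC, fun n hn x hx => ?_⟩
  rw [iteratedFDerivWithin_of_isOpen n hU hx]
  exact H n hn x

/-- The square root of a temperate function is temperate if it is smooth and bounded from below. -/
theorem TemperateOn.sqrt (hU : IsOpen U) {f g : E → ℂ} (hf : TemperateOn U f)
    (hg : ContDiffOn ℝ ∞ g U) (hgf : ∀ x ∈ U, g x ^ 2 = f x) {c : ℝ} (hc : 0 < c)
    (hgc : ∀ x ∈ U, c ≤ ‖g x‖) : TemperateOn U g := by
  have hU' := hU.uniqueDiffOn (𝕜 := ℝ)
  have hg0 : ∀ x ∈ U, g x ≠ 0 := fun x hx => norm_pos_iff.1 (hc.trans_le (hgc x hx))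
  -- The induction runs on `h = 1/g`: it is bounded by `c⁻¹` and satisfies `h' = -(1/2) h³ f'`,
  -- which is polynomial in `h` and `f'`. At the end `g = f h`.
  let h : E → ℂ := fun x => (g x)⁻¹
  have hh : ContDiffOn ℝ ∞ h U := hg.inv hg0
  have hgh : EqOn g (fun x => f x * h x) U := fun x hx => by
    simp only [h, ← hgf x hx, pow_two, mul_assoc, mul_inv_cancel₀ (hg0 x hx), mul_one]
  have hdf : ContDiffOn ℝ ∞ (fderivWithin ℝ f U) U := hf.1.fderivWithin hU' (by simp)
  have hder : EqOn (fderivWithin ℝ h U)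
      (fun x => (-(1 / 2 : ℂ) * (h x * (h x * h x))) • fderivWithin ℝ f U x) U := by
    intro x hx
    have hu := hU' x hx
    have d1 : DifferentiableWithinAt ℝ g U x := (hg x hx).differentiableWithinAt (by simp)
    have d2 : HasFDerivWithinAt f ((2 * g x) • fderivWithin ℝ g U x) U x := by
      have := (d1.hasFDerivWithinAt.pow 2).congr (f₁ := f) (fun y hy => (hgf y hy).symm)
        (hgf x hx).symm
      simpa using this
    have d3 : HasFDerivWithinAt h (-(g x ^ 2)⁻¹ • fderivWithin ℝ g U x) U x := by
      have := (hasDerivAt_inv (hg0 x hx)).comp_hasFDerivWithinAt x d1.hasFDerivWithinAt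
      exact this
    rw [d3.fderivWithin hu]
    dsimp only
    rw [d2.fderivWithin hu, smul_smul]
    congr 1
    have := hg0 x hx
    simp only [h]
    field_simp
  have key : ∀ N, PolyBounded U N h := by
    intro N
    induction N with
    | zero =>
      refine ⟨0, c⁻¹, by positivity, fun n hn x hx => ?_⟩
      obtain rfl : n = 0 := by omega
      simp only [norm_iteratedFDerivWithin_zero, pow_zero, mul_one, h, norm_inv]
      exact inv_anti₀ hc (hgc x hx)
    | succ N ih =>
      -- Bounds of order `N` for `h` and `f'` give bounds of order `N` for `h³ f'`, hence of order
      -- `N + 1` for `h`.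
      refine PolyBounded.of_fderivWithin hU' (ih.mono (Nat.zero_le _)) ?_
      have hc1 : TemperateOn U (fun _ : E => (-(1 / 2 : ℂ))) :=
        .of_hasTemperateGrowth hU (.const _)
      have m1 := ih.bilinear hU' (ContinuousLinearMap.mul ℝ ℂ) hh hh ih
      have m1' : ContDiffOn ℝ ∞ (fun x => h x * h x) U := hh.mul hh
      have m2 := ih.bilinear hU' (ContinuousLinearMap.mul ℝ ℂ) hh m1' m1
      have m2' : ContDiffOn ℝ ∞ (fun x => h x * (h x * h x)) U := hh.mul m1'
      have m3 := (hc1.2 N).bilinear hU' (ContinuousLinearMap.mul ℝ ℂ) hc1.1 m2' m2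
      have m3' : ContDiffOn ℝ ∞ (fun x => -(1 / 2 : ℂ) * (h x * (h x * h x))) U := hc1.1.mul m2'
      have m4 := m3.bilinear hU' (ContinuousLinearMap.lsmul ℝ ℂ) m3' hdf
        ((hf.2 (N + 1)).fderivWithin hU')
      exact m4.congr hder
  exact (hf.mul hU' ⟨hh, key⟩).congr hgh

/-- A function that is temperate on an open set and vanishes on another one, the two covering the
space, has temperate growth. -/
theorem TemperateOn.hasTemperateGrowth_of_union {V : Set E} (hU : IsOpen U) (hV : IsOpen V)
    (hUV : U ∪ V = univ) {f : E → F} (hf : TemperateOn U f) (h0 : ∀ x ∈ V, f x = 0) :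
    f.HasTemperateGrowth := by
  have hz : ∀ x ∈ V, f =ᶠ[nhds x] fun _ => 0 := fun x hx => by
    filter_upwards [hV.mem_nhds hx] with y hy using h0 y hy
  refine ⟨contDiff_iff_contDiffAt.2 fun x => ?_, fun n => ?_⟩
  · rcases (hUV.symm ▸ mem_univ x : x ∈ U ∪ V) with hx | hx
    · exact (hf.1 x hx).contDiffAt (hU.mem_nhds hx)
    · exact contDiffAt_const.congr_of_eventuallyEq (hz x hx)
  · obtain ⟨k, C, hC, H⟩ := hf.2 n
    refine ⟨k, C, fun x => ?_⟩
    rcases (hUV.symm ▸ mem_univ x : x ∈ U ∪ V) with hx | hx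
    · rw [← iteratedFDerivWithin_of_isOpen n hU hx]
      exact H n le_rfl x hx
    · rw [((hz x hx).iteratedFDeriv ℝ n).self_of_nhds]
      simp only [iteratedFDeriv_fun_zero, Pi.zero_apply, norm_zero]
      positivity

end Temperate
end CHG
namespace CHG
open MeasureTheory Set
open scoped ContDiff

/-! ### The principal square root on the slit plane. -/

section Sqrt

/-- The principal square root. -/
noncomputable def csqrt (z : ℂ) : ℂ := z ^ (2⁻¹ : ℂ)

theorem csqrt_sq (z : ℂ) : csqrt z ^ 2 = z := Complex.cpow_ofNat_inv_pow z 2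

theorem csqrt_re_pos {z : ℂ} (hz : z ∈ Complex.slitPlane) : 0 < (csqrt z).re := by
  have h0 := Complex.slitPlane_ne_zero hz
  have h1 := (Complex.mem_slitPlane_iff_arg.1 hz).1
  have h2 := Complex.neg_pi_lt_arg z
  have h3 := lt_of_le_of_ne (Complex.arg_le_pi z) h1
  have h4 : csqrt z = Complex.exp (Complex.log z * ((2⁻¹ : ℝ) : ℂ)) := by
    simp [csqrt, Complex.cpow_def_of_ne_zero h0]
  rw [h4, Complex.exp_re]
  refine mul_pos (Real.exp_pos _) (Real.cos_pos_of_mem_Ioo ?_)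
  rw [Complex.im_mul_ofReal, Complex.log_im]
  constructor <;> linarith

theorem contDiffAt_csqrt {z : ℂ} (hz : z ∈ Complex.slitPlane) : ContDiffAt ℝ ∞ csqrt z := by
  have h : ContDiffAt ℂ ∞ csqrt z := by
    have h1 : ContDiffAt ℂ ∞ (fun z => Complex.exp (Complex.log z * 2⁻¹)) z :=
      ((Complex.contDiffAt_log hz).mul contDiffAt_const).cexp
    refine h1.congr_of_eventuallyEq ?_
    filter_upwards [Complex.isOpen_slitPlane.mem_nhds hz] with y hy
    simp [csqrt, Complex.cpow_def_of_ne_zero (Complex.slitPlane_ne_zero hy)]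
  exact h.restrict_scalars ℝ

theorem measurable_csqrt : Measurable csqrt := by
  unfold csqrt
  fun_prop

/-- A positive real part selects the branch. This is how products and sums of square roots are
recognised as principal roots. -/
theorem eq_of_sq_eq_of_re_pos {a b : ℂ} (ha : 0 < a.re) (hb : 0 < b.re) (h : a ^ 2 = b ^ 2) :
    a = b := by
  rcases sq_eq_sq_iff_eq_or_eq_neg.1 h with h | h
  · exact h
  · rw [h] at ha
    simp at ha
    linarith

theorem re_sq_of_sq_eq {z w : ℂ} (h : w ^ 2 = z) : 2 * w.re ^ 2 = ‖z‖ + z.re := by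
  have h1 : ‖z‖ = w.re ^ 2 + w.im ^ 2 := by
    rw [← h, norm_pow, ← Complex.normSq_eq_norm_sq, Complex.normSq_apply]; ring
  have h2 : z.re = w.re ^ 2 - w.im ^ 2 := by
    rw [← h]; simp [pow_two]
  rw [h1, h2]; ring

theorem im_of_sq_eq {z w : ℂ} (h : w ^ 2 = z) : 2 * w.re * w.im = z.im := by
  rw [← h]; simp [pow_two]; ring

theorem mem_slitPlane_of_im_ne_zero {z : ℂ} (h : z.im ≠ 0) : z ∈ Complex.slitPlane :=
  Or.inr h

end Sqrt

/-! ### The coefficients of the two factors and the roots in the normal frequency. -/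

section Roots

/-- `D(τ, ξ', 0)` as a function of `τ` and `l = |ξ'|²`. -/
noncomputable def baseSymbol (τ l : ℝ) : ℂ :=
  (l : ℂ) ^ 2 + Complex.I * τ * l + Complex.I * τ

/-- The square root of `D(τ, ξ', 0)`, which is the negative of the constant coefficient in `ξ_n`
of the factors. -/
noncomputable def constCoeff (τ l : ℝ) : ℂ := csqrt (baseSymbol τ l)

/-- Up to the factor `±i`, the negative of the linear coefficient in `ξ_n` of the factors. -/
noncomputable def linCoeff (τ l : ℝ) : ℂ :=
  csqrt (2 * (l : ℂ) + Complex.I * τ + 2 * constCoeff τ l)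

/-- The factors `ξ_n² ∓ i q ξ_n - p` of the symbol `D`, for `σ = ±1`. -/
noncomputable def factorSymbol {d : ℕ} (σ : ℝ) (p : ℝ × Space d) : ℂ :=
  (lastCoord p.2 : ℂ) ^ 2
    - σ * Complex.I * linCoeff p.1 (tangentialSq p.2) * (lastCoord p.2 : ℂ)
    - constCoeff p.1 (tangentialSq p.2)

theorem baseSymbol_im (τ l : ℝ) : (baseSymbol τ l).im = τ * (l + 1) := by
  simp [baseSymbol, pow_two]; ring

theorem baseSymbol_mem {τ l : ℝ} (hτ : τ ≠ 0) (hl : 0 ≤ l) :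
    baseSymbol τ l ∈ Complex.slitPlane := by
  refine mem_slitPlane_of_im_ne_zero ?_
  rw [baseSymbol_im]
  exact mul_ne_zero hτ (by linarith)

theorem constCoeff_sq (τ l : ℝ) : constCoeff τ l ^ 2 = baseSymbol τ l := csqrt_sq _

theorem constCoeff_re_pos {τ l : ℝ} (hτ : τ ≠ 0) (hl : 0 ≤ l) : 0 < (constCoeff τ l).re :=
  csqrt_re_pos (baseSymbol_mem hτ hl)

theorem linCoeff_sq (τ l : ℝ) :
    linCoeff τ l ^ 2 = 2 * (l : ℂ) + Complex.I * τ + 2 * constCoeff τ l := csqrt_sq _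

theorem linCoeff_sq_mem {τ l : ℝ} (hτ : τ ≠ 0) (hl : 0 ≤ l) :
    2 * (l : ℂ) + Complex.I * τ + 2 * constCoeff τ l ∈ Complex.slitPlane := by
  have := constCoeff_re_pos hτ hl
  left
  simp
  linarith

theorem linCoeff_re_pos {τ l : ℝ} (hτ : τ ≠ 0) (hl : 0 ≤ l) : 0 < (linCoeff τ l).re :=
  csqrt_re_pos (linCoeff_sq_mem hτ hl)

/-- The lower bound for the coefficients of the factors. -/
theorem abs_le_norm_constCoeff_sq {τ l : ℝ} (hl : 0 ≤ l) :
    |τ| ≤ ‖constCoeff τ l‖ ^ 2 := by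
  rw [← norm_pow, constCoeff_sq]
  refine le_trans ?_ (Complex.abs_im_le_norm _)
  rw [baseSymbol_im, abs_mul]
  exact le_mul_of_one_le_right (abs_nonneg _) (by rw [abs_of_nonneg] <;> linarith)

/-- The imaginary part of `q²` is `τ + 2 Im p`. From `2 Re p · Im p = τ(l + 1)` and `Re p > 0`, the
number `Im p` has the sign of `τ`, so nothing cancels. -/
theorem abs_le_norm_linCoeff_sq {τ l : ℝ} (hτ : τ ≠ 0) (hl : 0 ≤ l) :
    |τ| ≤ ‖linCoeff τ l‖ ^ 2 := by
  rw [← norm_pow, linCoeff_sq]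
  refine le_trans ?_ (Complex.abs_im_le_norm _)
  have h1 := im_of_sq_eq (constCoeff_sq τ l)
  rw [baseSymbol_im] at h1
  have h2 := constCoeff_re_pos hτ hl
  have h3 : (2 * (l : ℂ) + Complex.I * τ + 2 * constCoeff τ l).im
      = τ + 2 * (constCoeff τ l).im := by simp
  rw [h3]
  rcases lt_or_gt_of_ne hτ with h | h
  · have : (constCoeff τ l).im < 0 := by
      by_contra hc
      have := mul_nonneg h2.le (not_lt.1 hc)
      nlinarith
    rw [abs_of_neg h, abs_of_neg (by linarith)]
    linarith
  · have : 0 < (constCoeff τ l).im := by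
      by_contra hc
      have := mul_nonneg h2.le (neg_nonneg.2 (not_lt.1 hc))
      nlinarith
    rw [abs_of_pos h, abs_of_pos (by linarith)]
    linarith

/-- The numbers `b` such that `|ξ|² = -b` are the roots of `D(τ, ·)` in `|ξ|²`. -/
theorem exists_shifts {τ : ℝ} (hτ : τ ≠ 0) :
    ∃ b₁ b₂ : ℂ, b₁ + b₂ = Complex.I * τ ∧ b₁ * b₂ = Complex.I * τ ∧ b₁.im * b₂.im < 0 := by
  -- A square root of the discriminant of `y² - iτy + iτ`, whose roots are the two shifts.
  let e : ℂ := csqrt (-(τ : ℂ) ^ 2 - 4 * Complex.I * τ)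
  have he : e ^ 2 = -(τ : ℂ) ^ 2 - 4 * Complex.I * τ := csqrt_sq _
  have hs : (Complex.I * τ + e) / 2 + (Complex.I * τ - e) / 2 = Complex.I * τ := by ring
  have hp : (Complex.I * τ + e) / 2 * ((Complex.I * τ - e) / 2) = Complex.I * τ := by
    have : (Complex.I * τ + e) / 2 * ((Complex.I * τ - e) / 2)
        = (Complex.I ^ 2 * τ ^ 2 - e ^ 2) / 4 := by ring
    rw [this, he, Complex.I_sq]; ring
  refine ⟨_, _, hs, hp, ?_⟩
  generalize (Complex.I * τ + e) / 2 = a at *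
  generalize (Complex.I * τ - e) / 2 = b at *
  have s1 := congrArg Complex.re hs
  have p1 := congrArg Complex.re hp
  have p2 := congrArg Complex.im hp
  simp at s1 p1 p2
  -- The sum is purely imaginary, so the real parts are opposite. The real part of the product then
  -- gives `a.im * b.im = -a.re ^ 2`, and `a.re = 0` would make the product real.
  have hb : b.re = -a.re := by linarith
  rw [hb] at p1 p2
  have h1 : a.im * b.im = -a.re ^ 2 := by linarith
  rw [h1, neg_lt_zero]
  refine lt_of_le_of_ne (sq_nonneg _) fun h => ?_
  have h0 : a.re = 0 := by simpa using h.symm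
  rw [h0] at p2
  apply hτ
  linarith

/-- The roots in the upper half plane are `i s₁` and `i s₂`. -/
theorem sqrt_shifts {τ : ℝ} (hτ : τ ≠ 0) {b₁ b₂ : ℂ} (hs : b₁ + b₂ = Complex.I * τ)
    (hp : b₁ * b₂ = Complex.I * τ) (hb : b₁.im * b₂.im < 0) {l : ℝ} (hl : 0 ≤ l) :
    csqrt (l + b₁) + csqrt (l + b₂) = linCoeff τ l ∧
      csqrt (l + b₁) * csqrt (l + b₂) = constCoeff τ l := by
  have hb1 : b₁.im ≠ 0 := fun h => by simp [h] at hb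
  have hb2 : b₂.im ≠ 0 := fun h => by simp [h] at hb
  have r1 : 0 < (csqrt (l + b₁)).re :=
    csqrt_re_pos (mem_slitPlane_of_im_ne_zero (by simpa using hb1))
  have r2 : 0 < (csqrt (l + b₂)).re :=
    csqrt_re_pos (mem_slitPlane_of_im_ne_zero (by simpa using hb2))
  have q1 := csqrt_sq (l + b₁)
  have q2 := csqrt_sq (l + b₂)
  have i1 := im_of_sq_eq q1
  have i2 := im_of_sq_eq q2
  generalize csqrt (l + b₁) = s₁ at *
  generalize csqrt (l + b₂) = s₂ at *
  simp at i1 i2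
  -- As `Im b₁` and `Im b₂` have opposite signs, so do `Im s₁` and `Im s₂`. Hence `Re (s₁ s₂) > 0`,
  -- and the product is the principal root of its square.
  have hprod : s₁ * s₂ = constCoeff τ l := by
    refine eq_of_sq_eq_of_re_pos ?_ (constCoeff_re_pos hτ hl) ?_
    · rw [Complex.mul_re]
      rw [← i1, ← i2] at hb
      have h4 : (s₁.re * s₂.re) * (s₁.im * s₂.im) < 0 := by nlinarith
      have h5 : 0 < s₁.re * s₂.re := mul_pos r1 r2
      have h6 : s₁.im * s₂.im < 0 := by
        by_contra hc
        have := mul_nonneg h5.le (not_lt.1 hc)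
        linarith
      linarith
    · rw [constCoeff_sq, mul_pow, q1, q2, baseSymbol]
      linear_combination (l : ℂ) * hs + hp
  refine ⟨?_, hprod⟩
  refine eq_of_sq_eq_of_re_pos (by simp; linarith) (linCoeff_re_pos hτ hl) ?_
  rw [linCoeff_sq, ← hprod]
  linear_combination q1 + q2 + hs

/-- With `2 (Re √z)² = |z| + Re z`: adding `l` raises the real part by `l` and lowers the modulus by
at most `l`. It keeps the roots away from the real axis uniformly in `ξ'`. -/
theorem csqrt_re_le {l : ℝ} (hl : 0 ≤ l) {b : ℂ} (hb : b.im ≠ 0) :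
    (csqrt b).re ≤ (csqrt (l + b)).re := by
  have r1 : 0 < (csqrt (l + b)).re :=
    csqrt_re_pos (mem_slitPlane_of_im_ne_zero (by simpa using hb))
  have h1 := re_sq_of_sq_eq (csqrt_sq (l + b))
  have h2 := re_sq_of_sq_eq (csqrt_sq b)
  have h3 : ‖b‖ ≤ ‖(l : ℂ) + b‖ + l := by
    have := norm_sub_le ((l : ℂ) + b) l
    simpa [abs_of_nonneg hl] using this
  simp at h1
  exact le_of_sq_le_sq (by linarith) r1.le

end Roots

/-! ### The factorization `D = D⁻ D⁺` and its description by roots. -/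

section Factorization

variable {d : ℕ}

theorem tangentialSq_nonneg (ξ : Space d) : 0 ≤ tangentialSq ξ :=
  Finset.sum_nonneg fun _ _ => sq_nonneg _

theorem norm_sq_eq (ξ : Space d) : ‖ξ‖ ^ 2 = tangentialSq ξ + lastCoord ξ ^ 2 := by
  rw [EuclideanSpace.norm_sq_eq, Fin.sum_univ_castSucc]
  simp [tangentialSq, lastCoord]

theorem factorSymbol_eq {τ : ℝ} (hτ : τ ≠ 0) {b₁ b₂ : ℂ} (hs : b₁ + b₂ = Complex.I * τ)
    (hp : b₁ * b₂ = Complex.I * τ) (hb : b₁.im * b₂.im < 0) {σ : ℝ} (hσ : σ ^ 2 = 1)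
    (ξ : Space d) :
    factorSymbol σ (τ, ξ) =
      ((lastCoord ξ : ℂ) - σ * Complex.I * csqrt (tangentialSq ξ + b₁)) *
        ((lastCoord ξ : ℂ) - σ * Complex.I * csqrt (tangentialSq ξ + b₂)) := by
  obtain ⟨h1, h2⟩ := sqrt_shifts hτ hs hp hb (tangentialSq_nonneg ξ)
  have h3 : (σ : ℂ) ^ 2 = 1 := by exact_mod_cast hσ
  rw [factorSymbol]
  dsimp only
  rw [← h1, ← h2]
  linear_combination (-csqrt (tangentialSq ξ + b₁) * csqrt (tangentialSq ξ + b₂)) *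
    (h3 * Complex.I ^ 2 + Complex.I_sq)

/-- With `x = ξ_n` the product is `(x² - p)² + q²x²`. Only the squares of `p` and `q` enter, so the
branches are irrelevant and `τ = 0` is allowed. -/
theorem chgSymbol_eq_mul (p : ℝ × Space d) :
    chgSymbol p = factorSymbol (-1) p * factorSymbol 1 p := by
  have h1 := constCoeff_sq p.1 (tangentialSq p.2)
  have h2 := linCoeff_sq p.1 (tangentialSq p.2)
  rw [chgSymbol, factorSymbol, factorSymbol, norm_sq_eq]
  rw [baseSymbol] at h1
  push_cast
  linear_combination (-1 : ℂ) * h1 - (lastCoord p.2 : ℂ) ^ 2 * h2 +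
    linCoeff p.1 (tangentialSq p.2) ^ 2 * (lastCoord p.2 : ℂ) ^ 2 * Complex.I_sq

theorem chgPoly_eq {τ : ℝ} {b₁ b₂ : ℂ} (hs : b₁ + b₂ = Complex.I * τ)
    (hp : b₁ * b₂ = Complex.I * τ) (ξ : Space d) :
    chgPoly (τ, ξ) =
      (({Complex.I * csqrt (tangentialSq ξ + b₁), Complex.I * csqrt (tangentialSq ξ + b₂),
        -(Complex.I * csqrt (tangentialSq ξ + b₁)), -(Complex.I * csqrt (tangentialSq ξ + b₂))} :
        Multiset ℂ).map fun a => Polynomial.X - Polynomial.C a).prod := by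
  have q1 := csqrt_sq (tangentialSq ξ + b₁)
  have q2 := csqrt_sq (tangentialSq ξ + b₂)
  generalize csqrt (tangentialSq ξ + b₁) = s₁ at *
  generalize csqrt (tangentialSq ξ + b₂) = s₂ at *
  simp only [chgPoly, Multiset.insert_eq_cons, Multiset.map_cons, Multiset.prod_cons,
    Multiset.map_singleton, Multiset.prod_singleton, map_neg, sub_neg_eq_add, map_mul]
  -- The scalar relations are transported to `Polynomial ℂ`, where the claim becomes a ring identity
  -- modulo them.
  have hC : ∀ a b : ℂ, a = b → (Polynomial.C a = Polynomial.C b) := fun a b h => by rw [h]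
  have e1 := hC _ _ hs
  have e2 := hC _ _ hp
  have e3 := hC _ _ q1
  have e4 := hC _ _ q2
  have e5 := hC _ _ Complex.I_sq
  simp only [map_add, map_mul, map_pow, map_neg, map_one] at e1 e2 e3 e4 e5
  generalize Polynomial.C b₁ = B₁ at *
  generalize Polynomial.C b₂ = B₂ at *
  generalize Polynomial.C s₁ = S₁ at *
  generalize Polynomial.C s₂ = S₂ at *
  generalize Polynomial.C Complex.I = J at *
  generalize Polynomial.C (τ : ℂ) = t at *
  generalize Polynomial.C ((tangentialSq ξ : ℝ) : ℂ) = L at *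
  have : (Polynomial.X - J * S₁) * ((Polynomial.X - J * S₂) * ((Polynomial.X + J * S₁) *
    (Polynomial.X + J * S₂))) = (Polynomial.X ^ 2 - J ^ 2 * S₁ ^ 2) *
      (Polynomial.X ^ 2 - J ^ 2 * S₂ ^ 2) := by ring
  rw [this, e5, e3, e4]
  linear_combination (-1 : Polynomial ℂ) * e2 - (L + Polynomial.X ^ 2) * e1

theorem rootFactor_eq {p : ℝ × Space d} (hp : p.1 ≠ 0) :
    factorSymbol 1 p = rootFactor {z | 0 < z.im} p ∧
      factorSymbol (-1) p = rootFactor {z | z.im < 0} p := by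
  obtain ⟨τ, ξ⟩ := p
  obtain ⟨b₁, b₂, hs, hq, hb⟩ := exists_shifts hp
  have hb1 : b₁.im ≠ 0 := fun h => by simp [h] at hb
  have hb2 : b₂.im ≠ 0 := fun h => by simp [h] at hb
  have r1 : 0 < (csqrt (tangentialSq ξ + b₁)).re :=
    csqrt_re_pos (mem_slitPlane_of_im_ne_zero (by simpa using hb1))
  have r2 : 0 < (csqrt (tangentialSq ξ + b₂)).re :=
    csqrt_re_pos (mem_slitPlane_of_im_ne_zero (by simpa using hb2))
  rw [rootFactor, rootFactor, chgPoly_eq hs hq, Polynomial.roots_multiset_prod_X_sub_C,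
    factorSymbol_eq hp hs hq hb (by norm_num), factorSymbol_eq hp hs hq hb (by norm_num)]
  constructor
  · simp [Multiset.filter_singleton, r1, r2, r1.not_gt, r2.not_gt]
  · simp [Multiset.filter_singleton, r1, r2, r1.le, r2.le]

end Factorization
end CHG
namespace CHG
open MeasureTheory Set
open scoped ContDiff

/-! ### The factors belong to the class `𝒪^⊥`. -/

section Smooth

variable {d : ℕ}

theorem hasTemperateGrowth_fst :
    (fun p : ℝ × Space d => (p.1 : ℂ)).HasTemperateGrowth :=
  (Complex.ofRealCLM.comp (ContinuousLinearMap.fst ℝ ℝ (Space d))).hasTemperateGrowth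

theorem hasTemperateGrowth_coord (i : Fin (d + 1)) :
    (fun p : ℝ × Space d => (p.2 i : ℂ)).HasTemperateGrowth :=
  (Complex.ofRealCLM.comp ((EuclideanSpace.proj i : Space d →L[ℝ] ℝ).comp
    (ContinuousLinearMap.snd ℝ ℝ (Space d)))).hasTemperateGrowth

theorem hasTemperateGrowth_tangentialSq :
    (fun p : ℝ × Space d => (tangentialSq p.2 : ℂ)).HasTemperateGrowth := by
  have h : (fun p : ℝ × Space d => (tangentialSq p.2 : ℂ)) =
      fun p => ∑ i : Fin d, (p.2 i.castSucc : ℂ) * (p.2 i.castSucc : ℂ) := by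
    funext p; simp [tangentialSq, pow_two]
  rw [h]
  exact .sum fun i _ => (hasTemperateGrowth_coord _).mul (hasTemperateGrowth_coord _)

theorem hasTemperateGrowth_baseSymbol :
    (fun p : ℝ × Space d => baseSymbol p.1 (tangentialSq p.2)).HasTemperateGrowth := by
  have h1 := hasTemperateGrowth_tangentialSq (d := d)
  have h2 := hasTemperateGrowth_fst (d := d)
  have h3 := (Function.HasTemperateGrowth.const (E := ℝ × Space d) Complex.I).mul h2
  exact ((h1.pow 2).add (h3.mul h1)).add h3

theorem isOpen_lt_abs_fst (c : ℝ) : IsOpen {p : ℝ × Space d | c < |p.1|} :=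
  isOpen_lt continuous_const continuous_fst.abs

theorem contDiffAt_constCoeff {p : ℝ × Space d} (hp : p.1 ≠ 0) :
    ContDiffAt ℝ ∞ (fun p : ℝ × Space d => constCoeff p.1 (tangentialSq p.2)) p :=
  (contDiffAt_csqrt (baseSymbol_mem hp (tangentialSq_nonneg p.2))).comp p
    hasTemperateGrowth_baseSymbol.1.contDiffAt

theorem contDiffAt_linCoeff {p : ℝ × Space d} (hp : p.1 ≠ 0) :
    ContDiffAt ℝ ∞ (fun p : ℝ × Space d => linCoeff p.1 (tangentialSq p.2)) p := by
  have h1 := (hasTemperateGrowth_tangentialSq (d := d)).1.contDiffAt (x := p)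
  have h2 := (hasTemperateGrowth_fst (d := d)).1.contDiffAt (x := p)
  exact (contDiffAt_csqrt (linCoeff_sq_mem hp (tangentialSq_nonneg p.2))).comp p
    (((contDiffAt_const.mul h1).add (contDiffAt_const.mul h2)).add
      (contDiffAt_const.mul (contDiffAt_constCoeff hp)))

theorem contDiffOn_factorSymbol (σ : ℝ) :
    ContDiffOn ℝ ∞ (factorSymbol (d := d) σ) {p | p.1 ≠ 0} := by
  intro p hp
  have h1 := (hasTemperateGrowth_coord (Fin.last d)).1.contDiffAt (x := p)
  exact (((h1.pow 2).sub ((contDiffAt_const.mul (contDiffAt_linCoeff hp)).mul h1)).sub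
    (contDiffAt_constCoeff hp)).contDiffWithinAt

theorem temperateOn_factorSymbol (σ : ℝ) {c : ℝ} (hc : 0 < c) :
    TemperateOn {p : ℝ × Space d | c < |p.1|} (factorSymbol σ) := by
  set U := {p : ℝ × Space d | c < |p.1|}
  have hU : IsOpen U := isOpen_lt_abs_fst c
  have hU' := hU.uniqueDiffOn (𝕜 := ℝ)
  have h0 : ∀ p ∈ U, p.1 ≠ 0 := fun p hp => abs_pos.1 (hc.trans hp)
  -- Both coefficients have squares of modulus at least `|τ|`, so `√c` is an admissible lower bound
  -- in both applications of `TemperateOn.sqrt`. The second uses the result of the first.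
  have hlow : ∀ {τ : ℝ} {z : ℂ}, c < |τ| → |τ| ≤ ‖z‖ ^ 2 → Real.sqrt c ≤ ‖z‖ := fun h1 h2 =>
    Real.sqrt_le_iff.2 ⟨norm_nonneg _, (h1.le.trans h2)⟩
  have hconst (z : ℂ) : TemperateOn U (fun _ => z) := .of_hasTemperateGrowth hU (.const _)
  have hp : TemperateOn U (fun p => constCoeff p.1 (tangentialSq p.2)) :=
    (TemperateOn.of_hasTemperateGrowth hU hasTemperateGrowth_baseSymbol).sqrt hU
      (fun p hp => (contDiffAt_constCoeff (h0 p hp)).contDiffWithinAt)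
      (fun p _ => constCoeff_sq _ _) (Real.sqrt_pos.2 hc)
      (fun p hp => hlow hp (abs_le_norm_constCoeff_sq (tangentialSq_nonneg p.2)))
  have ht := TemperateOn.of_hasTemperateGrowth hU (hasTemperateGrowth_tangentialSq (d := d))
  have hτ := TemperateOn.of_hasTemperateGrowth hU (hasTemperateGrowth_fst (d := d))
  have hx := TemperateOn.of_hasTemperateGrowth hU (hasTemperateGrowth_coord (Fin.last d))
  have hq : TemperateOn U (fun p => linCoeff p.1 (tangentialSq p.2)) :=
    TemperateOn.sqrt hU ((((hconst 2).mul hU' ht).add hU' ((hconst Complex.I).mul hU' hτ)).add hU'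
        ((hconst 2).mul hU' hp))
      (fun p hp => (contDiffAt_linCoeff (h0 p hp)).contDiffWithinAt)
      (fun p _ => linCoeff_sq _ _) (Real.sqrt_pos.2 hc)
      (fun p hp => hlow hp (abs_le_norm_linCoeff_sq (h0 p hp) (tangentialSq_nonneg p.2)))
  refine (((hx.mul hU' hx).add hU' ((hconst (-(σ * Complex.I))).mul hU' (hq.mul hU' hx))).add hU'
    ((hconst (-1)).mul hU' hp)).congr fun p _ => ?_
  simp only [factorSymbol, lastCoord]
  ring

theorem IsCutoff.eq_zero {T : ℝ} {η : ℝ → ℝ} (hη : IsCutoff T η) {τ : ℝ}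
    (hτ : |τ| ≤ Real.pi / T) : η τ = 0 := by
  obtain ⟨h1, h2⟩ := hη.2 τ
  rw [indicator_of_mem (mem_Icc.2 (abs_le.1 hτ))] at h1
  have h3 := h2.trans (indicator_le_self' (fun _ _ => zero_le_one) τ)
  simp at h1 h3
  linarith

theorem IsCutoff.hasTemperateGrowth {T : ℝ} {η : ℝ → ℝ} (hη : IsCutoff T η) :
    (fun τ => (η τ : ℂ)).HasTemperateGrowth := by
  have hs : HasCompactSupport (fun τ => 1 - η τ) := by
    refine HasCompactSupport.intro (K := Icc (-(2 * Real.pi / T)) (2 * Real.pi / T))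
      isCompact_Icc fun τ hτ => ?_
    obtain ⟨h1, h2⟩ := hη.2 τ
    rw [indicator_of_notMem hτ] at h2
    have h3 : 0 ≤ 1 - η τ := (indicator_nonneg (fun _ _ => zero_le_one) τ).trans h1
    linarith
  have h1 := hs.hasTemperateGrowth (contDiff_const.sub hη.1)
  have h2 := Complex.ofRealCLM.hasTemperateGrowth.comp
    ((Function.HasTemperateGrowth.const (E := ℝ) (1 : ℝ)).sub h1)
  convert h2 using 1
  funext τ
  simp

theorem isPerpSymbol_factorSymbol {T : ℝ} (hT : 0 < T) (σ : ℝ) :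
    IsPerpSymbol T (factorSymbol (d := d) σ) := by
  refine ⟨contDiffOn_factorSymbol σ, fun η hη => ?_⟩
  have hc : 0 < Real.pi / T := div_pos Real.pi_pos hT
  -- The set `|τ| > π/(2T)`, where the factor is temperate, overlaps the set `|τ| < π/T`, where `η`
  -- vanishes. So the two open sets cover the space.
  have hc2 : 0 < Real.pi / T / 2 := by linarith
  have hU := isOpen_lt_abs_fst (d := d) (Real.pi / T / 2)
  have h1 : (fun p : ℝ × Space d => (η p.1 : ℂ)).HasTemperateGrowth :=
    hη.hasTemperateGrowth.comp (ContinuousLinearMap.fst ℝ ℝ (Space d)).hasTemperateGrowth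
  have h2 := (TemperateOn.of_hasTemperateGrowth hU h1).mul hU.uniqueDiffOn
    (temperateOn_factorSymbol σ hc2)
  refine h2.hasTemperateGrowth_of_union hU
    (V := {p : ℝ × Space d | |p.1| < Real.pi / T}) (isOpen_lt continuous_fst.abs continuous_const)
    (eq_univ_of_forall fun p => ?_) fun p hp => ?_
  · rcases lt_or_ge (Real.pi / T / 2) |p.1| with h | h
    · exact Or.inl h
    · exact Or.inr (show |p.1| < Real.pi / T by linarith)
  · rw [hη.eq_zero (le_of_lt hp)]
    simp

end Smooth
end CHG
namespace CHG
open MeasureTheory Set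

/-! ### Newton polygons and order functions. -/

section Newton

variable {μ ν : OrderFn}

/-- The generating set of the Newton polygon of `E`. -/
def polygonPoints (E : Set (ℝ × ℝ)) : Set (ℝ × ℝ) :=
  E ∪ (fun v => (v.1, 0)) '' E ∪ (fun v => (0, v.2)) '' E ∪ {(0, 0)}

theorem polygonPoints_finite {E : Set (ℝ × ℝ)} (hE : E.Finite) : (polygonPoints E).Finite :=
  ((hE.union (hE.image _)).union (hE.image _)).union (finite_singleton _)

theorem extremePoints_newtonPolygon_subset (E : Set (ℝ × ℝ)) :
    (newtonPolygon E).extremePoints ℝ ⊆ polygonPoints E :=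
  extremePoints_convexHull_subset

/-- A linear functional on a Newton polygon is dominated by its values at the vertices. -/
theorem exists_extremePoint_ge {E : Set (ℝ × ℝ)} (hE : E.Finite) (a b : ℝ) {x : ℝ × ℝ}
    (hx : x ∈ polygonPoints E) :
    ∃ y ∈ (newtonPolygon E).extremePoints ℝ, a * x.1 + b * x.2 ≤ a * y.1 + b * y.2 := by
  have hF := polygonPoints_finite hE
  have hc : IsCompact (newtonPolygon E) := hF.isCompact_convexHull (𝕜 := ℝ)
  -- Krein–Milman: the polygon is the convex hull of its finitely many vertices, and a linear
  -- functional is maximal at one of them.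
  have hKM := closure_convexHull_extremePoints hc (convex_convexHull ℝ _)
  have hcl : IsClosed (convexHull ℝ ((newtonPolygon E).extremePoints ℝ)) :=
    (hF.subset (extremePoints_newtonPolygon_subset E)).isClosed_convexHull (𝕜 := ℝ)
  rw [hcl.closure_eq] at hKM
  have hx' : x ∈ convexHull ℝ ((newtonPolygon E).extremePoints ℝ) := by
    rw [hKM]
    exact subset_convexHull ℝ (polygonPoints E) hx
  let f : ℝ × ℝ →ₗ[ℝ] ℝ := a • LinearMap.fst ℝ ℝ ℝ + b • LinearMap.snd ℝ ℝ ℝ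
  exact (f.convexOn convex_univ).exists_ge_of_mem_convexHull (subset_univ _) hx'

/-- An interval has infinitely many points and `V` finitely many, so one `v ∈ V` attains the maximum
at two points of the interval. An affine function is determined by two values. -/
theorem pieces_subset {V : Finset (ℝ × ℝ)} {hV : V.Nonempty}
    (hμ : ∀ γ : Ioi (0 : ℝ), μ γ = V.sup' hV (fun v => v.1 + (γ : ℝ) * v.2)) :
    pieces μ ⊆ V := by
  rintro ⟨x, y⟩ ⟨a, b, ha, hab, h⟩
  have hex : ∀ γ : ℝ, ∃ v ∈ V, γ ∈ Ioo a b → x + γ * y = v.1 + γ * v.2 := by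
    intro γ
    by_cases hγ : γ ∈ Ioo a b
    · have h0 : 0 < γ := ha.trans_lt hγ.1
      obtain ⟨v, hv, e⟩ := Finset.exists_mem_eq_sup' hV (fun v : ℝ × ℝ => v.1 + γ * v.2)
      refine ⟨v, hv, fun _ => ?_⟩
      rw [← e, ← hμ ⟨γ, h0⟩, h ⟨γ, h0⟩ hγ.1 hγ.2]
    · exact ⟨hV.choose, hV.choose_spec, fun h => absurd h hγ⟩
  choose v hvV hv using hex
  obtain ⟨γ, hγ, γ', hγ', hne, he⟩ := (Ioo_infinite hab).exists_ne_map_eq_of_mapsTo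
    (f := v) (fun γ _ => hvV γ) V.finite_toSet
  have e1 := hv γ hγ
  have e2 := hv γ' hγ'
  rw [← he] at e2
  have e3 : (γ - γ') * (y - (v γ).2) = 0 := by linarith
  have e4 : y = (v γ).2 := by
    rcases mul_eq_zero.1 e3 with h | h
    · exact absurd (sub_eq_zero.1 h) hne
    · linarith
  have e5 : x = (v γ).1 := by rw [← e4] at e1; linarith
  have : (x, y) = v γ := Prod.ext e5 e4
  rw [this]
  exact hvV γ

theorem exists_piece {V : Finset (ℝ × ℝ)} {hV : V.Nonempty}
    (hμ : ∀ γ : Ioi (0 : ℝ), μ γ = V.sup' hV (fun v => v.1 + (γ : ℝ) * v.2))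
    (γ : Ioi (0 : ℝ)) : ∃ v ∈ pieces μ, μ γ = v.1 + (γ : ℝ) * v.2 := by
  obtain ⟨v₀, hv₀, e₀⟩ := Finset.exists_mem_eq_sup' hV (fun v : ℝ × ℝ => v.1 + (γ : ℝ) * v.2)
  rw [← hμ] at e₀
  -- Among the points of `V` attaining the maximum at `γ`, the one of largest slope also attains it
  -- on some interval to the right of `γ`.
  obtain ⟨v, hv, hmax⟩ := Finset.exists_max_image
    (V.filter fun v : ℝ × ℝ => μ γ = v.1 + (γ : ℝ) * v.2) (fun v => v.2)
    ⟨v₀, Finset.mem_filter.2 ⟨hv₀, e₀⟩⟩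
  rw [Finset.mem_filter] at hv
  refine ⟨v, ?_, hv.2⟩
  have hle : ∀ u ∈ V, u.1 + (γ : ℝ) * u.2 ≤ v.1 + γ * v.2 := fun u hu => by
    rw [← hv.2, hμ]
    exact Finset.le_sup' (fun v : ℝ × ℝ => v.1 + (γ : ℝ) * v.2) hu
  have hev : ∀ᶠ t in nhdsWithin (γ : ℝ) (Ioi (γ : ℝ)),
      ∀ u ∈ V, u.1 + t * u.2 ≤ v.1 + t * v.2 := by
    rw [Filter.eventually_all_finset]
    intro u hu
    by_cases h : μ γ = u.1 + (γ : ℝ) * u.2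
    · have h2 := hmax u (Finset.mem_filter.2 ⟨hu, h⟩)
      filter_upwards [self_mem_nhdsWithin] with t ht
      have ht' : (γ : ℝ) < t := ht
      have := hv.2
      nlinarith
    · have h1 : u.1 + (γ : ℝ) * u.2 < v.1 + γ * v.2 :=
        lt_of_le_of_ne (hle u hu) fun h' => h (hv.2.trans h'.symm)
      have c1 : Continuous fun t : ℝ => u.1 + t * u.2 := by fun_prop
      have c2 : Continuous fun t : ℝ => v.1 + t * v.2 := by fun_prop
      filter_upwards [nhdsWithin_le_nhds (c1.continuousAt.eventually_lt c2.continuousAt h1)]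
        with t ht using ht.le
  obtain ⟨b, hb, hsub⟩ := mem_nhdsGT_iff_exists_Ioo_subset.1 hev
  refine ⟨γ, b, le_of_lt γ.2, hb, fun t h1 h2 => ?_⟩
  rw [hμ]
  exact le_antisymm (Finset.sup'_le _ _ fun u hu => hsub ⟨h1, h2⟩ u hu)
    (Finset.le_sup' (fun v : ℝ × ℝ => v.1 + (t : ℝ) * v.2) hv.1)

theorem IsStrictlyPositiveOrder.pieces_finite (h : IsStrictlyPositiveOrder μ) :
    (pieces μ).Finite := by
  obtain ⟨V, hV, -, hμ⟩ := h
  exact V.finite_toSet.subset (pieces_subset hμ)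

theorem IsStrictlyPositiveOrder.vertices_finite (h : IsStrictlyPositiveOrder μ) :
    (vertices μ).Finite :=
  (polygonPoints_finite h.pieces_finite).subset
    (sdiff_subset.trans (extremePoints_newtonPolygon_subset _))

/-- A sum of maxima is the maximum over the Minkowski sum of the two point sets. -/
theorem IsStrictlyPositiveOrder.add (h : IsStrictlyPositiveOrder μ)
    (h' : IsStrictlyPositiveOrder ν) : IsStrictlyPositiveOrder (μ + ν) := by
  classical
  obtain ⟨V, hV, hpos, hμ⟩ := h
  obtain ⟨W, hW, hpos', hν⟩ := h'
  refine ⟨(V ×ˢ W).image fun x => x.1 + x.2, (hV.product hW).image _, ?_, fun γ => ?_⟩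
  · intro x hx
    obtain ⟨⟨v, w⟩, hvw, rfl⟩ := Finset.mem_image.1 hx
    rw [Finset.mem_product] at hvw
    have := hpos v hvw.1
    have := hpos' w hvw.2
    simp only [Prod.fst_add, Prod.snd_add]
    constructor <;> linarith
  · rw [Pi.add_apply, hμ, hν]
    refine le_antisymm ?_ (Finset.sup'_le _ _ fun x hx => ?_)
    · obtain ⟨v, hv, e⟩ := Finset.exists_mem_eq_sup' hV (fun v : ℝ × ℝ => v.1 + (γ : ℝ) * v.2)
      obtain ⟨w, hw, e'⟩ := Finset.exists_mem_eq_sup' hW (fun v : ℝ × ℝ => v.1 + (γ : ℝ) * v.2)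
      rw [e, e']
      have := Finset.le_sup' (s := (V ×ˢ W).image fun x => x.1 + x.2)
        (fun v : ℝ × ℝ => v.1 + (γ : ℝ) * v.2)
        (Finset.mem_image.2 ⟨(v, w), Finset.mem_product.2 ⟨hv, hw⟩, rfl⟩)
      refine le_trans (le_of_eq ?_) this
      simp only [Prod.fst_add, Prod.snd_add]
      ring
    · obtain ⟨⟨v, w⟩, hvw, rfl⟩ := Finset.mem_image.1 hx
      rw [Finset.mem_product] at hvw
      have h1 := Finset.le_sup' (fun v : ℝ × ℝ => v.1 + (γ : ℝ) * v.2) hvw.1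
      have h2 := Finset.le_sup' (fun v : ℝ × ℝ => v.1 + (γ : ℝ) * v.2) hvw.2
      simp only [Prod.fst_add, Prod.snd_add]
      simp only at h1 h2
      linarith

theorem half_chgOrder_isStrictlyPositiveOrder :
    IsStrictlyPositiveOrder ((1 / 2 : ℝ) • chgOrder) := by
  classical
  refine ⟨{(2, 0), (1, 1 / 2)}, Finset.insert_nonempty _ _, by simp, fun γ => ?_⟩
  rw [Finset.sup'_insert (Finset.singleton_nonempty _), Finset.sup'_singleton, Pi.smul_apply,
    chgOrder, smul_eq_mul, mul_max_of_nonneg _ _ (by norm_num)]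
  congr 1 <;> ring

theorem chgOrder_eq_add : chgOrder = (1 / 2 : ℝ) • chgOrder + (1 / 2 : ℝ) • chgOrder := by
  funext γ
  simp only [Pi.add_apply, Pi.smul_apply, smul_eq_mul]
  ring

theorem chgOrder_isStrictlyPositiveOrder : IsStrictlyPositiveOrder chgOrder := by
  rw [chgOrder_eq_add]
  exact half_chgOrder_isStrictlyPositiveOrder.add half_chgOrder_isStrictlyPositiveOrder

end Newton

/-! ### Comparison of the weight functions with a multiplicative growth function. -/

section Weight

variable {d : ℕ} {μ ν : OrderFn}

theorem finsum_le_of_subset {S : Set (ℝ × ℝ)} (hS : S.Finite) {f : ℝ × ℝ → ℝ} {C : ℝ}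
    (h : ∀ v ∈ S, f v ≤ C) : ∑ᶠ v ∈ S, f v ≤ S.ncard * C := by
  rw [finsum_mem_eq_finite_toFinset_sum _ hS, ncard_eq_toFinset_card S hS, ← nsmul_eq_mul]
  exact Finset.sum_le_card_nsmul _ _ _ fun v hv => h v (hS.mem_toFinset.1 hv)

theorem le_finsum_mem {S : Set (ℝ × ℝ)} (hS : S.Finite) {f : ℝ × ℝ → ℝ}
    (h : ∀ v ∈ S, 0 ≤ f v) {v : ℝ × ℝ} (hv : v ∈ S) : f v ≤ ∑ᶠ v ∈ S, f v := by
  rw [finsum_mem_eq_finite_toFinset_sum _ hS]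
  exact Finset.single_le_sum (fun v hv => h v (hS.mem_toFinset.1 hv)) (hS.mem_toFinset.2 hv)

/-- `log ⟨x⟩`. -/
noncomputable def logBracket (x : ℝ) : ℝ := Real.log (1 + x ^ 2) / 2

theorem logBracket_pos {x : ℝ} (hx : x ≠ 0) : 0 < logBracket x :=
  div_pos (Real.log_pos (by have := pow_pos (abs_pos.2 hx) 2; rw [sq_abs] at this; linarith)) two_pos

/-- `⟨τ⟩^s ⟨ξ⟩^r` as an exponential. -/
theorem bracket_rpow (x s : ℝ) : (1 + x ^ 2) ^ (s / 2) = Real.exp (s * logBracket x) := by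
  rw [Real.rpow_def_of_pos (by positivity), logBracket]
  congr 1; ring

/-- The growth `⟨ξ⟩^{μ(γ)}`, `⟨τ⟩ = ⟨ξ⟩^γ`, of the weight function of `μ`. It turns sums of order
functions into products. -/
noncomputable def growth (μ : OrderFn) (p : ℝ × Space d) : ℝ :=
  if h : 0 < logBracket p.1 / logBracket ‖p.2‖ then
    Real.exp (logBracket ‖p.2‖ * μ ⟨_, h⟩) else 1

theorem growth_pos (p : ℝ × Space d) : 0 < growth μ p := by
  unfold growth
  split_ifs
  · exact Real.exp_pos _
  · exact one_pos

theorem growth_add (p : ℝ × Space d) : growth (μ + ν) p = growth μ p * growth ν p := by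
  unfold growth
  split_ifs
  · rw [Pi.add_apply, mul_add, Real.exp_add]
  · simp

/-- Taking logarithms, `growth` is the value of a linear functional at some affine piece of `μ`. A
vertex of the polygon dominates it, and the term of that vertex (or the summand `1`, for the origin)
is part of the weight. -/
theorem growth_le_smoothWeight (h : IsStrictlyPositiveOrder μ) {p : ℝ × Space d}
    (h1 : p.1 ≠ 0) (h2 : p.2 ≠ 0) : growth μ p ≤ smoothWeight μ p := by
  have hα := logBracket_pos h1
  have hβ := logBracket_pos (norm_ne_zero_iff.2 h2)
  have hγ := div_pos hα hβ
  have hfin := h.vertices_finite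
  have hpf := h.pieces_finite
  obtain ⟨V, hV, hpos, hμ⟩ := h
  obtain ⟨v, hv, e⟩ := exists_piece hμ ⟨_, hγ⟩
  obtain ⟨y, hy, hle⟩ := exists_extremePoint_ge hpf (logBracket ‖p.2‖) (logBracket p.1)
    (Or.inl (Or.inl (Or.inl hv)))
  have hval : growth μ p ≤ Real.exp (logBracket ‖p.2‖ * y.1 + logBracket p.1 * y.2) := by
    rw [growth, dif_pos hγ]
    refine Real.exp_le_exp.2 (le_trans (le_of_eq ?_) hle)
    rw [e]
    field_simp
  refine hval.trans ?_
  have hterm : ∀ v : ℝ × ℝ, (1 + |p.1| ^ 2) ^ (v.2 / 2) * (1 + ‖p.2‖ ^ 2) ^ (v.1 / 2)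
      = Real.exp (logBracket ‖p.2‖ * v.1 + logBracket p.1 * v.2) := fun v => by
    rw [sq_abs, bracket_rpow, bracket_rpow, ← Real.exp_add]
    congr 1; ring
  have hnn : ∀ v ∈ vertices μ, 0 ≤ (1 + |p.1| ^ 2) ^ (v.2 / 2) * (1 + ‖p.2‖ ^ 2) ^ (v.1 / 2) :=
    fun v _ => by positivity
  unfold smoothWeight
  by_cases h0 : y = (0, 0)
  · have : 0 ≤ ∑ᶠ v ∈ vertices μ, (1 + |p.1| ^ 2) ^ (v.2 / 2) * (1 + ‖p.2‖ ^ 2) ^ (v.1 / 2) :=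
      finsum_nonneg fun v => finsum_nonneg fun _ => by positivity
    rw [h0, mul_zero, mul_zero, add_zero, Real.exp_zero]
    linarith
  · have := le_finsum_mem hfin hnn (v := y) ⟨hy, h0⟩
    rw [hterm y] at this
    linarith

theorem smoothWeight_le_growth (h : IsStrictlyPositiveOrder μ) : ∃ C : ℝ, 0 < C ∧
    ∀ p : ℝ × Space d, p.1 ≠ 0 → p.2 ≠ 0 → smoothWeight μ p ≤ C * growth μ p := by
  -- The summand `1` and each vertex term are at most `growth μ p`.
  refine ⟨1 + (vertices μ).ncard, by positivity, fun p h1 h2 => ?_⟩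
  have hα := logBracket_pos h1
  have hβ := logBracket_pos (norm_ne_zero_iff.2 h2)
  have hγ := div_pos hα hβ
  have hfin := h.vertices_finite
  obtain ⟨V, hV, hpos, hμ⟩ := h
  have hlin : ∀ v ∈ V, logBracket ‖p.2‖ * v.1 + logBracket p.1 * v.2
      ≤ logBracket ‖p.2‖ * μ ⟨_, hγ⟩ := fun v hv => by
    have h3 := Finset.le_sup' (fun v : ℝ × ℝ => v.1 +
      (logBracket p.1 / logBracket ‖p.2‖) * v.2) hv
    have h4 := mul_le_mul_of_nonneg_left h3 hβ.le
    rw [hμ]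
    refine le_trans (le_of_eq ?_) h4
    field_simp
  have hnn : 0 ≤ logBracket ‖p.2‖ * μ ⟨_, hγ⟩ := by
    obtain ⟨v, hv⟩ := hV
    refine le_trans ?_ (hlin v hv)
    have := hpos v hv
    exact add_nonneg (mul_nonneg hβ.le this.1) (mul_nonneg hα.le this.2)
  have hmax : ∀ v ∈ vertices μ, (1 + |p.1| ^ 2) ^ (v.2 / 2) * (1 + ‖p.2‖ ^ 2) ^ (v.1 / 2)
      ≤ growth μ p := by
    intro v hv
    rw [sq_abs, bracket_rpow, bracket_rpow, ← Real.exp_add, growth, dif_pos hγ]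
    refine Real.exp_le_exp.2 ?_
    have hlin' : ∀ w ∈ pieces μ, logBracket ‖p.2‖ * w.1 + logBracket p.1 * w.2
      ≤ logBracket ‖p.2‖ * μ ⟨_, hγ⟩ := fun w hw => hlin w (pieces_subset hμ hw)
    have hpos' : ∀ w ∈ pieces μ, 0 ≤ logBracket ‖p.2‖ * w.1 ∧ 0 ≤ logBracket p.1 * w.2 :=
      fun w hw => ⟨mul_nonneg hβ.le (hpos w (pieces_subset hμ hw)).1,
        mul_nonneg hα.le (hpos w (pieces_subset hμ hw)).2⟩
    -- A vertex is a piece, a projection of a piece, or the origin. Projecting drops a nonnegative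
    -- part of the exponent.
    rcases extremePoints_newtonPolygon_subset _ hv.1 with ((hw | ⟨w, hw, rfl⟩) | ⟨w, hw, rfl⟩) | rfl
    · linarith [hlin' v hw]
    · simp only [zero_mul]
      linarith [hlin' w hw, hpos' w hw]
    · simp only [zero_mul]
      linarith [hlin' w hw, hpos' w hw]
    · simpa using hnn
  have h1g : 1 ≤ growth μ p := by
    rw [growth, dif_pos hγ]
    exact Real.one_le_exp hnn
  have := finsum_le_of_subset hfin hmax
  unfold smoothWeight
  nlinarith

end Weight
end CHG
namespace CHG
open MeasureTheory Set

/-! ### Two-sided bounds for the factors and `𝒩`-ellipticity. -/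

section Estimates

variable {d : ℕ}

/-- A function equivalent to the weight function of `μ_D / 2`. -/
noncomputable def halfWeight (p : ℝ × Space d) : ℝ :=
  1 + ‖p.2‖ ^ 2 + √|p.1| * (1 + ‖p.2‖)

theorem one_le_halfWeight (p : ℝ × Space d) : 1 ≤ halfWeight p := by
  unfold halfWeight
  have : 0 ≤ ‖p.2‖ ^ 2 + √|p.1| * (1 + ‖p.2‖) := by positivity
  linarith

theorem half_chgOrder_apply (γ : Ioi (0 : ℝ)) :
    ((1 / 2 : ℝ) • chgOrder) γ = max 2 (1 + (γ : ℝ) / 2) := by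
  rw [Pi.smul_apply, chgOrder, smul_eq_mul, mul_max_of_nonneg _ _ (by norm_num)]
  congr 1 <;> ring

theorem pieces_half_chgOrder : pieces ((1 / 2 : ℝ) • chgOrder) = {(2, 0), (1, 1 / 2)} := by
  classical
  refine Subset.antisymm ?_ ?_
  · have h : ∀ γ : Ioi (0 : ℝ), ((1 / 2 : ℝ) • chgOrder) γ =
        ({(2, 0), (1, 1 / 2)} : Finset (ℝ × ℝ)).sup' (Finset.insert_nonempty _ _)
          (fun v => v.1 + (γ : ℝ) * v.2) := fun γ => by
      rw [half_chgOrder_apply, Finset.sup'_insert (Finset.singleton_nonempty _),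
        Finset.sup'_singleton]
      congr 1 <;> ring
    simpa using pieces_subset h
  · rintro v (rfl | rfl)
    · refine ⟨0, 2, le_rfl, two_pos, fun γ _ h => ?_⟩
      rw [half_chgOrder_apply, max_eq_left (by linarith)]
      simp
    · refine ⟨2, 3, by norm_num, by norm_num, fun γ h _ => ?_⟩
      rw [half_chgOrder_apply, max_eq_right (by linarith)]
      ring

theorem polygonPoints_half_chgOrder {v : ℝ × ℝ}
    (hv : v ∈ polygonPoints (pieces ((1 / 2 : ℝ) • chgOrder))) :
    v = (2, 0) ∨ v = (1, 1 / 2) ∨ v = (1, 0) ∨ v = (0, 1 / 2) ∨ v = (0, 0) := by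
  rw [pieces_half_chgOrder] at hv
  rcases hv with (((rfl | rfl) | ⟨w, (rfl | rfl), rfl⟩) | ⟨w, (rfl | rfl), rfl⟩) | rfl <;> simp

/-- For each point a linear functional is chosen whose maximum over the five generating points is
attained there only: `(1, 0)`, `(1, 4)` and `(-1, 1)`, respectively. -/
theorem mem_vertices_half_chgOrder :
    ((2, 0) : ℝ × ℝ) ∈ vertices ((1 / 2 : ℝ) • chgOrder) ∧
    ((1, 1 / 2) : ℝ × ℝ) ∈ vertices ((1 / 2 : ℝ) • chgOrder) ∧
    ((0, 1 / 2) : ℝ × ℝ) ∈ vertices ((1 / 2 : ℝ) • chgOrder) := by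
  have hfin := half_chgOrder_isStrictlyPositiveOrder.pieces_finite
  have m1 : ((2, 0) : ℝ × ℝ) ∈ pieces ((1 / 2 : ℝ) • chgOrder) := by
    rw [pieces_half_chgOrder]; simp
  have m2 : ((1, 1 / 2) : ℝ × ℝ) ∈ pieces ((1 / 2 : ℝ) • chgOrder) := by
    rw [pieces_half_chgOrder]; simp
  refine ⟨?_, ?_, ?_⟩
  · obtain ⟨y, hy, h⟩ := exists_extremePoint_ge hfin 1 0 (Or.inl (Or.inl (Or.inl m1)))
    rcases polygonPoints_half_chgOrder (extremePoints_newtonPolygon_subset _ hy) with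
      rfl | rfl | rfl | rfl | rfl
    · exact ⟨hy, by simp⟩
    all_goals norm_num at h
  · obtain ⟨y, hy, h⟩ := exists_extremePoint_ge hfin 1 4 (Or.inl (Or.inl (Or.inl m2)))
    rcases polygonPoints_half_chgOrder (extremePoints_newtonPolygon_subset _ hy) with
      rfl | rfl | rfl | rfl | rfl
    on_goal 2 => exact ⟨hy, by simp⟩
    all_goals norm_num at h
  · obtain ⟨y, hy, h⟩ := exists_extremePoint_ge hfin (-1) 1 (Or.inl (Or.inr ⟨_, m2, rfl⟩))
    rcases polygonPoints_half_chgOrder (extremePoints_newtonPolygon_subset _ hy) with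
      rfl | rfl | rfl | rfl | rfl
    on_goal 4 => exact ⟨hy, by simp⟩
    all_goals norm_num at h

theorem halfWeight_le_weight (p : ℝ × Space d) :
    halfWeight p ≤ 3 * weight ((1 / 2 : ℝ) • chgOrder) p := by
  have hfin := half_chgOrder_isStrictlyPositiveOrder.vertices_finite
  obtain ⟨h1, h2, h3⟩ := mem_vertices_half_chgOrder
  have hnn : ∀ v ∈ vertices ((1 / 2 : ℝ) • chgOrder), 0 ≤ |p.1| ^ v.2 * ‖p.2‖ ^ v.1 :=
    fun v _ => by positivity
  -- Each of the three vertex terms is at most the whole sum, which accounts for the factor `3`.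
  have e1 := le_finsum_mem hfin hnn h1
  have e2 := le_finsum_mem hfin hnn h2
  have e3 := le_finsum_mem hfin hnn h3
  simp only [Real.rpow_zero, one_mul, mul_one, Real.rpow_one, Real.rpow_two,
    ← Real.sqrt_eq_rpow] at e1 e2 e3
  unfold halfWeight weight
  linarith

theorem weight_le_halfWeight : ∃ C : ℝ, 0 < C ∧
    ∀ p : ℝ × Space d, weight ((1 / 2 : ℝ) • chgOrder) p ≤ C * halfWeight p := by
  refine ⟨1 + (vertices ((1 / 2 : ℝ) • chgOrder)).ncard, by positivity, fun p => ?_⟩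
  have hfin := half_chgOrder_isStrictlyPositiveOrder.vertices_finite
  have hx : 0 ≤ ‖p.2‖ := norm_nonneg _
  have ht : 0 ≤ √|p.1| := Real.sqrt_nonneg _
  have htx : 0 ≤ √|p.1| * ‖p.2‖ := by positivity
  have hmax : ∀ v ∈ vertices ((1 / 2 : ℝ) • chgOrder), |p.1| ^ v.2 * ‖p.2‖ ^ v.1 ≤ halfWeight p := by
    intro v hv
    unfold halfWeight
    rcases polygonPoints_half_chgOrder (extremePoints_newtonPolygon_subset _ hv.1) with
      rfl | rfl | rfl | rfl | rfl <;>
    simp only [Real.rpow_zero, one_mul, mul_one, Real.rpow_one, Real.rpow_two,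
      ← Real.sqrt_eq_rpow] <;> nlinarith [sq_nonneg (‖p.2‖ - 1)]
  have := finsum_le_of_subset hfin hmax
  have := one_le_halfWeight p
  unfold weight
  linarith

theorem tangentialSq_le (ξ : Space d) : tangentialSq ξ ≤ ‖ξ‖ ^ 2 := by
  rw [norm_sq_eq]
  linarith [sq_nonneg (lastCoord ξ)]

theorem abs_lastCoord_le (ξ : Space d) : |lastCoord ξ| ≤ ‖ξ‖ := by
  refine abs_le_of_sq_le_sq ?_ (norm_nonneg _)
  rw [norm_sq_eq]
  linarith [tangentialSq_nonneg ξ]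

theorem norm_constCoeff_le (p : ℝ × Space d) :
    ‖constCoeff p.1 (tangentialSq p.2)‖ ≤ halfWeight p := by
  have hl := tangentialSq_nonneg p.2
  have hl' := tangentialSq_le p.2
  have ht : 0 ≤ √|p.1| := Real.sqrt_nonneg _
  have ht2 : √|p.1| ^ 2 = |p.1| := Real.sq_sqrt (abs_nonneg _)
  have h0 : 0 ≤ halfWeight p := zero_le_one.trans (one_le_halfWeight p)
  have h1 : ‖constCoeff p.1 (tangentialSq p.2)‖ ^ 2
      ≤ tangentialSq p.2 ^ 2 + |p.1| * tangentialSq p.2 + |p.1| := by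
    rw [← norm_pow, constCoeff_sq, baseSymbol]
    refine (norm_add₃_le).trans (le_of_eq ?_)
    simp [abs_of_nonneg hl]
  refine le_of_sq_le_sq (h1.trans ?_) h0
  generalize tangentialSq p.2 = l at *
  unfold halfWeight
  generalize √|p.1| = s at *
  rw [← ht2]
  have hx : 0 ≤ ‖p.2‖ := norm_nonneg _
  generalize ‖p.2‖ = x at *
  have e1 : l ^ 2 ≤ (x ^ 2) ^ 2 := by gcongr
  have e2 : s ^ 2 * l ≤ s ^ 2 * x ^ 2 := by gcongr
  have : (x ^ 2) ^ 2 + s ^ 2 * x ^ 2 + s ^ 2 ≤ (1 + x ^ 2 + s * (1 + x)) ^ 2 := by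
    have : 0 ≤ 1 + 2 * x ^ 2 + 2 * s ^ 2 * x + 2 * (1 + x ^ 2) * (s * (1 + x)) := by positivity
    nlinarith
  linarith

theorem norm_linCoeff_mul_le (p : ℝ × Space d) :
    ‖linCoeff p.1 (tangentialSq p.2)‖ * ‖p.2‖ ≤ 3 * halfWeight p := by
  have hl := tangentialSq_nonneg p.2
  have hl' := tangentialSq_le p.2
  have hc := norm_constCoeff_le p
  have ht : 0 ≤ √|p.1| := Real.sqrt_nonneg _
  have ht2 : √|p.1| ^ 2 = |p.1| := Real.sq_sqrt (abs_nonneg _)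
  have hx : 0 ≤ ‖p.2‖ := norm_nonneg _
  have h0 : 0 ≤ halfWeight p := zero_le_one.trans (one_le_halfWeight p)
  have h1 : ‖linCoeff p.1 (tangentialSq p.2)‖ ^ 2
      ≤ 2 * ‖p.2‖ ^ 2 + |p.1| + 2 * halfWeight p := by
    rw [← norm_pow, linCoeff_sq]
    refine (norm_add₃_le).trans ?_
    simp [abs_of_nonneg hl]
    linarith
  refine le_of_sq_le_sq ?_ (by positivity)
  rw [mul_pow]
  refine (mul_le_mul_of_nonneg_right h1 (sq_nonneg _)).trans ?_
  have e1 : ‖p.2‖ ^ 2 ≤ halfWeight p := by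
    unfold halfWeight
    have : 0 ≤ √|p.1| * (1 + ‖p.2‖) := by positivity
    linarith
  have e2 : √|p.1| * ‖p.2‖ ≤ halfWeight p := by
    unfold halfWeight
    nlinarith [sq_nonneg ‖p.2‖]
  have e3 : |p.1| * ‖p.2‖ ^ 2 ≤ halfWeight p ^ 2 := by
    rw [← ht2, ← mul_pow]
    gcongr
  have e4 : ‖p.2‖ ^ 2 * ‖p.2‖ ^ 2 ≤ halfWeight p * halfWeight p := by gcongr
  have e5 : halfWeight p * ‖p.2‖ ^ 2 ≤ halfWeight p * halfWeight p := by gcongr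
  have e6 : 0 ≤ halfWeight p ^ 2 := by positivity
  nlinarith

/-- The sum of the absolute values of the terms of the factors. -/
theorem norm_terms_le (p : ℝ × Space d) :
    ‖p.2‖ ^ 2 + ‖linCoeff p.1 (tangentialSq p.2)‖ * ‖p.2‖ +
      ‖constCoeff p.1 (tangentialSq p.2)‖ ≤ 5 * halfWeight p := by
  have h1 := norm_constCoeff_le p
  have h2 := norm_linCoeff_mul_le p
  have e1 : ‖p.2‖ ^ 2 ≤ halfWeight p := by
    unfold halfWeight
    have : 0 ≤ √|p.1| * (1 + ‖p.2‖) := by positivity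
    linarith
  linarith

theorem norm_factorSymbol_le {σ : ℝ} (hσ : |σ| = 1) (p : ℝ × Space d) :
    ‖factorSymbol σ p‖ ≤ 5 * halfWeight p := by
  refine le_trans ?_ (norm_terms_le p)
  have hx := abs_lastCoord_le p.2
  unfold factorSymbol
  refine (norm_sub_le _ _).trans (add_le_add ((norm_sub_le _ _).trans (add_le_add ?_ ?_)) le_rfl)
  · rw [norm_pow, Complex.norm_real, Real.norm_eq_abs]
    gcongr
  · simp only [norm_mul, Complex.norm_real, Real.norm_eq_abs, hσ, Complex.norm_I, one_mul]
    gcongr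

/-- Real part `|ξ|⁴` and imaginary part `τ(1 + |ξ|²)` each bound `|D|` from below. The square of the
weight is at most four times the sum of their moduli and `1`, and `1` is absorbed by the imaginary
part because `|τ| ≥ lam`. -/
theorem halfWeight_sq_le {lam : ℝ} (hlam : 0 < lam) {p : ℝ × Space d} (hp : lam ≤ |p.1|) :
    halfWeight p ^ 2 ≤ 8 * (1 + lam⁻¹) * ‖chgSymbol p‖ := by
  have hre : (chgSymbol p).re = (‖p.2‖ ^ 2) ^ 2 := by
    rw [chgSymbol]
    generalize ‖p.2‖ ^ 2 = y
    simp [pow_two]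
  have him : (chgSymbol p).im = p.1 * (1 + ‖p.2‖ ^ 2) := by
    rw [chgSymbol]
    generalize ‖p.2‖ ^ 2 = y
    simp
    ring
  have h1 : (‖p.2‖ ^ 2) ^ 2 ≤ ‖chgSymbol p‖ := by
    rw [← hre]; exact Complex.re_le_norm _
  have h2 : |p.1| * (1 + ‖p.2‖ ^ 2) ≤ ‖chgSymbol p‖ := by
    have h3 : 0 ≤ 1 + ‖p.2‖ ^ 2 := by positivity
    have := Complex.abs_im_le_norm (chgSymbol p)
    rwa [him, abs_mul, abs_of_nonneg h3] at this
  have ht : 0 ≤ √|p.1| := Real.sqrt_nonneg _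
  have ht2 : √|p.1| ^ 2 = |p.1| := Real.sq_sqrt (abs_nonneg _)
  have hx : 0 ≤ ‖p.2‖ := norm_nonneg _
  have h4 : halfWeight p ^ 2 ≤ 4 * (1 + (‖p.2‖ ^ 2) ^ 2 + |p.1| * (1 + ‖p.2‖ ^ 2)) := by
    rw [← ht2, halfWeight]
    generalize √|p.1| = s at *
    generalize ‖p.2‖ = x at *
    nlinarith [sq_nonneg (1 - x ^ 2), sq_nonneg (1 - s), sq_nonneg (1 - s * x),
      sq_nonneg (x ^ 2 - s), sq_nonneg (x ^ 2 - s * x), sq_nonneg (s - s * x)]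
  have h5 : 1 ≤ lam⁻¹ * (|p.1| * (1 + ‖p.2‖ ^ 2)) := by
    rw [← div_eq_inv_mul, one_le_div hlam]
    nlinarith [sq_nonneg ‖p.2‖, abs_nonneg p.1]
  have h6 : lam⁻¹ * (|p.1| * (1 + ‖p.2‖ ^ 2)) ≤ lam⁻¹ * ‖chgSymbol p‖ := by gcongr
  have h7 : 0 ≤ lam⁻¹ * ‖chgSymbol p‖ := by positivity
  nlinarith

/-- No direct lower bound is needed: `halfWeight² ≤ 8(1 + lam⁻¹) |D⁻| |D⁺|`, and the other factor is
at most `5 halfWeight`. Cancel one power. -/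
theorem halfWeight_le_norm_factorSymbol {σ : ℝ} (hσ : σ = 1 ∨ σ = -1) {lam : ℝ} (hlam : 0 < lam)
    {p : ℝ × Space d} (hp : lam ≤ |p.1|) :
    halfWeight p ≤ 40 * (1 + lam⁻¹) * ‖factorSymbol σ p‖ := by
  have h1 := halfWeight_sq_le hlam hp
  have h0 := one_le_halfWeight p
  have hl : 0 ≤ 1 + lam⁻¹ := by positivity
  have h2 : ‖chgSymbol p‖ ≤ 5 * halfWeight p * ‖factorSymbol σ p‖ := by
    rw [chgSymbol_eq_mul, norm_mul]
    rcases hσ with rfl | rfl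
    · gcongr
      exact norm_factorSymbol_le (by simp) p
    · rw [mul_comm]
      gcongr
      exact norm_factorSymbol_le (by simp) p
  have h3 : halfWeight p * halfWeight p ≤
      halfWeight p * (40 * (1 + lam⁻¹) * ‖factorSymbol σ p‖) := by
    have := mul_le_mul_of_nonneg_left h2 hl
    nlinarith
  exact le_of_mul_le_mul_left h3 (by linarith)

theorem isNElliptic_factorSymbol {σ : ℝ} (hσ : σ = 1 ∨ σ = -1) :
    IsNElliptic (factorSymbol (d := d) σ) ((1 / 2 : ℝ) • chgOrder) := by
  refine ⟨contDiffOn_factorSymbol σ, ⟨15, by norm_num, fun p _ => ?_⟩, fun lam hlam => ?_⟩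
  · have h1 := norm_factorSymbol_le (σ := σ) (by rcases hσ with rfl | rfl <;> simp) p
    have h2 := halfWeight_le_weight p
    linarith
  · obtain ⟨C, hC, h⟩ := weight_le_halfWeight (d := d)
    refine ⟨(C * (40 * (1 + lam⁻¹)))⁻¹, by positivity, fun p hp => ?_⟩
    rw [inv_mul_le_iff₀ (by positivity), mul_assoc]
    exact (h p).trans (mul_le_mul_of_nonneg_left (halfWeight_le_norm_factorSymbol hσ hlam hp) hC.le)

/-- The weight of `μ_D / 2` is equivalent to its growth. -/
theorem growth_half_chgOrder {p : ℝ × Space d} (h1 : p.1 ≠ 0) (h2 : p.2 ≠ 0) :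
    growth ((1 / 2 : ℝ) • chgOrder) p ≤ 3 * halfWeight p ∧
      halfWeight p ≤ 3 * growth ((1 / 2 : ℝ) • chgOrder) p := by
  have hα := logBracket_pos h1
  have hβ := logBracket_pos (norm_ne_zero_iff.2 h2)
  have hγ := div_pos hα hβ
  have e : growth ((1 / 2 : ℝ) • chgOrder) p = max (Real.exp (logBracket ‖p.2‖) ^ 2)
      (Real.exp (logBracket ‖p.2‖) * Real.exp (logBracket p.1 / 2)) := by
    rw [growth, dif_pos hγ, half_chgOrder_apply, mul_max_of_nonneg _ _ hβ.le,
      Real.exp_monotone.map_max, ← Real.exp_add, ← Real.exp_nat_mul]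
    congr 2
    · push_cast; ring
    · field_simp
  have hu : Real.exp (logBracket ‖p.2‖) ^ 2 = 1 + ‖p.2‖ ^ 2 := by
    rw [← Real.exp_nat_mul, logBracket]
    push_cast
    rw [mul_div_cancel₀ _ two_ne_zero, Real.exp_log (by positivity)]
  have hv : Real.exp (logBracket p.1 / 2) ^ 4 = 1 + |p.1| ^ 2 := by
    rw [← Real.exp_nat_mul, logBracket, sq_abs]
    have : ((4 : ℕ) : ℝ) * (Real.log (1 + p.1 ^ 2) / 2 / 2) = Real.log (1 + p.1 ^ 2) := by
      push_cast; ring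
    rw [this, Real.exp_log (by positivity)]
  have ht : 0 ≤ √|p.1| := Real.sqrt_nonneg _
  have ht2 : |p.1| = √|p.1| ^ 2 := (Real.sq_sqrt (abs_nonneg _)).symm
  have hx : 0 ≤ ‖p.2‖ := norm_nonneg _
  rw [e, halfWeight]
  rw [ht2] at hv
  have hu0 := Real.exp_pos (logBracket ‖p.2‖)
  have hv0 := Real.exp_pos (logBracket p.1 / 2)
  generalize Real.exp (logBracket ‖p.2‖) = u at *
  generalize Real.exp (logBracket p.1 / 2) = v at *
  generalize √|p.1| = s at *
  generalize ‖p.2‖ = x at *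
  -- Here `u = ⟨ξ⟩`, `v = ⟨τ⟩^{1/2}`, `x = |ξ|` and `s = √|τ|`. The comparison of `max (u²) (uv)`
  -- with `1 + x² + s(1 + x)` follows from `s ≤ v ≤ 1 + s` and `u ≤ 1 + x ≤ 2u`.
  have a1 : s ≤ v := by
    refine le_of_pow_le_pow_left₀ (n := 4) (by norm_num) hv0.le ?_
    rw [hv]; nlinarith
  have a2 : v ≤ 1 + s := by
    refine le_of_pow_le_pow_left₀ (n := 4) (by norm_num) (by positivity) ?_
    rw [hv]
    have : 0 ≤ 4 * s + 6 * s ^ 2 + 4 * s ^ 3 := by positivity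
    nlinarith
  have a3 : u ≤ 1 + x := le_of_sq_le_sq (by nlinarith) (by positivity)
  have a4 : 1 + x ≤ 2 * u := le_of_sq_le_sq (by nlinarith [sq_nonneg (x - 1)]) (by positivity)
  constructor
  · refine max_le ?_ ?_
    · have : 0 ≤ s * (1 + x) := by positivity
      rw [hu]; nlinarith
    · have : u * v ≤ (1 + x) * (1 + s) := by gcongr
      have : 0 ≤ s * (1 + x) := by positivity
      nlinarith [sq_nonneg (x - 1)]
  · have b1 : s * (1 + x) ≤ v * (2 * u) := by gcongr
    have b2 := le_max_left (u ^ 2) (u * v)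
    have b3 := le_max_right (u ^ 2) (u * v)
    nlinarith

/-- `m` grows like the weight function of `μ` at the frequencies `|τ| ≥ lam`. -/
def HasGrowth (lam : ℝ) (μ : OrderFn) (m : ℝ × Space d → ℂ) : Prop :=
  ∃ C : ℝ, 0 < C ∧ ∀ p : ℝ × Space d, lam ≤ |p.1| → p.2 ≠ 0 →
    ‖m p‖ ≤ C * growth μ p ∧ growth μ p ≤ C * ‖m p‖

theorem hasGrowth_factorSymbol {σ : ℝ} (hσ : σ = 1 ∨ σ = -1) {lam : ℝ} (hlam : 0 < lam) :
    HasGrowth (d := d) lam ((1 / 2 : ℝ) • chgOrder) (factorSymbol σ) := by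
  refine ⟨15 + 120 * (1 + lam⁻¹), by positivity, fun p hp h2 => ?_⟩
  have h1 : p.1 ≠ 0 := abs_pos.1 (hlam.trans_le hp)
  obtain ⟨e1, e2⟩ := growth_half_chgOrder h1 h2
  have e3 := norm_factorSymbol_le (σ := σ) (by rcases hσ with rfl | rfl <;> simp) p
  have e4 := halfWeight_le_norm_factorSymbol hσ hlam hp
  have e5 : 0 ≤ lam⁻¹ := by positivity
  have e6 := growth_pos (μ := (1 / 2 : ℝ) • chgOrder) p
  have e7 := norm_nonneg (factorSymbol σ p)
  have e8 := mul_nonneg e5 e6.le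
  constructor <;> nlinarith

theorem HasGrowth.mul {lam : ℝ} {μ ν : OrderFn} {m m' : ℝ × Space d → ℂ}
    (h : HasGrowth lam μ m) (h' : HasGrowth lam ν m') :
    HasGrowth lam (μ + ν) (fun p => m p * m' p) := by
  obtain ⟨C, hC, H⟩ := h
  obtain ⟨C', hC', H'⟩ := h'
  refine ⟨C * C', by positivity, fun p h1 h2 => ?_⟩
  have g1 := growth_pos (μ := μ) p
  have g2 := growth_pos (μ := ν) p
  rw [growth_add, norm_mul]
  constructor
  · have := mul_le_mul (H p h1 h2).1 (H' p h1 h2).1 (norm_nonneg _) (by positivity)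
    linarith
  · have := mul_le_mul (H p h1 h2).2 (H' p h1 h2).2 g2.le (by positivity)
    linarith

theorem hasGrowth_chgSymbol {lam : ℝ} (hlam : 0 < lam) :
    HasGrowth (d := d) lam chgOrder chgSymbol := by
  have h := (hasGrowth_factorSymbol (d := d) (Or.inr rfl) hlam).mul
    (hasGrowth_factorSymbol (Or.inl rfl) hlam)
  rw [← chgOrder_eq_add] at h
  exact funext chgSymbol_eq_mul (α := ℝ × Space d) ▸ h

/-- Both sides are comparable to `growth μ p * growth ν p`, by multiplicativity of the growth. This
is the symbol estimate behind the isomorphisms and their inverses. -/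
theorem HasGrowth.smoothWeight {lam : ℝ} (hlam : 0 < lam) {μ ν : OrderFn} {m : ℝ × Space d → ℂ}
    (h : HasGrowth lam μ m) (hμ : IsStrictlyPositiveOrder μ) (hν : IsStrictlyPositiveOrder ν) :
    ∃ C : ℝ, 0 < C ∧ ∀ p : ℝ × Space d, lam ≤ |p.1| → p.2 ≠ 0 →
      ‖m p‖ * smoothWeight ν p ≤ C * smoothWeight (μ + ν) p ∧
        smoothWeight (μ + ν) p ≤ C * (‖m p‖ * smoothWeight ν p) := by
  obtain ⟨C, hC, H⟩ := h
  obtain ⟨C₁, hC₁, H₁⟩ := smoothWeight_le_growth (d := d) hν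
  obtain ⟨C₂, hC₂, H₂⟩ := smoothWeight_le_growth (d := d) (hμ.add hν)
  refine ⟨C * C₁ + C * C₂, by positivity, fun p hp h2 => ?_⟩
  have h1 : p.1 ≠ 0 := abs_pos.1 (hlam.trans_le hp)
  have a1 := growth_le_smoothWeight hν h1 h2
  have a2 := growth_le_smoothWeight (hμ.add hν) h1 h2
  have a3 := H₁ p h1 h2
  have a4 := H₂ p h1 h2
  obtain ⟨a5, a6⟩ := H p hp h2
  rw [growth_add] at a2 a4
  have g1 := growth_pos (μ := μ) p
  have g2 := growth_pos (μ := ν) p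
  have w1 := smoothWeight_pos ν p
  have w2 := smoothWeight_pos (μ + ν) p
  have hn := norm_nonneg (m p)
  constructor
  · calc ‖m p‖ * CHG.smoothWeight ν p ≤ (C * growth μ p) * (C₁ * growth ν p) := by gcongr
      _ = C * C₁ * (growth μ p * growth ν p) := by ring
      _ ≤ C * C₁ * CHG.smoothWeight (μ + ν) p := by gcongr
      _ ≤ _ := by gcongr; nlinarith [mul_pos hC hC₂]
  · calc CHG.smoothWeight (μ + ν) p ≤ C₂ * (growth μ p * growth ν p) := a4
      _ ≤ C₂ * ((C * ‖m p‖) * CHG.smoothWeight ν p) := by gcongr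
      _ = C * C₂ * (‖m p‖ * CHG.smoothWeight ν p) := by ring
      _ ≤ _ := by gcongr; nlinarith [mul_pos hC hC₁]

end Estimates
end CHG
namespace CHG
open MeasureTheory Set

/-! ### Plancherel's theorem on `𝕋 × ℝⁿ`. -/

section Plancherel

theorem enorm_sq_eq_lintegral {X : Type*} [MeasurableSpace X] {κ : Measure X} (f : Lp ℂ 2 κ) :
    ‖f‖ₑ ^ 2 = ∫⁻ x, ‖f x‖ₑ ^ 2 ∂κ := by
  rw [Lp.enorm_def]
  have := eLpNorm_nnreal_pow_eq_lintegral (f := f) (μ := κ) (p := 2) two_ne_zero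
  simpa using this

theorem exists_mul {X : Type*} [MeasurableSpace X] {κ : Measure X} {m : X → ℂ}
    (hm : AEStronglyMeasurable m κ) {C : ℝ} (hC : ∀ᵐ x ∂κ, ‖m x‖ ≤ C) (f : Lp ℂ 2 κ) :
    ∃ g : Lp ℂ 2 κ, (∀ᵐ x ∂κ, g x = m x * f x) ∧ ‖g‖ ≤ C * ‖f‖ := by
  have h1 : ∀ᵐ x ∂κ, ‖m x * f x‖ ≤ C * ‖f x‖ := by
    filter_upwards [hC] with x hx
    rw [norm_mul]
    gcongr
  have h2 : MemLp (fun x => m x * f x) 2 κ :=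
    (Lp.memLp f).of_le_mul (hm.mul (Lp.aestronglyMeasurable f)) h1
  have h3 := h2.coeFn_toLp
  refine ⟨h2.toLp _, h3, Lp.norm_le_mul_norm_of_ae_le_mul ?_⟩
  filter_upwards [h1, h3] with x e1 e2
  rw [e2]; exact e1

variable {T : ℝ} [hT : Fact (0 < T)] {d : ℕ}

theorem tsum_enorm_sq_fourierCoeff {f : AddCircle T → ℂ}
    (hf : MemLp f 2 AddCircle.haarAddCircle) :
    ∑' k : ℤ, ‖fourierCoeff f k‖ₑ ^ 2 = ∫⁻ t, ‖f t‖ₑ ^ 2 ∂AddCircle.haarAddCircle := by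
  set F := hf.toLp f
  have h1 : ∀ k, fourierCoeff f k = fourierBasis.repr F k := fun k => by
    rw [fourierBasis_repr, congrFun (fourierCoeff_congr_ae hf.coeFn_toLp) k]
  have h2 : HasSum (fun k => ‖fourierCoeff f k‖ ^ 2) (‖F‖ ^ 2) := by
    have := lp.hasSum_norm (by simp) ((fourierBasis (T := T)).repr F)
    rw [LinearIsometryEquiv.norm_map] at this
    simp_rw [h1]
    exact_mod_cast this
  have h3 : ∑' k : ℤ, ‖fourierCoeff f k‖ₑ ^ 2 = ‖F‖ₑ ^ 2 := by
    simp_rw [← ofReal_norm, ← ENNReal.ofReal_pow (norm_nonneg _)]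
    rw [← ENNReal.ofReal_tsum_of_nonneg (fun _ => by positivity) h2.summable, h2.tsum_eq]
  rw [h3, enorm_sq_eq_lintegral]
  refine lintegral_congr_ae ?_
  filter_upwards [hf.coeFn_toLp] with t ht
  rw [ht]

theorem timeCoeff_ae (f : L2G T d) (k : ℤ) :
    ∀ᵐ x : Space d, timeCoeff f k x = fourierCoeff (fun t => f (t, x)) k :=
  (memLp_timeCoeff f k).coeFn_toLp

/-- Parseval on the circle for almost every `x`, integrated over `x` by Tonelli. -/
theorem tsum_enorm_sq_timeCoeff (f : L2G T d) : ∑' k : ℤ, ‖timeCoeff f k‖ₑ ^ 2 = ‖f‖ₑ ^ 2 := by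
  have h1 : ∀ k, ‖timeCoeff f k‖ₑ ^ 2 =
      ∫⁻ x : Space d, ‖fourierCoeff (fun t => f (t, x)) k‖ₑ ^ 2 := fun k => by
    rw [enorm_sq_eq_lintegral]
    refine lintegral_congr_ae ?_
    filter_upwards [timeCoeff_ae f k] with x hx
    rw [hx]
  simp_rw [h1]
  rw [← lintegral_tsum fun k => (memLp_timeCoeff f k).1.enorm.pow_const _,
    enorm_sq_eq_lintegral, lintegral_prod_symm _ ((Lp.aestronglyMeasurable f).enorm.pow_const _)]
  refine lintegral_congr_ae ?_
  filter_upwards [memLp_slice f] with x hx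
  exact tsum_enorm_sq_fourierCoeff hx

theorem hasSum_norm_sq_fourierG (f : L2G T d) :
    HasSum (fun k : ℤ => ‖fourierG f k‖ ^ 2) (‖f‖ ^ 2) := by
  have h1 : ∀ k, ‖fourierG f k‖ = ‖timeCoeff f k‖ := fun k =>
    LinearIsometryEquiv.norm_map _ _
  simp_rw [h1]
  have h2 := tsum_enorm_sq_timeCoeff f
  have h3 : ∀ k : ℤ, ‖timeCoeff f k‖ₑ ^ 2 ≠ ⊤ := fun k => by finiteness
  have h4 : ∑' k : ℤ, ‖timeCoeff f k‖ₑ ^ 2 ≠ ⊤ := by rw [h2]; finiteness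
  have h5 := ENNReal.hasSum_toReal h4
  rw [← ENNReal.tsum_toReal_eq h3, h2] at h5
  simpa using h5

/-- The Fourier transform as an isometry of `L²(G)` into `ℓ²(ℤ; L²(ℝⁿ))`. -/
noncomputable def fourierIsometry :
    L2G T d →ₗᵢ[ℂ] lp (fun _ : ℤ => L2Space d) 2 where
  toFun f := ⟨fun k => fourierG f k, memℓp_gen (by
    simpa using (hasSum_norm_sq_fourierG f).summable)⟩
  map_add' f g := Subtype.ext (funext fun k => fourierG_add f g k)
  map_smul' c f := Subtype.ext (funext fun k => fourierG_smul c f k)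
  norm_map' f := by
    have h1 := lp.hasSum_norm (p := 2) (by simp) (⟨fun k => fourierG f k, memℓp_gen (by
      simpa using (hasSum_norm_sq_fourierG f).summable)⟩ : lp (fun _ : ℤ => L2Space d) 2)
    have h2 := h1.unique (f := fun k : ℤ => ‖fourierG f k‖ ^ (2 : ENNReal).toReal)
      (a₂ := ‖f‖ ^ 2) (by simpa using hasSum_norm_sq_fourierG f)
    simp only [ENNReal.toReal_ofNat, Real.rpow_ofNat] at h2
    exact (pow_left_inj₀ (norm_nonneg _) (norm_nonneg _) two_ne_zero).1 h2

theorem exists_timeCoeff_single (k : ℤ) (g : L2Space d) :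
    ∃ f : L2G T d, ∀ j, timeCoeff f j = if j = k then g else 0 := by
  have h1 : MemLp (fun z : AddCircle T × Space d => g z.2) 2 (haarG T d) :=
    (Lp.memLp g).comp_measurePreserving measurePreserving_snd
  have h2 : MemLp (fun z : AddCircle T × Space d => fourier k z.1 * g z.2) 2 (haarG T d) := by
    refine h1.of_le_mul (c := 1) ?_ (Filter.Eventually.of_forall fun z => ?_)
    · exact ((map_continuous (fourier k)).comp continuous_fst).aestronglyMeasurable.mul h1.1
    · rw [norm_mul, fourier_apply, Circle.norm_coe]
  refine ⟨h2.toLp _, fun j => Lp.ext ?_⟩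
  have h3 := ae_slice (p := fun z => h2.toLp _ z = fourier k z.1 * g z.2) h2.coeFn_toLp
  filter_upwards [timeCoeff_ae (h2.toLp _) j, h3, Lp.coeFn_zero ℂ 2 (volume : Measure (Space d))]
    with x e1 e2 e3
  rw [e1, congrFun (fourierCoeff_congr_ae e2) j]
  have h4 : (fun t : AddCircle T => fourier k t * g x) = fun t => g x * fourier k t := by
    funext t; ring
  rw [h4, fourierCoeff.const_mul, fourierCoeff_fourier]
  split_ifs with h
  · subst h; simp
  · rw [e3]; simp [h]

/-- The range of an isometry is closed, and it contains the sequences supported at one frequency,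
whose finite sums approximate every element of `ℓ²`. -/
theorem exists_fourierG {F : ℤ → L2Space d} (hF : Summable fun k => ‖F k‖ ^ 2) :
    ∃ f : L2G T d, ∀ k, fourierG f k = F k := by
  let y : lp (fun _ : ℤ => L2Space d) 2 := ⟨F, memℓp_gen (by simpa using hF)⟩
  have hcl : IsClosed (LinearMap.range (fourierIsometry (T := T) (d := d)).toLinearMap :
      Set (lp (fun _ : ℤ => L2Space d) 2)) :=
    (fourierIsometry (T := T) (d := d)).isometry.isClosedEmbedding.isClosed_range
  have hs := lp.hasSum_single (p := 2) (by simp) y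
  have hmem : y ∈ LinearMap.range (fourierIsometry (T := T) (d := d)).toLinearMap := by
    refine hcl.mem_of_tendsto hs (Filter.Eventually.of_forall fun s => ?_)
    refine Submodule.sum_mem _ fun k _ => ?_
    obtain ⟨f, hf⟩ := exists_timeCoeff_single (T := T) k
      ((Lp.fourierTransformₗᵢ (Space d) ℂ).symm (F k))
    refine ⟨f, Subtype.ext (funext fun j => ?_)⟩
    change fourierG f j = _
    rw [fourierG, hf]
    by_cases h : j = k
    · subst h
      rw [if_pos rfl, LinearIsometryEquiv.apply_symm_apply]
      exact (lp.single_apply_self (E := fun _ : ℤ => L2Space d) 2 j (F j)).symm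
    · rw [if_neg h, map_zero]
      exact (lp.single_apply_ne (E := fun _ : ℤ => L2Space d) 2 k (F k) h).symm
  obtain ⟨f, hf⟩ := hmem
  refine ⟨f, fun k => ?_⟩
  have := congrArg (fun z : lp (fun _ : ℤ => L2Space d) 2 => z k) hf
  exact this

theorem fourierG_ext {f g : L2G T d} (h : ∀ k, ∀ᵐ ξ : Space d, fourierG f k ξ = fourierG g k ξ) :
    f = g :=
  fourierIsometry.injective (Subtype.ext (funext fun k => Lp.ext (h k)))

theorem exists_fourierG_mul {a : ℤ → Space d → ℂ}
    (ha : ∀ k, AEStronglyMeasurable (a k) volume) {C : ℝ}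
    (hC : ∀ k, ∀ᵐ ξ : Space d, ‖a k ξ‖ ≤ C) (f : L2G T d) :
    ∃ g : L2G T d, (∀ k, ∀ᵐ ξ : Space d, fourierG g k ξ = a k ξ * fourierG f k ξ) ∧
      ‖g‖ ≤ C * ‖f‖ := by
  have hC0 : 0 ≤ C := by
    obtain ⟨ξ, hξ⟩ := (hC 0).exists
    exact (norm_nonneg _).trans hξ
  choose G hG hG' using fun k => exists_mul (ha k) (hC k) (fourierG f k)
  have hs := hasSum_norm_sq_fourierG f
  have hle : ∀ k, ‖G k‖ ^ 2 ≤ C ^ 2 * ‖fourierG f k‖ ^ 2 := fun k => by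
    rw [← mul_pow]
    exact pow_le_pow_left₀ (norm_nonneg _) (hG' k) 2
  have hGs : Summable fun k => ‖G k‖ ^ 2 :=
    (hs.summable.mul_left (C ^ 2)).of_nonneg_of_le (fun _ => by positivity) hle
  obtain ⟨g, hg⟩ := exists_fourierG (T := T) hGs
  refine ⟨g, fun k => by rw [hg k]; exact hG k, ?_⟩
  have h1 := hasSum_norm_sq_fourierG g
  simp_rw [hg] at h1
  have h2 := hasSum_le hle h1 (hs.mul_left (C ^ 2))
  rw [← mul_pow] at h2
  exact le_of_sq_le_sq h2 (by positivity)

end Plancherel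
end CHG
namespace CHG
open MeasureTheory Set

/-! ### Multiplier operators between the spaces `H^μ_⊥`. -/

section Frequencies

variable {T : ℝ} {d : ℕ}

/-- The comparison with `growth` needs `ξ ≠ 0`, which excludes only a null set because the space has
dimension `d + 1 ≥ 1`. -/
theorem ae_freq_snd_ne_zero (k : ℤ) : ∀ᵐ ξ : Space d, (freq T k ξ).2 ≠ 0 := by
  have h : ∀ᵐ ξ : Space d, ξ ≠ 0 := by
    rw [ae_iff]; simp
  filter_upwards [h] with ξ hξ
  simp [freq, hξ, Real.pi_ne_zero]

theorem measurable_freq (k : ℤ) : Measurable (freq (d := d) T k) := by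
  unfold freq
  fun_prop

end Frequencies

section Multipliers

variable {T : ℝ} [hT : Fact (0 < T)] {d : ℕ} {μ μ' : OrderFn}

theorem freq_fst_eq_zero (k : ℤ) (ξ : Space d) : (freq T k ξ).1 = 0 ↔ k = 0 := by
  have := hT.out
  simp [freq, Real.pi_ne_zero, this.ne']

theorem le_abs_freq_fst {k : ℤ} (hk : k ≠ 0) (ξ : Space d) :
    2 * Real.pi / T ≤ |(freq T k ξ).1| := by
  have hT' := hT.out
  have h1 : (1 : ℝ) ≤ |(k : ℝ)| := by exact_mod_cast Int.one_le_abs hk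
  have h2 : |(freq T k ξ).1| = 2 * Real.pi / T * |(k : ℝ)| := by
    simp only [freq, abs_div, abs_mul, abs_of_pos hT', abs_of_pos Real.pi_pos, abs_two]
    ring
  rw [h2]
  have := Real.pi_pos
  exact le_mul_of_one_le_right (by positivity) h1

theorem IsStrictlyPositiveOrder.measurable_smoothWeight (h : IsStrictlyPositiveOrder μ) :
    Measurable (smoothWeight (d := d) μ) := by
  have : smoothWeight (d := d) μ = fun p => 1 + ∑ v ∈ h.vertices_finite.toFinset,
      (1 + |p.1| ^ 2) ^ (v.2 / 2) * (1 + ‖p.2‖ ^ 2) ^ (v.1 / 2) := by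
    funext p
    rw [smoothWeight, finsum_mem_eq_finite_toFinset_sum _ h.vertices_finite]
  rw [this]
  fun_prop

theorem toL2_injective : Function.Injective (toL2 (T := T) (d := d) (μ := μ)) :=
  Subtype.val_injective

theorem timeCoeff_eq_zero_iff (f : L2G T d) (k : ℤ) : timeCoeff f k = 0 ↔ fourierG f k = 0 :=
  ((Lp.fourierTransformₗᵢ (Space d) ℂ).map_eq_zero_iff).symm

theorem fourierG_toL2_zero (f : NewtonSpace T d μ) : fourierG (toL2 f) 0 = 0 :=
  (timeCoeff_eq_zero_iff _ _).1 f.2.1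

/-- The symbol `(1 - δ_ℤ) m`. -/
noncomputable def perpSymbol (m : ℝ × Space d → ℂ) : ℝ × Space d → ℂ :=
  fun p => if p.1 = 0 then 0 else m p

theorem perpSymbol_freq_zero (m : ℝ × Space d → ℂ) (ξ : Space d) :
    perpSymbol m (freq T 0 ξ) = 0 := by
  rw [perpSymbol, if_pos ((freq_fst_eq_zero _ _).2 rfl)]

theorem perpSymbol_freq (m : ℝ × Space d → ℂ) {k : ℤ} (hk : k ≠ 0) (ξ : Space d) :
    perpSymbol m (freq T k ξ) = m (freq T k ξ) := by
  rw [perpSymbol, if_neg (mt (freq_fst_eq_zero _ _).1 hk)]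

/-- The symbol bound under which `op[m]` is bounded from `H^μ_⊥` to `H^μ'_⊥`. -/
def SymbolBound (T : ℝ) (μ μ' : OrderFn) (m : ℝ × Space d → ℂ) : Prop :=
  ∃ C : ℝ, ∀ k : ℤ, k ≠ 0 → ∀ᵐ ξ : Space d,
    ‖m (freq T k ξ)‖ * smoothWeight μ' (freq T k ξ) ≤ C * smoothWeight μ (freq T k ξ)

theorem one_le_smoothWeight (p : ℝ × Space d) : 1 ≤ smoothWeight μ p := by
  have : 0 ≤ ∑ᶠ v ∈ vertices μ, (1 + |p.1| ^ 2) ^ (v.2 / 2) * (1 + ‖p.2‖ ^ 2) ^ (v.1 / 2) :=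
    finsum_nonneg fun v => finsum_nonneg fun _ => by positivity
  unfold smoothWeight
  linarith

theorem exists_isOp (hμ : IsStrictlyPositiveOrder μ) (hμ' : IsStrictlyPositiveOrder μ')
    {m : ℝ × Space d → ℂ} (hm : Measurable m) (hb : SymbolBound T μ μ' m) :
    ∃ A : NewtonSpace T d μ →L[ℂ] NewtonSpace T d μ', IsOp m A := by
  obtain ⟨C, hC⟩ := hb
  have hmeas : ∀ k, Measurable fun ξ : Space d => perpSymbol m (freq T k ξ) := fun k => by
    by_cases hk : k = 0
    · subst hk; simp only [perpSymbol_freq_zero]; exact measurable_const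
    · simp only [perpSymbol_freq m hk]
      exact hm.comp (measurable_freq k)
  have hw : ∀ k, Measurable fun ξ : Space d => (smoothWeight μ (freq T k ξ) : ℂ) := fun k =>
    Complex.measurable_ofReal.comp (hμ.measurable_smoothWeight.comp (measurable_freq k))
  have hw' : ∀ k, Measurable fun ξ : Space d => (smoothWeight μ' (freq T k ξ) : ℂ) := fun k =>
    Complex.measurable_ofReal.comp (hμ'.measurable_smoothWeight.comp (measurable_freq k))
  have hbd : ∀ k, ∀ᵐ ξ : Space d, ‖perpSymbol m (freq T k ξ) * smoothWeight μ' (freq T k ξ) /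
      smoothWeight μ (freq T k ξ)‖ ≤ max C 0 := fun k => by
    by_cases hk : k = 0
    · subst hk; simp [perpSymbol_freq_zero]
    · filter_upwards [hC k hk] with ξ hξ
      have h1 := smoothWeight_pos μ (freq T k ξ)
      have h2 := smoothWeight_pos μ' (freq T k ξ)
      rw [perpSymbol_freq m hk, norm_div, norm_mul, Complex.norm_real, Complex.norm_real,
        Real.norm_of_nonneg h1.le, Real.norm_of_nonneg h2.le, div_le_iff₀ h1]
      exact hξ.trans (mul_le_mul_of_nonneg_right (le_max_left _ _) h1.le)
  have hbd' : ∀ k, ∀ᵐ ξ : Space d,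
      ‖perpSymbol m (freq T k ξ) / smoothWeight μ (freq T k ξ)‖ ≤ max C 0 := fun k => by
    filter_upwards [hbd k] with ξ hξ
    refine le_trans ?_ hξ
    rw [mul_div_right_comm, norm_mul]
    refine le_mul_of_one_le_right (norm_nonneg _) ?_
    rw [Complex.norm_real, Real.norm_of_nonneg (smoothWeight_pos μ' _).le]
    exact one_le_smoothWeight _
  have key : ∀ f : NewtonSpace T d μ, ∃ u : NewtonSpace T d μ',
      IsMultiplier (perpSymbol m) (toL2 f) (toL2 u) ∧ ‖u‖ ≤ max C 0 * ‖f‖ := by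
    intro f
    -- Everything is computed from `op[w_μ] f`: the symbol `m / w_μ` gives the image `u`, bounded
    -- since `w_μ' ≥ 1`. The symbol `m w_μ' / w_μ` gives `h = op[w_μ'] u`, whose `L²` norm is the
    -- norm of `u` in `H^μ'_⊥`.
    obtain ⟨u, hu, -⟩ := exists_fourierG_mul
      (fun k => ((hmeas k).div (hw k)).aestronglyMeasurable) hbd' (opWeight f)
    obtain ⟨h, hh, hn⟩ := exists_fourierG_mul
      (fun k => (((hmeas k).mul (hw' k)).div (hw k)).aestronglyMeasurable) hbd (opWeight f)
    have hf := opWeight_spec f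
    have h1 : IsMultiplier (perpSymbol m) (toL2 f) u := fun k => by
      filter_upwards [hu k, hf k] with ξ e1 e2
      have := (smoothWeight_pos μ (freq T k ξ)).ne'
      rw [e1, e2]
      have h0 : (smoothWeight μ (freq T k ξ) : ℂ) ≠ 0 := by exact_mod_cast this
      simp only [Pi.div_apply]
      field_simp
    have h2 : IsMultiplier (fun p => (smoothWeight μ' p : ℂ)) u h := fun k => by
      filter_upwards [hu k, hh k] with ξ e1 e2
      rw [e1, e2]
      simp only [Pi.div_apply, Pi.mul_apply]
      ring
    have h3 : timeCoeff u 0 = 0 := by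
      rw [timeCoeff_eq_zero_iff]
      refine Lp.ext ?_
      filter_upwards [hu 0, Lp.coeFn_zero ℂ 2 (volume : Measure (Space d))] with ξ e1 e2
      rw [e1, e2]
      simp [perpSymbol_freq_zero]
    let v : NewtonSpace T d μ' := ⟨u, h3, h, h2⟩
    refine ⟨v, h1, ?_⟩
    have h4 : opWeight v = h := (opWeight_spec v).unique h2
    change ‖opWeight v‖ ≤ max C 0 * ‖opWeight f‖
    rw [h4]
    exact hn
  choose u hu hn using key
  let L : NewtonSpace T d μ →ₗ[ℂ] NewtonSpace T d μ' :=
    { toFun := u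
      map_add' := fun f g => toL2_injective (by
        rw [map_add]
        refine (hu (f + g)).unique ?_
        rw [map_add]
        exact (hu f).add (hu g))
      map_smul' := fun c f => toL2_injective (by
        rw [RingHom.id_apply, map_smul]
        refine (hu (c • f)).unique ?_
        rw [map_smul]
        exact (hu f).smul c) }
  exact ⟨L.mkContinuous _ hn, hu⟩

theorem exists_isOp_equiv (hμ : IsStrictlyPositiveOrder μ) (hμ' : IsStrictlyPositiveOrder μ')
    {m : ℝ × Space d → ℂ} (hm : Measurable m) (hb : SymbolBound T μ μ' m)
    (hb' : SymbolBound T μ' μ fun p => (m p)⁻¹)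
    (h0 : ∀ k : ℤ, k ≠ 0 → ∀ᵐ ξ : Space d, m (freq T k ξ) ≠ 0) :
    ∃ A : NewtonSpace T d μ ≃L[ℂ] NewtonSpace T d μ',
      IsOp m (A : NewtonSpace T d μ →L[ℂ] NewtonSpace T d μ') ∧
      IsOp (fun p => (m p)⁻¹) (A.symm : NewtonSpace T d μ' →L[ℂ] NewtonSpace T d μ) := by
  obtain ⟨A, hA⟩ := exists_isOp hμ hμ' hm hb
  obtain ⟨B, hB⟩ := exists_isOp hμ' hμ hm.inv hb'
  have h1 : Function.LeftInverse B A := fun f => toL2_injective (fourierG_ext fun k => by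
    -- At frequency zero both symbols are set to zero and are not inverse to each other; there the
    -- identity holds because both functions have vanishing time average.
    by_cases hk : k = 0
    · subst hk
      rw [fourierG_toL2_zero, fourierG_toL2_zero]
      exact Filter.Eventually.of_forall fun _ => rfl
    · filter_upwards [hA f k, hB (A f) k, h0 k hk] with ξ e1 e2 e3
      have hne := mt (freq_fst_eq_zero (T := T) k ξ).1 hk
      rw [e2, e1, if_neg hne, if_neg hne, Pi.inv_apply, inv_mul_cancel_left₀ e3])
  have h2 : Function.RightInverse B A := fun f => toL2_injective (fourierG_ext fun k => by
    by_cases hk : k = 0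
    · subst hk
      rw [fourierG_toL2_zero, fourierG_toL2_zero]
      exact Filter.Eventually.of_forall fun _ => rfl
    · filter_upwards [hA (B f) k, hB f k, h0 k hk] with ξ e1 e2 e3
      have hne := mt (freq_fst_eq_zero (T := T) k ξ).1 hk
      rw [e1, e2, if_neg hne, if_neg hne, Pi.inv_apply, mul_inv_cancel_left₀ e3])
  exact ⟨ContinuousLinearEquiv.equivOfInverse A B h1 h2, hA, hB⟩

/-- The operator with a symbol that grows like the weight function of `μ` is an isomorphism of
order `μ`. -/
theorem HasGrowth.exists_isOp_equiv {ν : OrderFn} {m : ℝ × Space d → ℂ}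
    (h : HasGrowth (2 * Real.pi / T) μ m) (hm : Measurable m)
    (hμ : IsStrictlyPositiveOrder μ) (hν : IsStrictlyPositiveOrder ν) :
    ∃ A : NewtonSpace T d (μ + ν) ≃L[ℂ] NewtonSpace T d ν,
      IsOp m (A : NewtonSpace T d (μ + ν) →L[ℂ] NewtonSpace T d ν) ∧
      IsOp (fun p => (m p)⁻¹) (A.symm : NewtonSpace T d ν →L[ℂ] NewtonSpace T d (μ + ν)) := by
  have hlam : 0 < 2 * Real.pi / T := div_pos Real.two_pi_pos hT.out
  obtain ⟨C, hC, H⟩ := h.smoothWeight hlam hμ hν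
  have h0 : ∀ k : ℤ, k ≠ 0 → ∀ᵐ ξ : Space d, m (freq T k ξ) ≠ 0 := fun k hk => by
    filter_upwards [ae_freq_snd_ne_zero (T := T) k] with ξ hξ hm0
    have := (H _ (le_abs_freq_fst hk ξ) hξ).2
    rw [hm0, norm_zero, zero_mul, mul_zero] at this
    exact absurd (smoothWeight_pos _ _) (not_lt.2 this)
  refine CHG.exists_isOp_equiv (hμ.add hν) hν hm ⟨C, fun k hk => ?_⟩ ⟨C, fun k hk => ?_⟩ h0
  · filter_upwards [ae_freq_snd_ne_zero (T := T) k] with ξ hξ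
    exact (H _ (le_abs_freq_fst hk ξ) hξ).1
  · filter_upwards [ae_freq_snd_ne_zero (T := T) k, h0 k hk] with ξ hξ h1
    have := (H _ (le_abs_freq_fst hk ξ) hξ).2
    rw [norm_inv, inv_mul_le_iff₀ (norm_pos_iff.2 h1)]
    linarith

theorem measurable_factorSymbol (σ : ℝ) : Measurable (factorSymbol (d := d) σ) := by
  have h1 : Measurable fun p : ℝ × Space d => (lastCoord p.2 : ℂ) :=
    (hasTemperateGrowth_coord (Fin.last d)).1.continuous.measurable
  have h2 : Measurable fun p : ℝ × Space d => (tangentialSq p.2 : ℂ) :=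
    hasTemperateGrowth_tangentialSq.1.continuous.measurable
  have h3 : Measurable fun p : ℝ × Space d => (p.1 : ℂ) :=
    hasTemperateGrowth_fst.1.continuous.measurable
  have h4 : Measurable fun p : ℝ × Space d => constCoeff p.1 (tangentialSq p.2) :=
    measurable_csqrt.comp hasTemperateGrowth_baseSymbol.1.continuous.measurable
  have h5 : Measurable fun p : ℝ × Space d => linCoeff p.1 (tangentialSq p.2) :=
    measurable_csqrt.comp (((h2.const_mul 2).add (h3.const_mul _)).add (h4.const_mul 2))
  exact ((h1.pow_const 2).sub ((h5.const_mul _).mul h1)).sub h4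

theorem measurable_chgSymbol : Measurable (chgSymbol (d := d)) := by
  have : chgSymbol (d := d) = fun p => factorSymbol (-1) p * factorSymbol 1 p :=
    funext chgSymbol_eq_mul
  rw [this]
  exact (measurable_factorSymbol _).mul (measurable_factorSymbol _)

end Multipliers
end CHG
namespace CHG
open MeasureTheory Set Filter Topology
open scoped FourierTransform

/-! ### The algebra of multipliers on `ℝⁿ` that preserve a half space. -/

section HalfSpace

variable {d : ℕ}

/-- `supp f ⊆ {σ x_n ≥ 0}`. -/
def HalfSupported (σ : ℝ) (f : L2Space d) : Prop := ∀ᵐ x : Space d, σ * lastCoord x < 0 → f x = 0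

theorem HalfSupported.zero (σ : ℝ) : HalfSupported σ (0 : L2Space d) := by
  filter_upwards [Lp.coeFn_zero ℂ 2 (volume : Measure (Space d))] with x hx _
  rw [hx]; rfl

theorem HalfSupported.add {σ : ℝ} {f g : L2Space d} (hf : HalfSupported σ f)
    (hg : HalfSupported σ g) : HalfSupported σ (f + g) := by
  filter_upwards [hf, hg, Lp.coeFn_add f g] with x h1 h2 h3 h
  rw [h3, Pi.add_apply, h1 h, h2 h, add_zero]

theorem HalfSupported.smul {σ : ℝ} {f : L2Space d} (c : ℂ) (hf : HalfSupported σ f) :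
    HalfSupported σ (c • f) := by
  filter_upwards [hf, Lp.coeFn_smul c f] with x h1 h3 h
  rw [h3, Pi.smul_apply, h1 h, smul_zero]

/-- An `L²`-convergent sequence has a subsequence converging almost everywhere. -/
theorem HalfSupported.of_tendsto {σ : ℝ} {f : ℕ → L2Space d} {g : L2Space d}
    (hf : ∀ j, HalfSupported σ (f j)) (h : Tendsto f atTop (𝓝 g)) : HalfSupported σ g := by
  obtain ⟨ns, -, hns⟩ := (tendstoInMeasure_of_tendsto_Lp h).exists_seq_tendsto_ae
  filter_upwards [hns, ae_all_iff.2 hf] with x h1 h2 h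
  refine tendsto_nhds_unique h1 ?_
  simp only [fun j => h2 j h]
  exact tendsto_const_nhds

theorem tendsto_of_tendsto_mul {X : Type*} [MeasurableSpace X] {κ : Measure X}
    {m : ℕ → X → ℂ} {m' : X → ℂ} {B : X → ℝ} {f g : Lp ℂ 2 κ} {F : ℕ → Lp ℂ 2 κ}
    (hF : ∀ j, ∀ᵐ x ∂κ, F j x = m j x * f x) (hg : ∀ᵐ x ∂κ, g x = m' x * f x)
    (hm : ∀ᵐ x ∂κ, Tendsto (fun j => m j x) atTop (𝓝 (m' x)))
    (hB : ∀ j, ∀ᵐ x ∂κ, ‖m j x‖ ≤ B x) (hBf : MemLp (fun x => B x * ‖f x‖) 2 κ) :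
    Tendsto F atTop (𝓝 g) := by
  rw [tendsto_iff_norm_sub_tendsto_zero]
  have key : Tendsto (fun j => ‖F j - g‖ₑ ^ 2) atTop (𝓝 0) := by
    simp_rw [enorm_sq_eq_lintegral]
    have h0 : (0 : ENNReal) = ∫⁻ x, (fun _ => 0) x ∂κ := by simp
    rw [h0]
    -- The bound `B` passes to the limit symbol, so `|m_j - m'| ≤ 2B`.
    refine tendsto_lintegral_of_dominated_convergence' (fun x => (2 * ‖B x * ‖f x‖‖ₑ) ^ 2)
      (fun j => ((Lp.aestronglyMeasurable (F j - g)).enorm.pow_const _)) (fun j => ?_) ?_ ?_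
    · filter_upwards [Lp.coeFn_sub (F j) g, hF j, hg, ae_all_iff.2 hB, hm] with x h1 h2 h3 h4 h5
      have h6 : ‖m' x‖ ≤ B x := le_of_tendsto h5.norm (Eventually.of_forall h4)
      have hB0 : 0 ≤ B x := (norm_nonneg _).trans h6
      gcongr
      rw [h1, Pi.sub_apply, h2, h3, ← sub_mul]
      have h7 : ‖(m j x - m' x) * f x‖ ≤ 2 * (B x * ‖f x‖) := by
        rw [norm_mul, ← mul_assoc]
        gcongr
        linarith [norm_sub_le (m j x) (m' x), h4 j]
      have h8 : (2 : ENNReal) * ‖B x * ‖f x‖‖ₑ = ‖2 * (B x * ‖f x‖)‖ₑ := by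
        have h9 : ‖(2 : ℝ)‖ₑ = 2 := by rw [← ofReal_norm]; simp
        rw [enorm_mul 2, h9]
      rw [h8, ← ofReal_norm, ← ofReal_norm, Real.norm_of_nonneg (by positivity)]
      exact ENNReal.ofReal_le_ofReal h7
    · have := lintegral_rpow_enorm_lt_top_of_eLpNorm_lt_top (by norm_num) (by norm_num) hBf.2
      simp only [ENNReal.toReal_ofNat, ENNReal.rpow_ofNat] at this
      simp_rw [mul_pow]
      rw [lintegral_const_mul' _ _ (by finiteness)]
      exact ENNReal.mul_ne_top (by finiteness) this.ne
    · filter_upwards [ae_all_iff.2 fun j => Lp.coeFn_sub (F j) g, ae_all_iff.2 hF, hg, hm]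
        with x h1 h2 h3 h5
      have h6 : Tendsto (fun j => (F j - g) x) atTop (𝓝 0) := by
        have : ∀ j, (F j - g) x = (m j x - m' x) * f x := fun j => by
          rw [h1 j, Pi.sub_apply, h2 j, h3, sub_mul]
        simp_rw [this]
        have h7 := (h5.sub_const (m' x)).mul_const (f x)
        simpa using h7
      have h8 := ((ENNReal.continuous_pow 2).tendsto _).comp h6.enorm
      simpa [Function.comp_def] using h8
  have h1 : Tendsto (fun j => (‖F j - g‖ₑ ^ 2).toReal) atTop (𝓝 0) :=
    (ENNReal.tendsto_toReal (by simp)).comp key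
  have h2 : Tendsto (fun j => ‖F j - g‖ ^ 2) atTop (𝓝 0) := by simpa using h1
  have h3 := h2.sqrt
  simpa [Real.sqrt_sq] using h3

/-- The Fourier transform on `L²(ℝⁿ)`. -/
noncomputable abbrev fourierL2 : L2Space d ≃ₗᵢ[ℂ] L2Space d := Lp.fourierTransformₗᵢ (Space d) ℂ

/-- The bounded measurable symbols on `ℝⁿ` whose Fourier multiplier preserves the support in
`{σ x_n ≥ 0}`. -/
def supportSymbols (d : ℕ) (σ : ℝ) : Subalgebra ℂ (Space d → ℂ) where
  carrier := {m | Measurable m ∧ (∃ C : ℝ, ∀ ξ, ‖m ξ‖ ≤ C) ∧ ∀ f g : L2Space d,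
    (∀ᵐ ξ, fourierL2 g ξ = m ξ * fourierL2 f ξ) → HalfSupported σ f → HalfSupported σ g}
  mul_mem' := by
    rintro a b ⟨ha, ⟨C, hC⟩, H⟩ ⟨hb, ⟨C', hC'⟩, H'⟩
    refine ⟨ha.mul hb, ⟨C * C', fun ξ => ?_⟩, fun f g hfg hf => ?_⟩
    · rw [Pi.mul_apply, norm_mul]
      exact mul_le_mul (hC ξ) (hC' ξ) (norm_nonneg _) ((norm_nonneg _).trans (hC ξ))
    · obtain ⟨h, hh, -⟩ := exists_mul hb.aestronglyMeasurable (Eventually.of_forall hC')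
        (fourierL2 f)
      refine H (fourierL2.symm h) g ?_ (H' f _ ?_ hf)
      · rw [LinearIsometryEquiv.apply_symm_apply]
        filter_upwards [hfg, hh] with ξ h1 h2
        rw [h1, h2, Pi.mul_apply, mul_assoc]
      · rw [LinearIsometryEquiv.apply_symm_apply]
        exact hh
  add_mem' := by
    rintro a b ⟨ha, ⟨C, hC⟩, H⟩ ⟨hb, ⟨C', hC'⟩, H'⟩
    refine ⟨ha.add hb, ⟨C + C', fun ξ => ?_⟩, fun f g hfg hf => ?_⟩
    · exact (norm_add_le _ _).trans (add_le_add (hC ξ) (hC' ξ))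
    · obtain ⟨h, hh, -⟩ := exists_mul ha.aestronglyMeasurable (Eventually.of_forall hC)
        (fourierL2 f)
      obtain ⟨h', hh', -⟩ := exists_mul hb.aestronglyMeasurable (Eventually.of_forall hC')
        (fourierL2 f)
      have e : g = fourierL2.symm h + fourierL2.symm h' := by
        apply fourierL2.injective
        rw [map_add, LinearIsometryEquiv.apply_symm_apply, LinearIsometryEquiv.apply_symm_apply]
        refine Lp.ext ?_
        filter_upwards [hfg, hh, hh', Lp.coeFn_add h h'] with ξ h1 h2 h3 h4
        rw [h1, h4, Pi.add_apply, Pi.add_apply, h2, h3, add_mul]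
      rw [e]
      refine (H f _ ?_ hf).add (H' f _ ?_ hf) <;> rw [LinearIsometryEquiv.apply_symm_apply] <;>
        assumption
  algebraMap_mem' := by
    intro c
    refine ⟨measurable_const, ⟨‖c‖, fun ξ => le_rfl⟩, fun f g hfg hf => ?_⟩
    have e : g = c • f := by
      apply fourierL2.injective
      rw [map_smul]
      refine Lp.ext ?_
      filter_upwards [hfg, Lp.coeFn_smul c (fourierL2 f)] with ξ h1 h2
      rw [h1, h2]
      rfl
    rw [e]
    exact hf.smul c

variable {σ : ℝ}

/-- The limit symbol may be unbounded: only `B |f̂| ∈ L²` is required. Bounded limits remain in the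
algebra, while the polynomial factors need this general form. -/
theorem halfSupported_of_tendsto {m : ℕ → Space d → ℂ} {m' : Space d → ℂ} {B : Space d → ℝ}
    {f g : L2Space d} (hm : ∀ j, m j ∈ supportSymbols d σ)
    (hlim : ∀ ξ, Tendsto (fun j => m j ξ) atTop (𝓝 (m' ξ))) (hB : ∀ j ξ, ‖m j ξ‖ ≤ B ξ)
    (hBf : MemLp (fun ξ => B ξ * ‖fourierL2 f ξ‖) 2 volume)
    (hfg : ∀ᵐ ξ, fourierL2 g ξ = m' ξ * fourierL2 f ξ) (hf : HalfSupported σ f) :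
    HalfSupported σ g := by
  have hex : ∀ j, ∃ h : L2Space d, ∀ᵐ ξ, h ξ = m j ξ * fourierL2 f ξ := fun j => by
    obtain ⟨C, hC⟩ := (hm j).2.1
    obtain ⟨h, hh, -⟩ := exists_mul (hm j).1.aestronglyMeasurable (Eventually.of_forall hC)
      (fourierL2 f)
    exact ⟨h, hh⟩
  choose F hF using hex
  have h1 := tendsto_of_tendsto_mul hF hfg (Eventually.of_forall hlim)
    (fun j => Eventually.of_forall (hB j)) hBf
  have h2 : Tendsto (fun j => fourierL2.symm (F j)) atTop (𝓝 g) := by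
    have := (fourierL2 (d := d)).symm.continuous.continuousAt.tendsto.comp h1
    rwa [LinearIsometryEquiv.symm_apply_apply] at this
  refine HalfSupported.of_tendsto (fun j => (hm j).2.2 f _ ?_ hf) h2
  rw [LinearIsometryEquiv.apply_symm_apply]
  exact hF j

theorem supportSymbols_of_tendsto {m : ℕ → Space d → ℂ} {m' : Space d → ℂ} {C : ℝ}
    (hm : ∀ j, m j ∈ supportSymbols d σ)
    (hlim : ∀ ξ, Tendsto (fun j => m j ξ) atTop (𝓝 (m' ξ))) (hC : ∀ j ξ, ‖m j ξ‖ ≤ C) :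
    m' ∈ supportSymbols d σ :=
  ⟨measurable_of_tendsto_metrizable (fun j => (hm j).1) (tendsto_pi_nhds.2 hlim),
    ⟨C, fun ξ => le_of_tendsto (hlim ξ).norm (Eventually.of_forall fun j => hC j ξ)⟩,
    fun f _ hfg hf => halfSupported_of_tendsto (B := fun _ => C) hm hlim hC
      ((Lp.memLp (fourierL2 f)).norm.const_mul C) hfg hf⟩

/-- The Neumann series: its partial sums lie in the algebra and are bounded by `(1 - r)⁻¹`. -/
theorem supportSymbols_inv_one_sub {a : Space d → ℂ} (ha : a ∈ supportSymbols d σ) {r : ℝ}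
    (hr : r < 1) (har : ∀ ξ, ‖a ξ‖ ≤ r) : (fun ξ => (1 - a ξ)⁻¹) ∈ supportSymbols d σ := by
  have hr0 : 0 ≤ r := (norm_nonneg _).trans (har 0)
  refine supportSymbols_of_tendsto (m := fun N => ∑ l ∈ Finset.range N, a ^ l) (C := (1 - r)⁻¹)
    (fun N => Subalgebra.sum_mem _ fun l _ => Subalgebra.pow_mem _ ha l) (fun ξ => ?_)
    fun N ξ => ?_
  · have := (hasSum_geometric_of_norm_lt_one ((har ξ).trans_lt hr)).tendsto_sum_nat
    simpa using this
  · rw [Finset.sum_apply]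
    refine (norm_sum_le _ _).trans ?_
    refine (Finset.sum_le_sum (g := fun l => r ^ l) fun l _ => ?_).trans ?_
    · rw [Pi.pow_apply, norm_pow]
      exact pow_le_pow_left₀ (norm_nonneg _) (har ξ) l
    · rw [← tsum_geometric_of_lt_one hr0 hr]
      exact (summable_geometric_of_lt_one hr0 hr).sum_le_tsum _ fun l _ => by positivity

end HalfSpace

/-! ### Translations as Fourier multipliers. -/

section Translation

variable {d : ℕ}

/-- The symbol `e^{-2πi y·ξ}` of the translation by `y`. -/
noncomputable def translationSymbol (y ξ : Space d) : ℂ :=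
  Complex.exp (((-(2 * Real.pi * inner ℝ y ξ) : ℝ) : ℂ) * Complex.I)

theorem norm_translationSymbol (y ξ : Space d) : ‖translationSymbol y ξ‖ = 1 :=
  Complex.norm_exp_ofReal_mul_I _

theorem continuous_translationSymbol (y : Space d) : Continuous (translationSymbol y) := by
  unfold translationSymbol
  fun_prop

theorem measurePreserving_sub_const (y : Space d) :
    MeasurePreserving (fun x : Space d => x - y) volume volume :=
  measurePreserving_sub_right volume y

theorem fourierL2_translate (y : Space d) (f : L2Space d) :
    ∀ᵐ ξ, fourierL2 (Lp.compMeasurePreserving _ (measurePreserving_sub_const y) f) ξ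
      = translationSymbol y ξ * fourierL2 f ξ := by
  have hex : ∀ h : L2Space d, ∃ g : L2Space d, ∀ᵐ ξ, g ξ = translationSymbol y ξ * h ξ :=
    fun h => by
      obtain ⟨g, hg, -⟩ := exists_mul (C := 1)
        (continuous_translationSymbol y).aestronglyMeasurable
        (Eventually.of_forall fun ξ => (norm_translationSymbol y ξ).le) h
      exact ⟨g, hg⟩
  choose M hM using hex
  -- A symbol of modulus one acts isometrically, so both sides are continuous in `f` and it suffices
  -- to treat Schwartz functions, where the identity is a substitution in the Fourier integral.
  have hiso : Isometry M := by
    refine Isometry.of_dist_eq fun g h => ?_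
    rw [dist_eq_norm, dist_eq_norm]
    have : ∀ᵐ ξ, ‖(M g - M h) ξ‖ = ‖(g - h) ξ‖ := by
      filter_upwards [hM g, hM h, Lp.coeFn_sub g h, Lp.coeFn_sub (M g) (M h)] with ξ h1 h2 h3 h4
      rw [h4, h3, Pi.sub_apply, Pi.sub_apply, h1, h2, ← mul_sub, norm_mul,
        norm_translationSymbol, one_mul]
    exact le_antisymm (Lp.norm_le_norm_of_ae_le (this.mono fun _ h => h.le))
      (Lp.norm_le_norm_of_ae_le (this.mono fun _ h => h.ge))
  suffices h : fourierL2 (Lp.compMeasurePreserving _ (measurePreserving_sub_const y) f)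
      = M (fourierL2 f) by
    rw [h]; exact hM _
  refine DenseRange.induction_on
    (p := fun f : L2Space d => fourierL2 (Lp.compMeasurePreserving _
      (measurePreserving_sub_const y) f) = M (fourierL2 f))
    (SchwartzMap.denseRange_toLpCLM (p := 2) (F := ℂ) (μ := (volume : Measure (Space d)))
      ENNReal.ofNat_ne_top) f ?_ ?_
  · exact isClosed_eq (fourierL2.continuous.comp
      (Lp.isometry_compMeasurePreserving (measurePreserving_sub_const y)).continuous)
      (hiso.continuous.comp fourierL2.continuous)
  · intro φ
    have e1 : Lp.compMeasurePreserving _ (measurePreserving_sub_const y)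
        (SchwartzMap.toLpCLM ℝ ℂ 2 volume φ) = (φ.compSubConstCLM ℂ y).toLp 2 volume := by
      refine Lp.ext ?_
      filter_upwards [Lp.coeFn_compMeasurePreserving (SchwartzMap.toLpCLM ℝ ℂ 2 volume φ)
          (measurePreserving_sub_const y), (φ.compSubConstCLM ℂ y).coeFn_toLp 2 volume,
        (measurePreserving_sub_const y).quasiMeasurePreserving.ae (φ.coeFn_toLp 2 volume)]
        with x h1 h2 h3
      rw [h1, h2]
      exact h3
    have e2 : ∀ ψ : SchwartzMap (Space d) ℂ, fourierL2 (ψ.toLp 2 volume) = (𝓕 ψ).toLp 2 volume :=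
      fun ψ => SchwartzMap.toLp_fourier_eq ψ
    have e3 : fourierL2 (SchwartzMap.toLpCLM ℝ ℂ 2 volume φ) = (𝓕 φ).toLp 2 volume := e2 φ
    rw [e1, e2, e3]
    refine Lp.ext ?_
    filter_upwards [(𝓕 (φ.compSubConstCLM ℂ y)).coeFn_toLp 2 volume,
      hM ((𝓕 φ).toLp 2 volume), (𝓕 φ).coeFn_toLp 2 volume] with ξ h1 h2 h3
    rw [h1, h2, h3, SchwartzMap.fourier_coe, SchwartzMap.fourier_coe, Real.fourier_eq',
      Real.fourier_eq', ← integral_const_mul]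
    simp only [SchwartzMap.compSubConstCLM_apply]
    rw [← integral_sub_right_eq_self (fun v => translationSymbol y ξ *
      (Complex.exp (((-2 * Real.pi * inner ℝ v ξ : ℝ) : ℂ) * Complex.I) • φ v)) y]
    congr 1
    funext v
    rw [translationSymbol, smul_eq_mul, smul_eq_mul, ← mul_assoc, ← Complex.exp_add,
      inner_sub_left]
    congr 2
    push_cast
    ring

theorem translationSymbol_mem {σ : ℝ} {y : Space d} (hy : 0 ≤ σ * lastCoord y) :
    translationSymbol y ∈ supportSymbols d σ := by
  refine ⟨(continuous_translationSymbol y).measurable,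
    ⟨1, fun ξ => (norm_translationSymbol y ξ).le⟩, fun f g hfg hf => ?_⟩
  have e : g = Lp.compMeasurePreserving _ (measurePreserving_sub_const y) f := by
    apply fourierL2.injective
    refine Lp.ext ?_
    filter_upwards [hfg, fourierL2_translate y f] with ξ h1 h2
    rw [h1, h2]
  rw [e]
  filter_upwards [Lp.coeFn_compMeasurePreserving f (measurePreserving_sub_const y),
    (measurePreserving_sub_const y).quasiMeasurePreserving.ae hf] with x h1 h2 h
  rw [h1]
  refine h2 ?_
  have : lastCoord (x - y) = lastCoord x - lastCoord y := rfl
  rw [this, mul_sub]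
  linarith

end Translation
end CHG
namespace CHG
open MeasureTheory Set Filter Topology

/-! ### Difference quotients as approximations of frequencies. -/

section DifferenceQuotient

/-- The symbol of a difference quotient, which approximates `θ` as `h → 0`. -/
noncomputable def diffQuot (θ h : ℝ) : ℂ :=
  (1 - Complex.exp (((-(θ * h) : ℝ) : ℂ) * Complex.I)) / (Complex.I * h)

theorem norm_diffQuot_le (θ : ℝ) {h : ℝ} (hh : 0 < h) : ‖diffQuot θ h‖ ≤ |θ| := by
  have h1 := Real.norm_exp_I_mul_ofReal_sub_one_le (x := -(θ * h))
  rw [norm_sub_rev, mul_comm Complex.I] at h1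
  rw [diffQuot, norm_div, norm_mul, Complex.norm_I, one_mul, Complex.norm_real,
    Real.norm_of_nonneg hh.le, div_le_iff₀ hh]
  refine h1.trans (le_of_eq ?_)
  rw [Real.norm_eq_abs, abs_neg, abs_mul, abs_of_pos hh]

theorem tendsto_diffQuot (θ : ℝ) :
    Tendsto (fun j : ℕ => diffQuot θ (1 / ((j : ℝ) + 1))) atTop (𝓝 (θ : ℂ)) := by
  have h1 : HasDerivAt (fun h : ℝ => Complex.exp (((-(θ * h) : ℝ) : ℂ) * Complex.I))
      (-(θ : ℂ) * Complex.I) 0 := by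
    have h2 : HasDerivAt (fun h : ℝ => ((-(θ * h) : ℝ) : ℂ) * Complex.I)
        (-(θ : ℂ) * Complex.I) 0 := by
      have h3 : HasDerivAt (fun h : ℝ => -(θ * h)) (-θ) 0 := by
        simpa using ((hasDerivAt_id (0 : ℝ)).const_mul θ).fun_neg
      simpa using h3.ofReal_comp.mul_const Complex.I
    have h4 := h2.cexp
    simpa using h4
  have h5 := h1.tendsto_slope_zero
  have h6 : Tendsto (fun j : ℕ => 1 / ((j : ℝ) + 1)) atTop (𝓝[≠] 0) :=
    tendsto_nhdsWithin_iff.2 ⟨tendsto_one_div_add_atTop_nhds_zero_nat,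
      Eventually.of_forall fun j => by simp only [mem_compl_iff, mem_singleton_iff]; positivity⟩
  have h7 := (h5.comp h6).mul_const Complex.I
  have h8 : -(θ : ℂ) * Complex.I * Complex.I = θ := by
    rw [mul_assoc, Complex.I_mul_I]; ring
  rw [h8] at h7
  refine h7.congr fun j => ?_
  simp only [Function.comp_apply, zero_add, mul_zero, neg_zero, Complex.ofReal_zero, zero_mul,
    Complex.exp_zero, diffQuot, Complex.real_smul]
  have h9 : (((1 / ((j : ℝ) + 1) : ℝ)) : ℂ) ≠ 0 := by
    rw [Complex.ofReal_ne_zero]; positivity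
  rw [Complex.ofReal_inv]
  generalize (((1 / ((j : ℝ) + 1) : ℝ)) : ℂ) = z at *
  field_simp
  rw [Complex.I_sq]
  ring

/-- Expresses the second difference by translations in opposite directions. Both are admissible only
for tangential directions, which is where it is used. -/
theorem normSq_diffQuot (θ h : ℝ) : (Complex.normSq (diffQuot θ h) : ℂ) =
    (2 - Complex.exp (((-(θ * h) : ℝ) : ℂ) * Complex.I)
      - Complex.exp (((-(θ * -h) : ℝ) : ℂ) * Complex.I)) / (h : ℂ) ^ 2 := by
  have e1 : (starRingEnd ℂ) (Complex.exp (((-(θ * h) : ℝ) : ℂ) * Complex.I)) =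
      Complex.exp (((-(θ * -h) : ℝ) : ℂ) * Complex.I) := by
    rw [← Complex.exp_conj, map_mul, Complex.conj_ofReal, Complex.conj_I]
    congr 1
    push_cast; ring
  have e2 : Complex.exp (((-(θ * h) : ℝ) : ℂ) * Complex.I) *
      Complex.exp (((-(θ * -h) : ℝ) : ℂ) * Complex.I) = 1 := by
    rw [← Complex.exp_add, ← Complex.exp_zero]
    congr 1
    push_cast; ring
  rw [Complex.normSq_eq_conj_mul_self, diffQuot, map_div₀, map_sub, map_one, e1, map_mul,
    Complex.conj_I, Complex.conj_ofReal, div_mul_div_comm]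
  have e3 : -Complex.I * (h : ℂ) * (Complex.I * h) = (h : ℂ) ^ 2 := by
    linear_combination (-(h : ℂ) ^ 2) * Complex.I_sq
  rw [e3]
  congr 1
  linear_combination e2

end DifferenceQuotient

/-! ### Tangential multipliers preserve half spaces. -/

section Symbols

variable {d : ℕ} {σ : ℝ}

theorem translationSymbol_single (i : Fin (d + 1)) (h : ℝ) (ξ : Space d) :
    translationSymbol (EuclideanSpace.single i h) ξ =
      Complex.exp (((-((2 * Real.pi) • ξ) i * h : ℝ) : ℂ) * Complex.I) := by
  rw [translationSymbol]
  congr 3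
  simp [EuclideanSpace.inner_single_left]
  ring

theorem translationSymbol_single_castSucc_mem (i : Fin d) (h : ℝ) :
    translationSymbol (EuclideanSpace.single i.castSucc h) ∈ supportSymbols d σ :=
  translationSymbol_mem (by simp [lastCoord, (Fin.castSucc_lt_last i).ne'])

/-- The resolvent of the tangential Laplacian preserves supports, being a limit of resolvents of
difference operators. -/
theorem inv_one_add_tangentialSq_mem :
    (fun ξ : Space d => ((1 + tangentialSq ((2 * Real.pi) • ξ) : ℝ) : ℂ)⁻¹) ∈
      supportSymbols d σ := by
  let S : ℝ → Space d → ℝ := fun h ξ =>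
    ∑ i : Fin d, Complex.normSq (diffQuot (((2 * Real.pi) • ξ) i.castSucc) h)
  have hS : ∀ h ξ, 0 ≤ S h ξ := fun h ξ => Finset.sum_nonneg fun _ _ => Complex.normSq_nonneg _
  refine supportSymbols_of_tendsto (C := 1)
    (m := fun j ξ => ((1 + S (1 / ((j : ℝ) + 1)) ξ : ℝ) : ℂ)⁻¹) (fun j => ?_) (fun ξ => ?_)
    fun j ξ => ?_
  · have hh : (0 : ℝ) < 1 / ((j : ℝ) + 1) := by positivity
    generalize 1 / ((j : ℝ) + 1) = h at *
    -- The discrete operator is `1 + S_h = (h² + 2d - c) / h²` with `|c| ≤ 2d`. Hence `a = c / (h² +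
    -- 2d)` is a strict contraction and the Neumann series applies.
    let c : Space d → ℂ := ∑ i : Fin d, (translationSymbol (EuclideanSpace.single i.castSucc h)
      + translationSymbol (EuclideanSpace.single i.castSucc (-h)))
    have hc : c ∈ supportSymbols d σ := Subalgebra.sum_mem _ fun i _ =>
      Subalgebra.add_mem _ (translationSymbol_single_castSucc_mem i h)
        (translationSymbol_single_castSucc_mem i (-h))
    have hn : (0 : ℝ) < h ^ 2 + 2 * d := by positivity
    have hcn : ∀ ξ, ‖c ξ‖ ≤ 2 * d := fun ξ => by
      simp only [c, Finset.sum_apply, Pi.add_apply]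
      refine (norm_sum_le_of_le (f := fun i : Fin d =>
        translationSymbol (EuclideanSpace.single i.castSucc h) ξ +
          translationSymbol (EuclideanSpace.single i.castSucc (-h)) ξ)
        (n := fun _ => (2 : ℝ)) _ fun i _ => ?_).trans (by simp [mul_comm])
      refine (norm_add_le _ _).trans ?_
      rw [norm_translationSymbol, norm_translationSymbol]
      norm_num
    have ha : (((h ^ 2 + 2 * d : ℝ) : ℂ)⁻¹ • c) ∈ supportSymbols d σ :=
      Subalgebra.smul_mem _ hc _
    have hr : 2 * (d : ℝ) / (h ^ 2 + 2 * d) < 1 := by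
      rw [div_lt_one hn]
      have := pow_pos hh 2
      linarith
    have har : ∀ ξ, ‖(((h ^ 2 + 2 * d : ℝ) : ℂ)⁻¹ • c) ξ‖ ≤ 2 * (d : ℝ) / (h ^ 2 + 2 * d) :=
      fun ξ => by
      rw [Pi.smul_apply, norm_smul, norm_inv, Complex.norm_real, Real.norm_of_nonneg hn.le,
        inv_mul_eq_div]
      gcongr
      exact hcn ξ
    have h1 := Subalgebra.smul_mem _ (supportSymbols_inv_one_sub ha hr har)
      ((h ^ 2 / (h ^ 2 + 2 * d) : ℝ) : ℂ)
    convert h1 using 1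
    funext ξ
    have e1 : (S h ξ : ℂ) = (2 * d - c ξ) / (h : ℂ) ^ 2 := by
      simp only [S, Complex.ofReal_sum, normSq_diffQuot, c, Finset.sum_apply, Pi.add_apply,
        translationSymbol_single]
      rw [← Finset.sum_div]
      congr 1
      have : (2 * d : ℂ) = ∑ i : Fin d, 2 := by simp [mul_comm]
      rw [this, ← Finset.sum_sub_distrib]
      refine Finset.sum_congr rfl fun i _ => ?_
      rw [neg_mul, neg_mul]
      ring
    have hh' : (h : ℂ) ≠ 0 := by exact_mod_cast hh.ne'
    have hn' : (h : ℂ) ^ 2 + 2 * d ≠ 0 := by exact_mod_cast hn.ne'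
    rw [Pi.smul_apply, Pi.smul_apply]
    push_cast
    rw [e1, smul_eq_mul, smul_eq_mul]
    rw [show (1 : ℂ) + (2 * d - c ξ) / (h : ℂ) ^ 2
      = ((h : ℂ) ^ 2 + 2 * d) / (h : ℂ) ^ 2 * (1 - ((h : ℂ) ^ 2 + 2 * d)⁻¹ * c ξ) by
        field_simp; ring, mul_inv, inv_div]
  · have h1 : Tendsto (fun j : ℕ => S (1 / ((j : ℝ) + 1)) ξ) atTop
        (𝓝 (tangentialSq ((2 * Real.pi) • ξ))) := by
      refine tendsto_finsetSum _ fun i _ => ?_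
      have := (Complex.continuous_normSq.tendsto _).comp
        (tendsto_diffQuot (((2 * Real.pi) • ξ) i.castSucc))
      rw [Complex.normSq_ofReal, ← pow_two] at this
      exact this
    have h2 : ((1 + tangentialSq ((2 * Real.pi) • ξ) : ℝ) : ℂ) ≠ 0 := by
      rw [Complex.ofReal_ne_zero]
      have := tangentialSq_nonneg ((2 * Real.pi) • ξ)
      positivity
    exact ((Complex.continuous_ofReal.tendsto _).comp (h1.const_add 1)).inv₀ h2
  · rw [norm_inv, Complex.norm_real, Real.norm_of_nonneg (by linarith [hS (1 / ((j : ℝ) + 1)) ξ])]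
    exact inv_le_one_of_one_le₀ (by linarith [hS (1 / ((j : ℝ) + 1)) ξ])

theorem continuousOn_resolvent_mem {β : ℝ → ℝ} (hβ : ContinuousOn β (Icc 0 1)) :
    (fun ξ : Space d => (β (1 + tangentialSq ((2 * Real.pi) • ξ))⁻¹ : ℂ)) ∈
      supportSymbols d σ := by
  have hs : ∀ ξ : Space d, (1 + tangentialSq ((2 * Real.pi) • ξ))⁻¹ ∈ Icc (0 : ℝ) 1 := fun ξ => by
    have := tangentialSq_nonneg ((2 * Real.pi) • ξ)
    exact ⟨by positivity, inv_le_one_of_one_le₀ (by linarith)⟩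
  obtain ⟨C, hC⟩ := isCompact_Icc.exists_bound_of_continuousOn hβ
  have hpos : ∀ j : ℕ, (0 : ℝ) < 1 / ((j : ℝ) + 1) := fun j => by positivity
  -- Weierstrass: the resolvent takes values in `[0, 1]`, and polynomials in it stay in the algebra.
  choose p hp using fun j : ℕ => exists_polynomial_near_of_continuousOn 0 1 β hβ _ (hpos j)
  refine supportSymbols_of_tendsto (C := C + 1)
    (m := fun j ξ => (((p j).eval (1 + tangentialSq ((2 * Real.pi) • ξ))⁻¹ : ℝ) : ℂ))
    (fun j => ?_) (fun ξ => ?_) fun j ξ => ?_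
  · have h1 : (fun ξ : Space d => (((p j).eval (1 + tangentialSq ((2 * Real.pi) • ξ))⁻¹ : ℝ) : ℂ))
        = ∑ n ∈ Finset.range ((p j).natDegree + 1), ((p j).coeff n : ℂ) •
          (fun ξ : Space d => ((1 + tangentialSq ((2 * Real.pi) • ξ) : ℝ) : ℂ)⁻¹) ^ n := by
      funext ξ
      rw [Polynomial.eval_eq_sum_range]
      simp
    rw [h1]
    exact Subalgebra.sum_mem _ fun n _ =>
      Subalgebra.smul_mem _ (Subalgebra.pow_mem _ inv_one_add_tangentialSq_mem n) _
  · refine (Complex.continuous_ofReal.tendsto _).comp ?_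
    rw [tendsto_iff_dist_tendsto_zero]
    exact squeeze_zero (fun _ => dist_nonneg) (fun j => (hp j _ (hs ξ)).le)
      tendsto_one_div_add_atTop_nhds_zero_nat
  · rw [Complex.norm_real, Real.norm_eq_abs]
    have h1 := (hp j _ (hs ξ)).le
    have h2 := hC _ (hs ξ)
    have h3 : 1 / ((j : ℝ) + 1) ≤ 1 := by
      rw [div_le_one (by positivity)]
      linarith [Nat.cast_nonneg (α := ℝ) j]
    rw [Real.norm_eq_abs] at h2
    have h4 := abs_sub_abs_le_abs_sub
      ((p j).eval (1 + tangentialSq ((2 * Real.pi) • ξ))⁻¹) (β (1 + tangentialSq ((2 * Real.pi) • ξ))⁻¹)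
    linarith

/-- Multipliers that depend only on the tangential frequencies preserve supports (radial real
case). -/
theorem real_tangential_mem {b : ℝ → ℝ} (hb : ContinuousOn b (Ici 0)) {C : ℝ}
    (hC : ∀ l, 0 ≤ l → |b l| ≤ C) :
    (fun ξ : Space d => (b (tangentialSq ((2 * Real.pi) • ξ)) : ℂ)) ∈ supportSymbols d σ := by
  have hC0 : 0 ≤ C := (abs_nonneg _).trans (hC 0 le_rfl)
  -- For `s = (1 + l)⁻¹` the first factor is `b l`. The cut-off forces continuity at `s = 0`, where
  -- `b` is only bounded, and equals `1` as soon as `j ≥ 1 + l`.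
  let β : ℕ → ℝ → ℝ := fun j s => b (s⁻¹ - 1) * min 1 (j * s)
  have hβle : ∀ j, ∀ s ∈ Icc (0 : ℝ) 1, |β j s| ≤ C * (j * s) := fun j s hs => by
    rcases hs.1.eq_or_lt with rfl | h0
    · simp [β]
    · have h1 : 0 ≤ s⁻¹ - 1 := sub_nonneg.2 ((one_le_inv₀ h0).2 hs.2)
      have h2 : 0 ≤ (j : ℝ) * s := by positivity
      rw [abs_mul, abs_of_nonneg (le_min zero_le_one h2)]
      exact mul_le_mul (hC _ h1) (min_le_right _ _) (le_min zero_le_one h2) hC0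
  have hβ : ∀ j, ContinuousOn (β j) (Icc 0 1) := fun j s hs => by
    rcases hs.1.eq_or_lt with rfl | h0
    · have h1 : β j 0 = 0 := by simp [β]
      rw [ContinuousWithinAt, h1]
      have h2 : Tendsto (fun s : ℝ => C * (j * s)) (𝓝[Icc 0 1] 0) (𝓝 0) := by
        have : Continuous fun s : ℝ => C * (j * s) := by fun_prop
        simpa using (this.tendsto 0).mono_left nhdsWithin_le_nhds
      refine squeeze_zero_norm' ?_ h2
      filter_upwards [self_mem_nhdsWithin] with s hs using hβle j s hs
    · have h1 : ContinuousWithinAt (fun s : ℝ => s⁻¹ - 1) (Icc 0 1 ∩ Ioi 0) s :=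
        ((continuousAt_inv₀ h0.ne').sub continuousAt_const).continuousWithinAt
      have h2 : ContinuousWithinAt (fun s : ℝ => b (s⁻¹ - 1)) (Icc 0 1 ∩ Ioi 0) s :=
        (hb (s⁻¹ - 1) (sub_nonneg.2 ((one_le_inv₀ h0).2 hs.2))).comp (t := Ici 0) h1
          fun t ht => sub_nonneg.2 ((one_le_inv₀ ht.2).2 ht.1.2)
      have h3 : Continuous fun s : ℝ => min 1 ((j : ℝ) * s) := by fun_prop
      have h4 := h2.mul (h3.continuousAt (x := s)).continuousWithinAt
      exact h4.mono_of_mem_nhdsWithin (inter_mem_nhdsWithin _ (Ioi_mem_nhds h0))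
  refine supportSymbols_of_tendsto (C := C)
    (m := fun j ξ => (β j (1 + tangentialSq ((2 * Real.pi) • ξ))⁻¹ : ℂ))
    (fun j => continuousOn_resolvent_mem (hβ j)) (fun ξ => ?_) fun j ξ => ?_
  · have hl := tangentialSq_nonneg ((2 * Real.pi) • ξ)
    refine tendsto_const_nhds.congr' ?_
    filter_upwards [eventually_ge_atTop (⌈1 + tangentialSq ((2 * Real.pi) • ξ)⌉₊)] with j hj
    have h1 : 1 + tangentialSq ((2 * Real.pi) • ξ) ≤ j := Nat.ceil_le.1 hj
    simp only [β, inv_inv, add_sub_cancel_left]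
    rw [min_eq_left, mul_one]
    rwa [← div_eq_mul_inv, one_le_div (by positivity)]
  · have hl := tangentialSq_nonneg ((2 * Real.pi) • ξ)
    simp only [β, inv_inv, add_sub_cancel_left]
    have h2 : 0 ≤ (j : ℝ) * (1 + tangentialSq ((2 * Real.pi) • ξ))⁻¹ := by positivity
    rw [Complex.norm_real, Real.norm_eq_abs, abs_mul, abs_of_nonneg (le_min zero_le_one h2)]
    calc _ ≤ C * 1 := mul_le_mul (hC _ hl) (min_le_left _ _) (le_min zero_le_one h2) hC0
      _ = C := mul_one C

theorem tangential_mem {b : ℝ → ℂ} (hb : ContinuousOn b (Ici 0)) {C : ℝ}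
    (hC : ∀ l, 0 ≤ l → ‖b l‖ ≤ C) :
    (fun ξ : Space d => b (tangentialSq ((2 * Real.pi) • ξ))) ∈ supportSymbols d σ := by
  have h1 := real_tangential_mem (d := d) (σ := σ) (Complex.continuous_re.comp_continuousOn hb)
    (C := C) fun l hl => (Complex.abs_re_le_norm _).trans (hC l hl)
  have h2 := real_tangential_mem (d := d) (σ := σ) (Complex.continuous_im.comp_continuousOn hb)
    (C := C) fun l hl => (Complex.abs_im_le_norm _).trans (hC l hl)
  have h3 := Subalgebra.add_mem _ h1 (Subalgebra.smul_mem _ h2 Complex.I)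
  convert h3 using 1
  funext ξ
  simp only [Function.comp_apply, Pi.add_apply, Pi.smul_apply, smul_eq_mul]
  rw [mul_comm Complex.I, Complex.re_add_im]

end Symbols
end CHG
namespace CHG
open MeasureTheory Set Filter Topology

/-! ### Symbols involving the normal frequency. -/

section NormalSymbols

variable {d : ℕ} {σ : ℝ}

theorem abs_eq_one_of_sq (hσ : σ ^ 2 = 1) : |σ| = 1 := by
  rw [← sq_eq_sq₀ (abs_nonneg _) zero_le_one, sq_abs, hσ, one_pow]

theorem continuous_lastCoord_smul :
    Continuous fun ξ : Space d => lastCoord ((2 * Real.pi) • ξ) := by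
  unfold lastCoord
  fun_prop

theorem continuous_tangentialSq_smul :
    Continuous fun ξ : Space d => tangentialSq ((2 * Real.pi) • ξ) := by
  unfold tangentialSq
  fun_prop

/-- The symbol of a one-sided difference quotient in the normal direction. -/
noncomputable def normalDiff (σ h : ℝ) (ξ : Space d) : ℂ :=
  σ * diffQuot (σ * lastCoord ((2 * Real.pi) • ξ)) h

theorem normalDiff_eq (σ h : ℝ) (ξ : Space d) : normalDiff σ h ξ =
    σ / (Complex.I * h) * (1 - translationSymbol (EuclideanSpace.single (Fin.last d) (σ * h)) ξ) := by
  rw [normalDiff, diffQuot, translationSymbol_single, lastCoord]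
  rw [show -(σ * ((2 * Real.pi) • ξ) (Fin.last d) * h) = -((2 * Real.pi) • ξ) (Fin.last d) * (σ * h)
    by ring]
  ring

theorem translationSymbol_last_mem {h : ℝ} (hh : 0 < h) :
    translationSymbol (EuclideanSpace.single (Fin.last d) (σ * h)) ∈ supportSymbols d σ := by
  refine translationSymbol_mem ?_
  simp only [lastCoord, PiLp.single_apply, if_true]
  rw [← mul_assoc]
  exact mul_nonneg (mul_self_nonneg σ) hh.le

theorem normalDiff_mem {h : ℝ} (hh : 0 < h) : normalDiff σ h ∈ supportSymbols d σ := by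
  have h1 := Subalgebra.smul_mem _ (Subalgebra.sub_mem _ (Subalgebra.one_mem (supportSymbols d σ))
    (translationSymbol_last_mem hh)) ((σ : ℂ) / (Complex.I * h))
  convert h1 using 1
  funext ξ
  rw [normalDiff_eq]
  rfl

theorem norm_normalDiff_le (hσ : σ ^ 2 = 1) {h : ℝ} (hh : 0 < h) (ξ : Space d) :
    ‖normalDiff σ h ξ‖ ≤ |lastCoord ((2 * Real.pi) • ξ)| := by
  have h1 := norm_diffQuot_le (σ * lastCoord ((2 * Real.pi) • ξ)) hh
  have h2 : |σ| = 1 := abs_eq_one_of_sq hσ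
  rw [abs_mul, h2, one_mul] at h1
  rwa [normalDiff, norm_mul, Complex.norm_real, Real.norm_eq_abs, h2, one_mul]

theorem tendsto_normalDiff (hσ : σ ^ 2 = 1) (ξ : Space d) :
    Tendsto (fun j : ℕ => normalDiff σ (1 / ((j : ℝ) + 1)) ξ) atTop
      (𝓝 (lastCoord ((2 * Real.pi) • ξ) : ℂ)) := by
  have h1 := (tendsto_diffQuot (σ * lastCoord ((2 * Real.pi) • ξ))).const_mul (σ : ℂ)
  have h2 : (σ : ℂ) * ((σ * lastCoord ((2 * Real.pi) • ξ) : ℝ) : ℂ)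
      = (lastCoord ((2 * Real.pi) • ξ) : ℂ) := by
    have h3 : (σ : ℂ) ^ 2 = 1 := by exact_mod_cast hσ
    push_cast
    linear_combination (lastCoord ((2 * Real.pi) • ξ) : ℂ) * h3
  rwa [h2] at h1

/-- Shows the discretised factor as `1 + hc` minus a translation into the half space. Since `|1 +
hc| > 1` when `Re c > 0`, it can be inverted by a Neumann series. -/
theorem normalDiff_sub {h : ℝ} (hh : 0 < h) (ξ : Space d) (c : ℂ) :
    normalDiff σ h ξ - σ * Complex.I * c = σ / (Complex.I * h) *
      (1 + h * c - translationSymbol (EuclideanSpace.single (Fin.last d) (σ * h)) ξ) := by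
  have hh' : (h : ℂ) ≠ 0 := by exact_mod_cast hh.ne'
  rw [normalDiff_eq]
  field_simp
  linear_combination (-(σ : ℂ) * h * c) * Complex.I_sq

/-- The limit `h → 0` of the inverses of the discretised factors `normalDiff σ h - σic`. They are
uniformly bounded by `ε⁻¹`, because `|1 + hc - z| ≥ hε` for `|z| = 1`. The sign of `σ` ties the half
plane of the root to the half space that is preserved. -/
theorem inv_normal_sub_mem (hσ : σ ^ 2 = 1) {c : ℝ → ℂ} (hc : ContinuousOn c (Ici 0)) {ε : ℝ}
    (hε : 0 < ε) (hcε : ∀ l, 0 ≤ l → ε ≤ (c l).re) :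
    (fun ξ : Space d => ((lastCoord ((2 * Real.pi) • ξ) : ℂ) -
      σ * Complex.I * c (tangentialSq ((2 * Real.pi) • ξ)))⁻¹) ∈ supportSymbols d σ := by
  have hσ0 : σ ≠ 0 := fun h => by simp [h] at hσ
  have hσ1 : |σ| = 1 := abs_eq_one_of_sq hσ
  refine supportSymbols_of_tendsto (C := ε⁻¹)
    (m := fun j ξ => (normalDiff σ (1 / ((j : ℝ) + 1)) ξ -
      σ * Complex.I * c (tangentialSq ((2 * Real.pi) • ξ)))⁻¹) (fun j => ?_) (fun ξ => ?_)
    fun j ξ => ?_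
  · have hh : (0 : ℝ) < 1 / ((j : ℝ) + 1) := by positivity
    generalize 1 / ((j : ℝ) + 1) = h at *
    have hlow : ∀ l, 0 ≤ l → 1 + h * ε ≤ ‖1 + h * c l‖ := fun l hl => by
      refine le_trans ?_ (Complex.re_le_norm _)
      have := mul_le_mul_of_nonneg_left (hcε l hl) hh.le
      simpa using this
    have hpos : 0 < 1 + h * ε := by positivity
    have hne : ∀ l, 0 ≤ l → 1 + h * c l ≠ 0 := fun l hl =>
      norm_pos_iff.1 (hpos.trans_le (hlow l hl))
    have hbn : ∀ l, 0 ≤ l → ‖(1 + h * c l)⁻¹‖ ≤ (1 + h * ε)⁻¹ := fun l hl => by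
      rw [norm_inv]
      exact inv_anti₀ hpos (hlow l hl)
    have hb := tangential_mem (d := d) (σ := σ) (b := fun l => (1 + h * c l)⁻¹)
      ((continuousOn_const.add (continuousOn_const.mul hc)).inv₀ hne) hbn
    have hz := translationSymbol_last_mem (d := d) (σ := σ) hh
    have ha := Subalgebra.mul_mem _ hb hz
    have hr : (1 + h * ε)⁻¹ < 1 := inv_lt_one_of_one_lt₀ (by linarith [mul_pos hh hε])
    have h1 := supportSymbols_inv_one_sub ha hr fun ξ => by
      rw [Pi.mul_apply, norm_mul, norm_translationSymbol, mul_one]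
      exact hbn _ (tangentialSq_nonneg _)
    have h2 := Subalgebra.smul_mem _ (Subalgebra.mul_mem _ hb h1) (Complex.I * h / σ)
    convert h2 using 1
    funext ξ
    have h3 := hne _ (tangentialSq_nonneg ((2 * Real.pi) • ξ))
    rw [normalDiff_sub hh]
    simp only [Pi.smul_apply, Pi.mul_apply, smul_eq_mul]
    rw [mul_inv, inv_div, ← mul_inv]
    congr 2
    rw [mul_sub, mul_one, mul_inv_cancel_left₀ h3]
  · have h1 : (lastCoord ((2 * Real.pi) • ξ) : ℂ) -
        σ * Complex.I * c (tangentialSq ((2 * Real.pi) • ξ)) ≠ 0 := fun h => by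
      have h2 := congrArg Complex.im h
      simp at h2
      rcases h2 with h2 | h2
      · exact hσ0 h2
      · have := hcε _ (tangentialSq_nonneg ((2 * Real.pi) • ξ))
        linarith
    exact ((tendsto_normalDiff hσ ξ).sub_const _).inv₀ h1
  · have hh : (0 : ℝ) < 1 / ((j : ℝ) + 1) := by positivity
    generalize 1 / ((j : ℝ) + 1) = h at *
    rw [norm_inv]
    refine inv_anti₀ hε ?_
    rw [normalDiff_sub hh, norm_mul, norm_div, norm_mul, Complex.norm_I, Complex.norm_real,
      Complex.norm_real, Real.norm_eq_abs, hσ1, one_mul, Real.norm_of_nonneg hh.le, one_div,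
      le_inv_mul_iff₀ hh]
    refine le_trans ?_ (Complex.re_le_norm _)
    have h1 := mul_le_mul_of_nonneg_left
      (hcε _ (tangentialSq_nonneg ((2 * Real.pi) • ξ))) hh.le
    have h2 := Complex.re_le_norm
      (translationSymbol (EuclideanSpace.single (Fin.last d) (σ * h)) ξ)
    rw [norm_translationSymbol] at h2
    simp
    linarith

/-- A differential operator in `x_n` is local, so the half space `σ` and the sign `σ'` in the symbol
are independent. The symbol is approximated by elements of the algebra, and `hK` makes their common
majorant times `f̂` square integrable, being at most `K |ĝ|`. -/
theorem halfSupported_polynomial (hσ : σ ^ 2 = 1) {p q : ℝ → ℂ} (hp : ContinuousOn p (Ici 0))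
    (hq : ContinuousOn q (Ici 0)) {σ' K : ℝ} (hσ' : |σ'| = 1) {f g : L2Space d}
    (hK : ∀ ξ : Space d, |lastCoord ((2 * Real.pi) • ξ)| ^ 2 +
      ‖q (tangentialSq ((2 * Real.pi) • ξ))‖ * |lastCoord ((2 * Real.pi) • ξ)| +
      ‖p (tangentialSq ((2 * Real.pi) • ξ))‖ ≤
      K * ‖(lastCoord ((2 * Real.pi) • ξ) : ℂ) ^ 2 - σ' * Complex.I *
        q (tangentialSq ((2 * Real.pi) • ξ)) * (lastCoord ((2 * Real.pi) • ξ) : ℂ) -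
        p (tangentialSq ((2 * Real.pi) • ξ))‖)
    (hfg : ∀ᵐ ξ, fourierL2 g ξ = ((lastCoord ((2 * Real.pi) • ξ) : ℂ) ^ 2 - σ' * Complex.I *
        q (tangentialSq ((2 * Real.pi) • ξ)) * (lastCoord ((2 * Real.pi) • ξ) : ℂ) -
        p (tangentialSq ((2 * Real.pi) • ξ))) * fourierL2 f ξ)
    (hf : HalfSupported σ f) : HalfSupported σ g := by
  -- A tangential cut-off with values in `[0, 1]` that tends to `1` and makes `p ψ` and `q ψ`
  -- bounded by `j + 1`.
  let ψ : ℕ → ℝ → ℝ := fun j l => (1 + (‖p l‖ + ‖q l‖) / ((j : ℝ) + 1))⁻¹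
  have hden : ∀ (j : ℕ) (l : ℝ), 1 ≤ 1 + (‖p l‖ + ‖q l‖) / ((j : ℝ) + 1) := fun j l =>
    le_add_of_nonneg_right (by positivity)
  have hψ0 : ∀ j l, 0 ≤ ψ j l := fun j l =>
    inv_nonneg.2 (zero_le_one.trans (hden j l))
  have hψ1 : ∀ j l, ψ j l ≤ 1 := fun j l => inv_le_one_of_one_le₀ (hden j l)
  have hψc : ∀ j, ContinuousOn (fun l => (ψ j l : ℂ)) (Ici 0) := fun j =>
    Complex.continuous_ofReal.comp_continuousOn ((continuousOn_const.add
      ((hp.norm.add hq.norm).div_const _)).inv₀ fun l _ => (zero_lt_one.trans_le (hden j l)).ne')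
  have hψb : ∀ j l, (‖p l‖ + ‖q l‖) * ψ j l ≤ j + 1 := fun j l => by
    have hj : (0 : ℝ) < (j : ℝ) + 1 := by positivity
    rw [← div_eq_mul_inv, div_le_iff₀ (zero_lt_one.trans_le (hden j l))]
    field_simp
    linarith
  have hψlim : ∀ l, Tendsto (fun j => (ψ j l : ℂ)) atTop (𝓝 1) := fun l => by
    have h1 : Tendsto (fun j : ℕ => (‖p l‖ + ‖q l‖) * (1 / ((j : ℝ) + 1))) atTop (𝓝 0) := by
      simpa using tendsto_one_div_add_atTop_nhds_zero_nat.const_mul (‖p l‖ + ‖q l‖)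
    have h2 := (h1.const_add 1).inv₀ (by norm_num)
    have h3 := (Complex.continuous_ofReal.tendsto _).comp h2
    simpa [ψ, Function.comp_def, div_eq_mul_inv] using h3
  have hpm : ∀ j, (fun ξ : Space d => p (tangentialSq ((2 * Real.pi) • ξ)) *
      (ψ j (tangentialSq ((2 * Real.pi) • ξ)) : ℂ)) ∈ supportSymbols d σ := fun j =>
    tangential_mem (b := fun l => p l * (ψ j l : ℂ)) (hp.mul (hψc j)) (C := j + 1) fun l _ => by
      rw [norm_mul, Complex.norm_real, Real.norm_of_nonneg (hψ0 j l)]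
      refine le_trans ?_ (hψb j l)
      have := hψ0 j l
      gcongr
      linarith [norm_nonneg (q l)]
  have hqm : ∀ j, (fun ξ : Space d => q (tangentialSq ((2 * Real.pi) • ξ)) *
      (ψ j (tangentialSq ((2 * Real.pi) • ξ)) : ℂ)) ∈ supportSymbols d σ := fun j =>
    tangential_mem (b := fun l => q l * (ψ j l : ℂ)) (hq.mul (hψc j)) (C := j + 1) fun l _ => by
      rw [norm_mul, Complex.norm_real, Real.norm_of_nonneg (hψ0 j l)]
      refine le_trans ?_ (hψb j l)
      have := hψ0 j l
      gcongr
      linarith [norm_nonneg (p l)]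
  have hpc : Continuous fun ξ : Space d => p (tangentialSq ((2 * Real.pi) • ξ)) :=
    hp.comp_continuous continuous_tangentialSq_smul fun _ => tangentialSq_nonneg _
  have hqc : Continuous fun ξ : Space d => q (tangentialSq ((2 * Real.pi) • ξ)) :=
    hq.comp_continuous continuous_tangentialSq_smul fun _ => tangentialSq_nonneg _
  have hBc : Continuous fun ξ : Space d => |lastCoord ((2 * Real.pi) • ξ)| ^ 2 +
      ‖q (tangentialSq ((2 * Real.pi) • ξ))‖ * |lastCoord ((2 * Real.pi) • ξ)| +
      ‖p (tangentialSq ((2 * Real.pi) • ξ))‖ :=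
    ((continuous_lastCoord_smul.abs.pow 2).add (hqc.norm.mul continuous_lastCoord_smul.abs)).add
      hpc.norm
  refine halfSupported_of_tendsto (B := fun ξ => |lastCoord ((2 * Real.pi) • ξ)| ^ 2 +
      ‖q (tangentialSq ((2 * Real.pi) • ξ))‖ * |lastCoord ((2 * Real.pi) • ξ)| +
      ‖p (tangentialSq ((2 * Real.pi) • ξ))‖)
    (m := fun j ξ => normalDiff σ (1 / ((j : ℝ) + 1)) ξ ^ 2 -
      σ' * Complex.I * (q (tangentialSq ((2 * Real.pi) • ξ)) *
        (ψ j (tangentialSq ((2 * Real.pi) • ξ)) : ℂ)) * normalDiff σ (1 / ((j : ℝ) + 1)) ξ -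
      p (tangentialSq ((2 * Real.pi) • ξ)) * (ψ j (tangentialSq ((2 * Real.pi) • ξ)) : ℂ))
    (fun j => ?_) (fun ξ => ?_) (fun j ξ => ?_) ?_ hfg hf
  · have hh : (0 : ℝ) < 1 / ((j : ℝ) + 1) := by positivity
    have hn := normalDiff_mem (d := d) (σ := σ) hh
    exact Subalgebra.sub_mem _ (Subalgebra.sub_mem _ (Subalgebra.pow_mem _ hn 2)
      (Subalgebra.mul_mem _ (Subalgebra.smul_mem _ (hqm j) (σ' * Complex.I)) hn)) (hpm j)
  · have h1 := tendsto_normalDiff hσ ξ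
    have h2 := hψlim (tangentialSq ((2 * Real.pi) • ξ))
    have h3 := ((h1.pow 2).sub (((h2.const_mul (q (tangentialSq ((2 * Real.pi) • ξ)))).const_mul
      (σ' * Complex.I)).mul h1)).sub (h2.const_mul (p (tangentialSq ((2 * Real.pi) • ξ))))
    simpa only [mul_one] using h3
  · have hh : (0 : ℝ) < 1 / ((j : ℝ) + 1) := by positivity
    have hn := norm_normalDiff_le hσ hh ξ
    have h0 := hψ0 j (tangentialSq ((2 * Real.pi) • ξ))
    have h1 := hψ1 j (tangentialSq ((2 * Real.pi) • ξ))
    refine (norm_sub_le _ _).trans (add_le_add ((norm_sub_le _ _).trans (add_le_add ?_ ?_)) ?_)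
    · rw [norm_pow]; gcongr
    · simp only [norm_mul, Complex.norm_real, Real.norm_eq_abs, hσ', Complex.norm_I, one_mul,
        abs_of_nonneg h0]
      gcongr
      exact mul_le_of_le_one_right (norm_nonneg _) h1
    · rw [norm_mul, Complex.norm_real, Real.norm_of_nonneg h0]
      exact mul_le_of_le_one_right (norm_nonneg _) h1
  · refine (Lp.memLp (fourierL2 g)).of_le_mul (c := K)
      (hBc.aestronglyMeasurable.mul (Lp.aestronglyMeasurable _).norm) ?_
    filter_upwards [hfg] with ξ h1
    rw [h1, norm_mul, norm_mul, norm_norm, ← mul_assoc, Real.norm_of_nonneg (by positivity)]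
    gcongr
    exact hK ξ

end NormalSymbols

/-! ### Support preservation for the factors and their inverses. -/

section Support

variable {T : ℝ} [hT : Fact (0 < T)] {d : ℕ} {σ : ℝ}

theorem halfSupported_timeCoeff_iff (f : L2G T d) :
    (∀ᵐ z ∂haarG T d, σ * lastCoord z.2 < 0 → f z = 0) ↔
      ∀ k, HalfSupported σ (timeCoeff f k) := by
  constructor
  · intro h k
    filter_upwards [ae_slice h, timeCoeff_ae f k] with x h1 h2 hx
    rw [h2]
    have h3 : (fun t => f (t, x)) =ᵐ[AddCircle.haarAddCircle] fun _ => 0 := by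
      filter_upwards [h1] with t ht using ht hx
    rw [congrFun (fourierCoeff_congr_ae h3) k]
    simp [fourierCoeff]
  · intro h
    let S : Set (AddCircle T × Space d) := {z | σ * lastCoord z.2 < 0}
    have hS : MeasurableSet S := by
      have : Continuous fun z : AddCircle T × Space d => σ * lastCoord z.2 := by
        unfold lastCoord; fun_prop
      exact this.measurable measurableSet_Iio
    -- The indicator of `S` depends on `x` only, so restricting `f` to `S` restricts each time
    -- coefficient. All of them vanish there, and a function is determined by its coefficients.
    obtain ⟨g, hg, -⟩ := exists_mul (κ := haarG T d) (m := S.indicator 1) (C := 1)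
      ((measurable_one.indicator hS).aestronglyMeasurable)
      (Eventually.of_forall fun z => by
        by_cases hz : z ∈ S <;> simp [hz]) f
    have hg0 : g = 0 := by
      refine eq_zero_of_fourierG g fun k => (timeCoeff_eq_zero_iff g k).1 (Lp.ext ?_)
      filter_upwards [ae_slice hg, timeCoeff_ae g k, timeCoeff_ae f k, h k,
        Lp.coeFn_zero ℂ 2 (volume : Measure (Space d))] with x h1 h2 h3 h4 h5
      rw [h2, h5, congrFun (fourierCoeff_congr_ae h1) k, Pi.zero_apply]
      by_cases hx : σ * lastCoord x < 0
      · have : ∀ t, S.indicator (1 : AddCircle T × Space d → ℂ) (t, x) = 1 := fun t => indicator_of_mem (s := S) hx _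
        simp only [this, one_mul]
        rw [← h3, h4 hx]
      · have : ∀ t, S.indicator (1 : AddCircle T × Space d → ℂ) (t, x) = 0 := fun t =>
          indicator_of_notMem (s := S) hx _
        simp only [this, zero_mul]
        simp [fourierCoeff]
    rw [hg0] at hg
    filter_upwards [hg, Lp.coeFn_zero ℂ 2 (haarG T d)] with z h1 h2 hz
    rw [h2, indicator_of_mem (s := S) hz] at h1
    simpa using h1.symm

theorem isSupportedUpper_iff (f : L2G T d) :
    IsSupportedUpper f ↔ ∀ k, HalfSupported 1 (timeCoeff f k) := by
  rw [← halfSupported_timeCoeff_iff, IsSupportedUpper]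
  simp only [one_mul]

theorem isSupportedLower_iff (f : L2G T d) :
    IsSupportedLower f ↔ ∀ k, HalfSupported (-1) (timeCoeff f k) := by
  rw [← halfSupported_timeCoeff_iff, IsSupportedLower]
  simp only [neg_one_mul, neg_lt_zero]

theorem IsOp.halfSupported {μ μ' : OrderFn} {m : ℝ × Space d → ℂ}
    {A : NewtonSpace T d μ →L[ℂ] NewtonSpace T d μ'} (hA : IsOp m A)
    (hm : ∀ k : ℤ, k ≠ 0 → ∀ f g : L2Space d,
      (∀ᵐ ξ, fourierL2 g ξ = m (freq T k ξ) * fourierL2 f ξ) →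
        HalfSupported σ f → HalfSupported σ g)
    {f : NewtonSpace T d μ} (hf : ∀ k, HalfSupported σ (timeCoeff (toL2 f) k)) (k : ℤ) :
    HalfSupported σ (timeCoeff (toL2 (A f)) k) := by
  by_cases hk : k = 0
  · subst hk
    rw [(timeCoeff_eq_zero_iff _ _).2 (fourierG_toL2_zero (A f))]
    exact HalfSupported.zero σ
  · refine hm k hk _ _ ?_ (hf k)
    filter_upwards [hA f k] with ξ h1
    rw [if_neg (mt (freq_fst_eq_zero (T := T) k ξ).1 hk)] at h1
    exact h1

theorem continuousOn_constCoeff {τ : ℝ} (hτ : τ ≠ 0) : ContinuousOn (constCoeff τ) (Ici 0) := by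
  intro l hl
  have h1 : Continuous fun l : ℝ => baseSymbol τ l := by unfold baseSymbol; fun_prop
  exact ((contDiffAt_csqrt (baseSymbol_mem hτ hl)).continuousAt.comp
    (h1.continuousAt (x := l))).continuousWithinAt

theorem continuousOn_linCoeff {τ : ℝ} (hτ : τ ≠ 0) : ContinuousOn (linCoeff τ) (Ici 0) := by
  intro l hl
  have h1 : Continuous fun l : ℝ => 2 * (l : ℂ) + Complex.I * τ := by fun_prop
  exact ContinuousAt.comp_continuousWithinAt
    (f := fun l : ℝ => 2 * (l : ℂ) + Complex.I * τ + 2 * constCoeff τ l)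
    (contDiffAt_csqrt (linCoeff_sq_mem hτ hl)).continuousAt
    (h1.continuousWithinAt.add (continuousWithinAt_const.mul (continuousOn_constCoeff hτ l hl)))

/-- The factors are polynomials in `ξ_n`, hence preserve both supports. -/
theorem factorSymbol_halfSupported (hσ : σ ^ 2 = 1) {σ' : ℝ} (hσ' : σ' = 1 ∨ σ' = -1) {k : ℤ}
    (hk : k ≠ 0) {f g : L2Space d}
    (hfg : ∀ᵐ ξ, fourierL2 g ξ = factorSymbol σ' (freq T k ξ) * fourierL2 f ξ)
    (hf : HalfSupported σ f) : HalfSupported σ g := by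
  have hlam : 0 < 2 * Real.pi / T := div_pos Real.two_pi_pos hT.out
  have hτ : 2 * Real.pi * k / T ≠ 0 := mt (freq_fst_eq_zero (d := d) (T := T) k 0).1 hk
  refine halfSupported_polynomial hσ (continuousOn_constCoeff hτ) (continuousOn_linCoeff hτ)
    -- The terms add up to at most `5 halfWeight`, and ellipticity is applied with `lam = 2π/T`, the
    -- smallest nonzero frequency in time.
    (σ' := σ') (K := 5 * (40 * (1 + (2 * Real.pi / T)⁻¹)))
    (by rcases hσ' with rfl | rfl <;> simp) (fun ξ => ?_) hfg hf
  have h1 := norm_terms_le (freq T k ξ)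
  have h2 := halfWeight_le_norm_factorSymbol hσ' hlam (le_abs_freq_fst hk ξ)
  have h3 := abs_lastCoord_le (freq T k ξ).2
  have h4 : |lastCoord (freq T k ξ).2| ^ 2 +
      ‖linCoeff (freq T k ξ).1 (tangentialSq (freq T k ξ).2)‖ * |lastCoord (freq T k ξ).2| +
      ‖constCoeff (freq T k ξ).1 (tangentialSq (freq T k ξ).2)‖ ≤
      5 * (40 * (1 + (2 * Real.pi / T)⁻¹)) * ‖factorSymbol σ' (freq T k ξ)‖ := by
    refine le_trans ?_ (h1.trans ?_)
    · gcongr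
    · rw [mul_assoc]; gcongr
  exact h4

/-- The inverse factors are bounded and holomorphic in a half plane, hence preserve one support. -/
theorem inv_factorSymbol_mem (hσ : σ ^ 2 = 1) {k : ℤ} (hk : k ≠ 0) :
    (fun ξ : Space d => (factorSymbol σ (freq T k ξ))⁻¹) ∈ supportSymbols d σ := by
  have hτ : 2 * Real.pi * k / T ≠ 0 := mt (freq_fst_eq_zero (d := d) (T := T) k 0).1 hk
  obtain ⟨b₁, b₂, hs, hq, hb⟩ := exists_shifts hτ
  have hb1 : b₁.im ≠ 0 := fun h => by simp [h] at hb
  have hb2 : b₂.im ≠ 0 := fun h => by simp [h] at hb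
  have key : ∀ b : ℂ, b.im ≠ 0 → (fun ξ : Space d => ((lastCoord ((2 * Real.pi) • ξ) : ℂ) -
      σ * Complex.I * csqrt (tangentialSq ((2 * Real.pi) • ξ) + b))⁻¹) ∈ supportSymbols d σ := by
    intro b hb
    -- Each linear factor is inverted separately; its root has distance at least `Re √b` from the
    -- real axis for every `ξ'`.
    refine inv_normal_sub_mem hσ (c := fun l : ℝ => csqrt (l + b)) (ε := (csqrt b).re) ?_
      (csqrt_re_pos (mem_slitPlane_of_im_ne_zero hb)) fun l hl => csqrt_re_le hl hb
    intro l _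
    have h1 : Continuous fun l : ℝ => (l : ℂ) + b := by fun_prop
    have h2 : (l : ℂ) + b ∈ Complex.slitPlane := mem_slitPlane_of_im_ne_zero (by simpa using hb)
    exact (ContinuousAt.comp (f := fun l : ℝ => (l : ℂ) + b) (contDiffAt_csqrt h2).continuousAt
      h1.continuousAt).continuousWithinAt
  have h1 := Subalgebra.mul_mem _ (key b₁ hb1) (key b₂ hb2)
  convert h1 using 1
  funext ξ
  rw [Pi.mul_apply, ← mul_inv]
  congr 1
  exact factorSymbol_eq hτ hs hq hb hσ _

end Support
end CHG
open CHG
theorem mainTheorem8 (T : ℝ) [Fact (0 < T)] (d : ℕ) :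
    ∃ Dp Dm : ℝ × Space d → ℂ,
      (∀ p : ℝ × Space d, p.1 ≠ 0 →
        Dp p = rootFactor {z | 0 < z.im} p ∧ Dm p = rootFactor {z | z.im < 0} p ∧
          chgSymbol p = Dm p * Dp p) ∧
      IsPerpSymbol T Dp ∧ IsPerpSymbol T Dm ∧
      IsNElliptic Dp ((1 / 2 : ℝ) • chgOrder) ∧ IsNElliptic Dm ((1 / 2 : ℝ) • chgOrder) ∧
      ∀ ν : OrderFn, IsStrictlyPositiveOrder ν →
        ∃ (A : NewtonSpace T d (chgOrder + ν) ≃L[ℂ] NewtonSpace T d ν)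
          (Ap : NewtonSpace T d (chgOrder + ν) ≃L[ℂ]
            NewtonSpace T d ((1 / 2 : ℝ) • chgOrder + ν))
          (Am : NewtonSpace T d ((1 / 2 : ℝ) • chgOrder + ν) ≃L[ℂ] NewtonSpace T d ν),
          IsOp chgSymbol (A : NewtonSpace T d (chgOrder + ν) →L[ℂ] NewtonSpace T d ν) ∧
          IsOp Dp (Ap : NewtonSpace T d (chgOrder + ν) →L[ℂ]
            NewtonSpace T d ((1 / 2 : ℝ) • chgOrder + ν)) ∧
          IsOp Dm (Am : NewtonSpace T d ((1 / 2 : ℝ) • chgOrder + ν) →L[ℂ] NewtonSpace T d ν) ∧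
          IsAdmissible ((1 / 2 : ℝ) • chgOrder) A Ap Am := by
  have hT : 0 < T := Fact.out
  have hlam : 0 < 2 * Real.pi / T := div_pos Real.two_pi_pos hT
  refine ⟨factorSymbol 1, factorSymbol (-1), fun p hp => ⟨(rootFactor_eq hp).1,
    (rootFactor_eq hp).2, chgSymbol_eq_mul p⟩, isPerpSymbol_factorSymbol hT 1,
    isPerpSymbol_factorSymbol hT (-1), isNElliptic_factorSymbol (Or.inl rfl),
    isNElliptic_factorSymbol (Or.inr rfl), fun ν hν => ?_⟩
  have hhalf := half_chgOrder_isStrictlyPositiveOrder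
  obtain ⟨A, hA, -⟩ := (hasGrowth_chgSymbol (d := d) hlam).exists_isOp_equiv
    measurable_chgSymbol chgOrder_isStrictlyPositiveOrder hν
  obtain ⟨Am, hAm, hAm'⟩ := (hasGrowth_factorSymbol (d := d) (Or.inr rfl) hlam).exists_isOp_equiv
    (measurable_factorSymbol _) hhalf hν
  obtain ⟨Ap, hAp, hAp'⟩ : ∃ Ap : NewtonSpace T d (chgOrder + ν) ≃L[ℂ]
      NewtonSpace T d ((1 / 2 : ℝ) • chgOrder + ν),
      IsOp (factorSymbol 1) (Ap : NewtonSpace T d (chgOrder + ν) →L[ℂ]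
        NewtonSpace T d ((1 / 2 : ℝ) • chgOrder + ν)) ∧
      IsOp (fun p => (factorSymbol 1 p)⁻¹) (Ap.symm :
        NewtonSpace T d ((1 / 2 : ℝ) • chgOrder + ν) →L[ℂ] NewtonSpace T d (chgOrder + ν)) := by
    -- The general isomorphism has source order `μ + ν'`, here with `ν' = μ_D/2 + ν`. The spaces
    -- depend on the order function, so the equality is rewritten in the goal before it is applied.
    have e : chgOrder + ν = (1 / 2 : ℝ) • chgOrder + ((1 / 2 : ℝ) • chgOrder + ν) := by
      rw [← add_assoc, ← chgOrder_eq_add]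
    rw [e]
    exact (hasGrowth_factorSymbol (d := d) (Or.inl rfl) hlam).exists_isOp_equiv
      (measurable_factorSymbol _) hhalf (hhalf.add hν)
  refine ⟨A, Ap, Am, hA, hAp, hAm, ?_⟩
  have h1 : (1 : ℝ) ^ 2 = 1 := by norm_num
  have h2 : (-1 : ℝ) ^ 2 = 1 := by norm_num
  refine ⟨chgOrder_isStrictlyPositiveOrder, hν, hhalf, hhalf, chgOrder_eq_add, fun f => ?_,
    fun f hf => ?_, fun f hf => ?_, fun f hf => ?_, fun f hf => ?_, fun f hf => ?_⟩
  · refine toL2_injective (fourierG_ext fun k => ?_)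
    filter_upwards [hA f k, hAp f k, hAm (Ap f) k] with ξ e1 e2 e3
    refine e1.trans (Eq.trans ?_ e3.symm)
    refine Eq.trans ?_ (congrArg _ e2.symm)
    -- At time frequency zero all three symbols are cut off to zero; elsewhere the pointwise
    -- factorization applies.
    split_ifs
    · ring
    · rw [chgSymbol_eq_mul, mul_assoc]
  · rw [isSupportedLower_iff] at hf ⊢
    exact hAp.halfSupported
      (fun k hk f g hfg => factorSymbol_halfSupported h2 (Or.inl rfl) hk hfg) hf
  · rw [isSupportedLower_iff] at hf ⊢
    exact hAm.halfSupported
      (fun k hk f g hfg => factorSymbol_halfSupported h2 (Or.inr rfl) hk hfg) hf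
  · rw [isSupportedUpper_iff] at hf ⊢
    exact hAp.halfSupported
      (fun k hk f g hfg => factorSymbol_halfSupported h1 (Or.inl rfl) hk hfg) hf
  · rw [isSupportedUpper_iff] at hf ⊢
    exact hAp'.halfSupported (fun k hk => (inv_factorSymbol_mem h1 hk).2.2) hf
  · rw [isSupportedLower_iff] at hf ⊢
    exact hAm'.halfSupported (fun k hk => (inv_factorSymbol_mem h2 hk).2.2) hf
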